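/- For strings $X,Y$ of equal length over $\mathbb{Z}$ write $X\approx Y$ if $X[i]<X[j]\Leftrightarrow Y[i]<Y[j]$ for all positions $i,j$. A string $S$ has an \emph{initial op-period} $p$ if $1\le p<|S|$ and $S$ is a prefix of a concatenation $V_2V_3\cdots V_k$ of pairwise order-equivalent ($\approx$) strings of length $p$; it is a \emph{full op-period} if moreover $p$ divides $|S|$. \textbf{Theorem.} All full op-periods of a string of length $n$ over a polynomially bounded integer alphabet can be computed in $O(n)$ time on the word RAM. Precisely, there is a single word-RAM program $P$ such that for every $k\in\mathbb{N}$ there are constants $C,c\in\mathbb{N}$ with the following property: for every string $S\in\mathbb{Z}^n$ ($n\ge 0$) with $|S[i]|\le (n+1)^k$ for all $i$, and every word length $w\ge c\log_2(n+2)$, the program $P$, run on input $S$ on a machine with $w$-bit words (signed arithmetic modulo $2^w$, where every arithmetic operation $+,-,\cdot$, integer division, remainder, every comparison and every memory access takes one step), halts after at most $C(n+1)$ steps and outputs a list, without repetitions, of exactly the full op-periods of $S$. -/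

import Mathlib

/-! ### Op-periods of strings over an integer alphabet -/

/-- Order-equivalence `X ≈ Y`: equal lengths and the same relative order of letters. -/
def OrderEquiv (X Y : List ℤ) : Prop :=
  ∃ h : X.length = Y.length, ∀ i j : Fin X.length,
    X.get i < X.get j ↔ Y.get (i.cast h) < Y.get (j.cast h)

/-- `S` has op-period `p` with shift `s ∈ {0, …, p-1}`: `p < |S|`, and `S` is a factor of some
`V₁ V₂ ⋯ V_k`, where all `V_i` have length `p` and are pairwise order-equivalent, positioned so
that `S[s+1..|S|]` is a prefix of `V₂ ⋯ V_k` (hence `S[1..s]` is a suffix of `V₁`).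
In the code `Vs` is the list `[V₂, …, V_k]`. -/
def HasOpPeriod (S : List ℤ) (p s : ℕ) : Prop :=
  s < p ∧ p < S.length ∧
    ∃ (V₁ : List ℤ) (Vs : List (List ℤ)),
      (∀ V ∈ V₁ :: Vs, V.length = p) ∧
      (∀ U ∈ V₁ :: Vs, ∀ V ∈ V₁ :: Vs, OrderEquiv U V) ∧
      S.take s <:+ V₁ ∧ S.drop s <+: Vs.flatten

/-- The set of all shifts of the op-period `p`. -/
def opShifts (S : List ℤ) (p : ℕ) : Set ℕ := {s | HasOpPeriod S p s}

/-- `p` is an initial op-period of `S`. -/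
def IsInitialOpPeriod (S : List ℤ) (p : ℕ) : Prop := 0 ∈ opShifts S p

/-- `p` is a full op-period of `S`. -/
def IsFullOpPeriod (S : List ℤ) (p : ℕ) : Prop := IsInitialOpPeriod S p ∧ p ∣ S.length

/-! ### The word RAM with unit costs

A machine word of `w` bits is read as a signed (two's complement) integer; all results are
reduced to the range `-2^(w-1) ≤ x < 2^(w-1)` by `Int.bmod · (2^w)`.
A program uses finitely many registers and finitely many arrays (its random access memory);
array cells are addressed by words. -/

namespace WordRAM

/-- Binary machine operations. -/
inductive BinOp
  | add | sub | mul | div | mod | lt | eq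

/-- The exact value of an operation, before reduction to a word.
Comparisons return `1` for true and `0` for false. -/
def BinOp.apply : BinOp → ℤ → ℤ → ℤ
  | .add, x, y => x + y
  | .sub, x, y => x - y
  | .mul, x, y => x * y
  | .div, x, y => x / y
  | .mod, x, y => x % y
  | .lt, x, y => if x < y then 1 else 0
  | .eq, x, y => if x = y then 1 else 0

/-- Expressions: constants, registers, reading the cell of array `a` whose address is given by an
expression, and machine operations. -/
inductive Expr
  | const (c : ℤ)
  | reg (x : ℕ)
  | read (a : ℕ) (i : Expr)
  | bin (o : BinOp) (e₁ e₂ : Expr)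

/-- Programs. -/
inductive Prog
  | skip
  | assign (x : ℕ) (e : Expr)
  | write (a : ℕ) (i e : Expr)
  | seq (c₁ c₂ : Prog)
  | branch (e : Expr) (c₁ c₂ : Prog)
  | loop (e : Expr) (c : Prog)

/-- Contents of the registers and of the arrays. -/
structure State where
  reg : ℕ → ℤ
  arr : ℕ → ℤ → ℤ

/-- The value of an expression on a machine with `w`-bit words. -/
def Expr.eval (w : ℕ) (σ : State) : Expr → ℤ
  | .const c => Int.bmod c (2 ^ w)
  | .reg x => σ.reg x
  | .read a i => σ.arr a (i.eval w σ)
  | .bin o e₁ e₂ => Int.bmod (o.apply (e₁.eval w σ) (e₂.eval w σ)) (2 ^ w)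

/-- Every constant, register access, memory access and operation takes one step. -/
def Expr.cost : Expr → ℕ
  | .const _ => 1
  | .reg _ => 1
  | .read _ i => i.cost + 1
  | .bin _ e₁ e₂ => e₁.cost + e₂.cost + 1

/-- Put the word `v` into register `x`. -/
def State.setReg (σ : State) (x : ℕ) (v : ℤ) : State :=
  { σ with reg := Function.update σ.reg x v }

/-- Put the word `v` into cell `i` of array `a`. -/
def State.setArr (σ : State) (a : ℕ) (i v : ℤ) : State :=
  { σ with arr := Function.update σ.arr a (Function.update (σ.arr a) i v) }

/-- `Run w c σ t τ`: on a machine with `w`-bit words, the program `c` started in state `σ` halts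
after exactly `t` steps in state `τ`. A condition is true when its value is nonzero. -/
inductive Run (w : ℕ) : Prog → State → ℕ → State → Prop
  | skip (σ : State) : Run w .skip σ 1 σ
  | assign (σ : State) (x : ℕ) (e : Expr) :
      Run w (.assign x e) σ (e.cost + 1) (σ.setReg x (e.eval w σ))
  | write (σ : State) (a : ℕ) (i e : Expr) :
      Run w (.write a i e) σ (i.cost + e.cost + 1) (σ.setArr a (i.eval w σ) (e.eval w σ))
  | seq {c₁ c₂ : Prog} {σ τ υ : State} {t₁ t₂ : ℕ} :
      Run w c₁ σ t₁ τ → Run w c₂ τ t₂ υ → Run w (.seq c₁ c₂) σ (t₁ + t₂) υ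
  | branch_true {e : Expr} {c₁ c₂ : Prog} {σ τ : State} {t : ℕ} :
      e.eval w σ ≠ 0 → Run w c₁ σ t τ → Run w (.branch e c₁ c₂) σ (e.cost + 1 + t) τ
  | branch_false {e : Expr} {c₁ c₂ : Prog} {σ τ : State} {t : ℕ} :
      e.eval w σ = 0 → Run w c₂ σ t τ → Run w (.branch e c₁ c₂) σ (e.cost + 1 + t) τ
  | loop_true {e : Expr} {c : Prog} {σ τ υ : State} {t₁ t₂ : ℕ} :
      e.eval w σ ≠ 0 → Run w c σ t₁ τ → Run w (.loop e c) τ t₂ υ →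
      Run w (.loop e c) σ (e.cost + 1 + t₁ + t₂) υ
  | loop_false {e : Expr} {c : Prog} {σ : State} :
      e.eval w σ = 0 → Run w (.loop e c) σ (e.cost + 1) σ

/-- The machine is deterministic: final state and running time are determined by the program and
the initial state. -/
theorem Run.deterministic {w : ℕ} {c : Prog} {σ τ τ₂ : State} {t t₂ : ℕ}
    (h : Run w c σ t τ) (h₂ : Run w c σ t₂ τ₂) : t = t₂ ∧ τ = τ₂ := by
  induction h generalizing t₂ τ₂ with
  | skip | assign | write => cases h₂; exact ⟨rfl, rfl⟩
  | seq _ _ ih₁ ih₂ =>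
    cases h₂ with
    | seq a b =>
      obtain ⟨rfl, rfl⟩ := ih₁ a
      obtain ⟨rfl, rfl⟩ := ih₂ b
      exact ⟨rfl, rfl⟩
  | branch_true he _ ih | branch_false he _ ih =>
    cases h₂ with
    | branch_true he₂ a =>
      first
      | exact absurd he he₂
      | (obtain ⟨rfl, rfl⟩ := ih a; exact ⟨rfl, rfl⟩)
    | branch_false he₂ a =>
      first
      | exact absurd he₂ he
      | (obtain ⟨rfl, rfl⟩ := ih a; exact ⟨rfl, rfl⟩)
  | loop_true he _ _ ih₁ ih₂ =>
    cases h₂ with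
    | loop_true _ a b =>
      obtain ⟨rfl, rfl⟩ := ih₁ a
      obtain ⟨rfl, rfl⟩ := ih₂ b
      exact ⟨rfl, rfl⟩
    | loop_false he₂ => exact absurd he₂ he
  | loop_false he =>
    cases h₂ with
    | loop_true he₂ _ _ => exact absurd he he₂
    | loop_false _ => exact ⟨rfl, rfl⟩

/-- The initial state on input `S`: register `0` holds `|S|`, array `0` holds the letters of `S` in
cells `0, …, |S|-1`, and everything else is `0`. -/
def inputState (S : List ℤ) : State where
  reg x := if x = 0 then (S.length : ℤ) else 0
  arr a i := if a = 0 ∧ 0 ≤ i then S.getD i.toNat 0 else 0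

/-- The state `τ` holds the list `L` as output: register `1` holds `|L|`, and array `1` holds the
entries of `L` in cells `0, …, |L|-1`. -/
def HasOutput (τ : State) (L : List ℕ) : Prop :=
  τ.reg 1 = (L.length : ℤ) ∧ ∀ j : Fin L.length, τ.arr 1 (j : ℕ) = (L.get j : ℤ)

end WordRAM

/-! Let `n = |S|` and let `p` be a proper divisor of `n`. The string splits into complete blocks of
length `p`, and `p` is a full op-period exactly when every block is order-equivalent to the first
(`isFullOpPeriod_iff`). Let `Z[j]` be the length of the longest factor starting at `j` that is
order-equivalent to a prefix; the condition becomes `p ≤ Z[j]` for all multiples `j` of `p` with `1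
≤ j < n`. Since `p ∣ n`, `p ∣ j` means `p ∣ gcd(j, n)`. So only the minimum `G[d]` of `Z` over each
class `gcd(j, n) = d` matters: the test is `p ≤ G[d]` for every proper divisor `d` of `n` that is a
multiple of `p`. As `n` has at most `2√n` proper divisors, trying all pairs of them is linear
(`length_divisorList_sq_le`).

The table `Z` is built as in the Z-algorithm: inside a known match, questions transfer to earlier
positions (`OpMatch.shift`), and extending a match by one letter needs only comparisons with the
predecessor and successor of that letter among the earlier ones (`OpMatch.succ_iff`). These
neighbours come from radix sorting the positions in base `n + 2`, with a number of passes depending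
only on `k`, and then deleting positions from right to left in the doubly linked sorted list
(`IsNeighbour.delete`).

Euclid's algorithm would cost a logarithm per gcd. A linear sieve instead reaches each composite
once, as its least prime factor times the cofactor, and `gcd_prime_mul` obtains the new gcd in a
constant number of steps.

On the machine side, `Ter` bounds time by a syntactic cost times a factor `F + 1`. Costs add along a
program, and only loops demand a larger factor, so linear time reduces to potential functions of
linear size. -/

namespace WordRAM

/-! ### A calculus for termination, cost and framing. -/

/-- Running sequentially through a list of programs. -/
def block : List Prog → Prog
  | [] => .skip
  | c :: cs => .seq c (block cs)

/-- A static cost: an upper bound for the running time when every loop body runs once. -/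
def Prog.cost : Prog → ℕ
  | .skip => 1
  | .assign _ e => e.cost + 1
  | .write _ i e => i.cost + e.cost + 1
  | .seq c₁ c₂ => c₁.cost + c₂.cost
  | .branch e c₁ c₂ => e.cost + 1 + (c₁.cost + c₂.cost)
  | .loop e c => c.cost + (e.cost + 1)

/-- The registers a program may write to. -/
def Prog.wregs : Prog → List ℕ
  | .skip => []
  | .assign x _ => [x]
  | .write _ _ _ => []
  | .seq c₁ c₂ => c₁.wregs ++ c₂.wregs
  | .branch _ c₁ c₂ => c₁.wregs ++ c₂.wregs
  | .loop _ c => c.wregs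

/-- The arrays a program may write to. -/
def Prog.warrs : Prog → List ℕ
  | .skip => []
  | .assign _ _ => []
  | .write a _ _ => [a]
  | .seq c₁ c₂ => c₁.warrs ++ c₂.warrs
  | .branch _ c₁ c₂ => c₁.warrs ++ c₂.warrs
  | .loop _ c => c.warrs

@[simp] theorem setReg_reg (σ : State) (x y : ℕ) (v : ℤ) :
    (σ.setReg x v).reg y = if y = x then v else σ.reg y := by
  simp [State.setReg, Function.update_apply]

@[simp] theorem setReg_arr (σ : State) (x : ℕ) (v : ℤ) : (σ.setReg x v).arr = σ.arr := rfl

@[simp] theorem setArr_reg (σ : State) (a : ℕ) (i v : ℤ) : (σ.setArr a i v).reg = σ.reg := rfl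

@[simp] theorem setArr_arr (σ : State) (a b : ℕ) (i j v : ℤ) :
    (σ.setArr a i v).arr b j = if b = a ∧ j = i then v else σ.arr b j := by
  simp only [State.setArr, Function.update_apply]
  by_cases h : b = a
  · subst h; by_cases h' : j = i <;> simp [h']
  · simp [h]

/-- `τ` agrees with `σ` on everything that `c` does not write to. -/
def Frame (c : Prog) (σ τ : State) : Prop :=
  (∀ x, x ∉ c.wregs → τ.reg x = σ.reg x) ∧ ∀ a, a ∉ c.warrs → τ.arr a = σ.arr a

theorem Frame.refl (c : Prog) (σ : State) : Frame c σ σ := ⟨fun _ _ => rfl, fun _ _ => rfl⟩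

theorem Frame.trans {c : Prog} {σ τ υ : State} (h₁ : Frame c σ τ) (h₂ : Frame c τ υ) :
    Frame c σ υ :=
  ⟨fun x hx => (h₂.1 x hx).trans (h₁.1 x hx), fun a ha => (h₂.2 a ha).trans (h₁.2 a ha)⟩

/-- Write sets are syntactic, so `decide` settles which registers and arrays survive a program, and
a specification need only describe what changes. -/
theorem Run.frame {w : ℕ} {c : Prog} {σ τ : State} {t : ℕ} (h : Run w c σ t τ) :
    Frame c σ τ := by
  induction h with
  | skip => exact Frame.refl _ _
  | assign σ x e =>
    refine ⟨fun y hy => ?_, fun _ _ => rfl⟩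
    simp only [Prog.wregs, List.mem_singleton] at hy
    simp [hy]
  | write σ a i e =>
    refine ⟨fun _ _ => rfl, fun b hb => ?_⟩
    simp only [Prog.warrs, List.mem_singleton] at hb
    funext j
    simp [hb]
  | seq _ _ ih₁ ih₂ =>
    refine ⟨fun x hx => ?_, fun a ha => ?_⟩
    · simp only [Prog.wregs, List.mem_append, not_or] at hx
      exact (ih₂.1 x hx.2).trans (ih₁.1 x hx.1)
    · simp only [Prog.warrs, List.mem_append, not_or] at ha
      exact (ih₂.2 a ha.2).trans (ih₁.2 a ha.1)
  | branch_true _ _ ih | branch_false _ _ ih =>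
    refine ⟨fun x hx => ?_, fun a ha => ?_⟩
    · simp only [Prog.wregs, List.mem_append, not_or] at hx
      first | exact ih.1 x hx.1 | exact ih.1 x hx.2
    · simp only [Prog.warrs, List.mem_append, not_or] at ha
      first | exact ih.2 a ha.1 | exact ih.2 a ha.2
  | loop_true _ _ _ ih₁ ih₂ => exact Frame.trans (c := .loop _ _) ih₁ ih₂
  | loop_false => exact Frame.refl _ _

/-- `c` started in `σ` halts in a state satisfying `Q`, within `F + 1` times its static cost. -/
def Ter (w F : ℕ) (c : Prog) (σ : State) (Q : State → Prop) : Prop :=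
  ∃ t τ, Run w c σ t τ ∧ t ≤ c.cost * (F + 1) ∧ Q τ

variable {w F : ℕ} {c c₁ c₂ : Prog} {σ : State} {Q R : State → Prop}

theorem Ter.mono_frame (h : Ter w F c σ Q) (hQ : ∀ τ, Frame c σ τ → Q τ → R τ) :
    Ter w F c σ R :=
  let ⟨t, τ, h₁, h₂, h₃⟩ := h
  ⟨t, τ, h₁, h₂, hQ τ h₁.frame h₃⟩

theorem Ter.mono (h : Ter w F c σ Q) (hQ : ∀ τ, Q τ → R τ) : Ter w F c σ R :=
  h.mono_frame fun τ _ => hQ τ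

/-- Static costs add, so sequencing keeps the factor `F`; constants never have to be tracked. -/
theorem Ter.seq (h : Ter w F c₁ σ fun τ => Ter w F c₂ τ Q) : Ter w F (.seq c₁ c₂) σ Q := by
  obtain ⟨t₁, τ, h₁, h₂, t₂, υ, h₃, h₄, h₅⟩ := h
  exact ⟨t₁ + t₂, υ, .seq h₁ h₃, by simp only [Prog.cost, add_mul]; omega, h₅⟩

theorem Ter.nil (h : Q σ) : Ter w F (block []) σ Q :=
  ⟨1, σ, .skip σ, by simp [block, Prog.cost], h⟩

theorem Ter.cons {cs : List Prog} (h : Ter w F c σ fun τ => Ter w F (block cs) τ Q) :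
    Ter w F (block (c :: cs)) σ Q := Ter.seq h

theorem Ter.assign {x : ℕ} {e : Expr} {cs : List Prog} (v : ℤ) (hv : e.eval w σ = v)
    (h : Ter w F (block cs) (σ.setReg x v) Q) : Ter w F (block (.assign x e :: cs)) σ Q :=
  Ter.cons ⟨_, _, .assign σ x e, Nat.le_mul_of_pos_right _ (by omega), by rw [hv]; exact h⟩

theorem Ter.write {a : ℕ} {i e : Expr} {cs : List Prog} (u v : ℤ) (hu : i.eval w σ = u)
    (hv : e.eval w σ = v) (h : Ter w F (block cs) (σ.setArr a u v) Q) :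
    Ter w F (block (.write a i e :: cs)) σ Q :=
  Ter.cons ⟨_, _, .write σ a i e, Nat.le_mul_of_pos_right _ (by omega), by rw [hu, hv]; exact h⟩

theorem Ter.branch {e : Expr} {cs : List Prog}
    (h₁ : e.eval w σ ≠ 0 → Ter w F c₁ σ fun τ => Ter w F (block cs) τ Q)
    (h₂ : e.eval w σ = 0 → Ter w F c₂ σ fun τ => Ter w F (block cs) τ Q) :
    Ter w F (block (.branch e c₁ c₂ :: cs)) σ Q := by
  refine Ter.cons ?_
  by_cases h : e.eval w σ = 0
  · obtain ⟨t, τ, h₃, h₄, h₅⟩ := h₂ h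
    refine ⟨_, τ, .branch_false h h₃, ?_, h₅⟩
    simp only [Prog.cost]
    nlinarith [Nat.zero_le (c₁.cost * (F + 1)), Nat.zero_le (e.cost * F)]
  · obtain ⟨t, τ, h₃, h₄, h₅⟩ := h₁ h
    refine ⟨_, τ, .branch_true h h₃, ?_, h₅⟩
    simp only [Prog.cost]
    nlinarith [Nat.zero_le (c₂.cost * (F + 1)), Nat.zero_le (e.cost * F)]

/-- The loop rule: `I` is an invariant with a ghost parameter, `Φ` a potential bounding the number
of remaining iterations. -/
theorem Ter.loop {α : Type*} {F₁ : ℕ} {e : Expr} (I : α → State → Prop) (Φ : α → ℕ) (a : α)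
    (h₀ : I a σ) (hF : (F₁ + 1) * (Φ a + 1) ≤ F + 1)
    (hs : ∀ a τ, Frame c σ τ → I a τ → e.eval w τ ≠ 0 →
      Ter w F₁ c τ fun υ => ∃ b, I b υ ∧ Φ b < Φ a) :
    Ter w F (.loop e c) σ fun τ => ∃ a, I a τ ∧ e.eval w τ = 0 := by
  suffices H : ∀ m a τ, Φ a = m → Frame c σ τ → I a τ → ∃ t υ, Run w (.loop e c) τ t υ ∧
      t ≤ (Prog.loop e c).cost * ((F₁ + 1) * (m + 1)) ∧ ∃ a, I a υ ∧ e.eval w υ = 0 by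
    obtain ⟨t, υ, h₁, h₂, h₃⟩ := H _ a σ rfl (Frame.refl _ _) h₀
    exact ⟨t, υ, h₁, h₂.trans (Nat.mul_le_mul_left _ hF), h₃⟩
  intro m
  induction m using Nat.strong_induction_on with
  | _ m ih =>
    intro a τ ha hf hI
    by_cases h : e.eval w τ = 0
    · refine ⟨_, τ, .loop_false h, ?_, a, hI, h⟩
      have : 1 ≤ (F₁ + 1) * (m + 1) := Nat.mul_pos (by omega) (by omega)
      simp only [Prog.cost]
      nlinarith
    · obtain ⟨t, υ, h₁, h₂, b, hb, hlt⟩ := hs a τ hf hI h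
      obtain ⟨t', υ', h₁', h₂', h₃'⟩ := ih (Φ b) (ha ▸ hlt) b υ rfl (hf.trans h₁.frame) hb
      refine ⟨_, υ', .loop_true h h₁ h₁', ?_, h₃'⟩
      -- The potential drops by at least one, which frees one share `F₁ + 1` to pay for this round;
      -- the extra `+ 1` in the bound pays for the final failing test.
      have h₄ : (F₁ + 1) * (Φ b + 1) + (F₁ + 1) ≤ (F₁ + 1) * (m + 1) := by
        rw [ha] at hlt
        nlinarith
      have h₅ := Nat.mul_le_mul_left (Prog.loop e c).cost h₄
      simp only [Prog.cost] at h₂' h₅ ⊢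
      nlinarith [Nat.zero_le (e.cost * F₁)]

/-- Numbers of absolute value at most `M` fit into a word. -/
structure Fits (w : ℕ) (M : ℤ) : Prop where
  one_le : 1 ≤ M
  bmod : ∀ x : ℤ, -M ≤ x → x ≤ M → Int.bmod x (2 ^ w) = x

theorem Fits.ite {M : ℤ} (h : Fits w M) (p : Prop) [Decidable p] :
    Int.bmod (if p then 1 else 0) (2 ^ w) = if p then 1 else 0 := by
  have := h.one_le
  split_ifs
  · exact h.bmod _ (by omega) (by omega)
  · exact h.bmod _ (by omega) (by omega)

/-- `for x = 0, …, y - 1` do `body`. -/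
def forLoop (x y : ℕ) (body : List Prog) : Prog :=
  block [.assign x (.const 0), .loop (.bin .lt (.reg x) (.reg y))
    (.seq (block body) (block [.assign x (.bin .add (.reg x) (.const 1))]))]

/-- Neither the counter nor the bound is written by the body, so there are exactly `N` rounds. The
counter is incremented after the body, hence the invariant for `i + 1` is asked of the state with
the counter already updated. -/
theorem Ter.forLoop {M : ℤ} (hW : Fits w M) {x y : ℕ} {body : List Prog} (N : ℕ)
    (hNM : (N : ℤ) ≤ M)
    (I : ℕ → State → Prop) (hy : σ.reg y = N) (hxy : y ≠ x) (hyb : y ∉ (block body).wregs)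
    (hxb : x ∉ (block body).wregs) (hF : N ≤ F) (h₀ : I 0 (σ.setReg x 0))
    (hs : ∀ i < N, ∀ τ, Frame (forLoop x y body) σ τ → τ.reg x = i → I i τ →
      Ter w 0 (block body) τ fun υ => I (i + 1) (υ.setReg x (i + 1))) :
    Ter w F (forLoop x y body) σ (I N) := by
  have h1 := hW.one_le
  have hwr : ∀ z, z ∉ (WordRAM.forLoop x y body).wregs ↔ z ≠ x ∧ z ∉ (block body).wregs := by
    intro z
    simp only [WordRAM.forLoop, block, Prog.wregs, List.mem_append, List.mem_singleton,
      List.not_mem_nil]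
    tauto
  refine Ter.assign 0 (hW.bmod 0 (by omega) (by omega)) (Ter.cons ?_)
  refine (Ter.loop (F₁ := 0) (fun i τ => i ≤ N ∧ τ.reg x = (i : ℕ) ∧ I i τ) (fun i => N - i) 0
    ⟨by omega, by simp, h₀⟩ (by omega) ?_).mono_frame ?_
  · rintro i τ hf ⟨hi, hx, hI⟩ hc
    have hf' : Frame (WordRAM.forLoop x y body) σ τ := by
      refine ⟨fun z hz => ?_, fun b hb => ?_⟩
      · rw [hf.1 z]
        · simp [((hwr z).1 hz).1]
        · have := (hwr z).1 hz
          simpa [Prog.wregs, block] using ⟨this.2, this.1⟩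
      · rw [hf.2 b]
        · simp
        · simpa [WordRAM.forLoop, Prog.warrs, block] using hb
    have hyτ : τ.reg y = N := by
      rw [← hy]; exact hf'.1 y ((hwr y).2 ⟨hxy, hyb⟩)
    have hiN : i < N := by
      by_contra hcon
      apply hc
      simp only [Expr.eval, BinOp.apply, hx, hyτ, hW.ite]
      rw [if_neg (by omega)]
    refine Ter.seq (Ter.mono_frame (hs i hiN τ hf' hx hI) fun υ hfυ hυ => ?_)
    refine Ter.assign ((i : ℤ) + 1) ?_ (Ter.nil ⟨i + 1, ⟨by omega, by simp, by simpa using hυ⟩,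
      by omega⟩)
    simp only [Expr.eval, BinOp.apply]
    rw [hfυ.1 x hxb, hx, hW.bmod 1 (by omega) (by omega), hW.bmod _ (by omega) (by omega)]
  · rintro τ hf ⟨i, ⟨hi, hx, hI⟩, hc⟩
    have hyτ : τ.reg y = N := by
      rw [← hy, hf.1 y (by simpa [Prog.wregs, block] using ⟨hyb, hxy⟩)]
      simp [hxy]
    have : i = N := by
      by_contra hcon
      simp only [Expr.eval, BinOp.apply, hx, hyτ, hW.ite] at hc
      rw [if_pos (by omega)] at hc
      exact one_ne_zero hc
    subst this
    exact Ter.nil hI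

end WordRAM

/-! ### The range of the letters and their shift to nonnegative values. -/

namespace WordRAM
open WordRAM.Expr WordRAM.Prog

/-- Registers `3` and `4` receive a lower and an upper bound of the letters. -/
def minMax : Prog :=
  forLoop 2 0 [assign 7 (read 0 (reg 2)),
    branch (bin .lt (reg 7) (reg 3)) (block [assign 3 (reg 7)]) (block []),
    branch (bin .lt (reg 4) (reg 7)) (block [assign 4 (reg 7)]) (block [])]

theorem minMax_spec {w n F : ℕ} {M A : ℤ} (hW : Fits w M) {σ : State} {s : ℕ → ℤ}
    (hnM : (n : ℤ) ≤ M) (h0 : σ.reg 0 = n) (h3 : σ.reg 3 = 0) (h4 : σ.reg 4 = 0)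
    (hs : ∀ i : ℕ, σ.arr 0 i = s i) (hA0 : 0 ≤ A) (hA : ∀ i < n, -A ≤ s i ∧ s i ≤ A)
    (hF : n ≤ F) :
    Ter w F minMax σ fun τ => -A ≤ τ.reg 3 ∧ τ.reg 4 ≤ A ∧ τ.reg 3 ≤ 0 ∧ 0 ≤ τ.reg 4 ∧
      ∀ i < n, τ.reg 3 ≤ s i ∧ s i ≤ τ.reg 4 := by
  -- Both bounds start at `0` and therefore enclose `0` too; this keeps their difference nonnegative
  -- even for the empty string.
  refine Ter.forLoop hW n hnM (fun i τ => -A ≤ τ.reg 3 ∧ τ.reg 4 ≤ A ∧ τ.reg 3 ≤ 0 ∧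
    0 ≤ τ.reg 4 ∧ ∀ j < i, τ.reg 3 ≤ s j ∧ s j ≤ τ.reg 4) h0 (by decide) (by decide) (by decide)
    hF (by simp [h3, h4, hA0]) ?_
  rintro i hi τ hf hx ⟨a1, a2, a3, a4, a5⟩
  have hs' : τ.arr 0 i = s i := by rw [hf.2 0 (by decide), hs]
  have := hA i hi
  refine Ter.assign (s i) (by simp [Expr.eval, hx, hs']) ?_
  refine Ter.branch (fun h => ?_) (fun h => ?_) <;>
    simp [Expr.eval, BinOp.apply, hW.ite] at h
  · refine Ter.assign (s i) (by simp [Expr.eval]) (Ter.nil ?_)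
    refine Ter.branch (fun h => ?_) (fun h => ?_) <;>
      simp [Expr.eval, BinOp.apply, hW.ite] at h
    · omega
    · refine Ter.nil (Ter.nil ?_)
      simp
      refine ⟨by omega, by omega, by omega, by omega, fun j hj => ?_⟩
      rcases hj.lt_or_eq with hj | rfl
      · have := a5 j hj; omega
      · omega
  · refine Ter.nil (Ter.branch (fun h => ?_) (fun h => ?_)) <;>
      simp [Expr.eval, BinOp.apply, hW.ite] at h
    · refine Ter.assign (s i) (by simp [Expr.eval]) (Ter.nil (Ter.nil ?_))
      simp
      refine ⟨by omega, by omega, by omega, by omega, fun j hj => ?_⟩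
      rcases hj.lt_or_eq with hj | rfl
      · have := a5 j hj; omega
      · omega
    · refine Ter.nil (Ter.nil ?_)
      simp
      refine ⟨by omega, by omega, by omega, by omega, fun j hj => ?_⟩
      rcases hj.lt_or_eq with hj | rfl
      · have := a5 j hj; omega
      · omega

/-- Shift the letters to nonnegative values in array `2`, and put the identity into array `3`. -/
def shift : Prog :=
  forLoop 2 0 [write 2 (reg 2) (bin .sub (read 0 (reg 2)) (reg 3)), write 3 (reg 2) (reg 2)]

theorem shift_spec {w n F : ℕ} {M m : ℤ} (hW : Fits w M) {σ : State} {s : ℕ → ℤ}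
    (hnM : (n : ℤ) ≤ M) (h0 : σ.reg 0 = n) (h3 : σ.reg 3 = m)
    (hs : ∀ i : ℕ, σ.arr 0 i = s i) (hM : ∀ i < n, m ≤ s i ∧ s i - m ≤ M)
    (hF : n ≤ F) :
    Ter w F shift σ fun τ => (∀ i < n, τ.arr 2 (i : ℕ) = s i - m) ∧
      ∀ i < n, τ.arr 3 (i : ℕ) = (i : ℕ) := by
  refine Ter.forLoop hW n hnM (fun i τ => (∀ j < i, τ.arr 2 (j : ℕ) = s j - m) ∧
      ∀ j < i, τ.arr 3 (j : ℕ) = (j : ℕ)) h0 (by decide) (by decide) (by decide)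
    hF (by simp) ?_
  rintro i hi τ hf hx ⟨a1, a2⟩
  have hs' : τ.arr 0 i = s i := by rw [hf.2 0 (by decide), hs]
  have h3' : τ.reg 3 = m := by rw [hf.1 3 (by decide), h3]
  have := hM i hi
  have h1 := hW.one_le
  refine Ter.write i (s i - m) (by simp [Expr.eval, hx]) ?_ ?_
  · simp [Expr.eval, BinOp.apply, hx, hs', h3']
    exact hW.bmod _ (by omega) (by omega)
  refine Ter.write i i (by simp [Expr.eval, hx]) (by simp [Expr.eval, hx]) (Ter.nil ?_)
  simp
  constructor <;> intro j hj <;> rcases hj.lt_or_eq with hj | rfl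
  · simp [hj.ne, a1 j hj]
  · simp
  · simp [hj.ne, a2 j hj]
  · simp

end WordRAM

/-! ### Ranks and the keys of radix sort. -/

/-- The number of elements of `{0, …, n - 1}` with a smaller key than `y`. -/
def keyRank (n : ℕ) (κ : ℕ → ℕ) (y : ℕ) : ℕ := ((Finset.range n).filter fun z => κ z < κ y).card

section keyRank
variable {n : ℕ} {κ κ' dig : ℕ → ℕ}

theorem keyRank_lt {y : ℕ} (hy : y < n) : keyRank n κ y < n := by
  have : (Finset.range n).filter (fun z => κ z < κ y) ⊂ Finset.range n := by
    rw [Finset.filter_ssubset]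
    exact ⟨y, Finset.mem_range.2 hy, lt_irrefl _⟩
  simpa [keyRank] using Finset.card_lt_card this

theorem keyRank_lt_keyRank {y z : ℕ} (hz : z < n) :
    keyRank n κ z < keyRank n κ y ↔ κ z < κ y := by
  constructor
  · intro h
    by_contra hcon
    refine absurd h (not_lt.2 (Finset.card_le_card fun u hu => ?_))
    simp only [Finset.mem_filter] at hu ⊢
    exact ⟨hu.1, by omega⟩
  · intro h
    refine Finset.card_lt_card ?_
    rw [Finset.ssubset_iff_of_subset]
    · exact ⟨z, by simp [hz, h], by simp⟩
    · intro u hu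
      simp only [Finset.mem_filter] at hu ⊢
      exact ⟨hu.1, by omega⟩

theorem keyRank_inj (hκ : ∀ y < n, ∀ z < n, κ y = κ z → y = z) {y z : ℕ} (hy : y < n)
    (hz : z < n) (h : keyRank n κ y = keyRank n κ z) : y = z := by
  have h₁ := keyRank_lt_keyRank (κ := κ) (y := y) hz
  have h₂ := keyRank_lt_keyRank (κ := κ) (y := z) hy
  exact hκ y hy z hz (by omega)

/-- An injective self-map of a finite set is onto. This lets a loop over places of the sorted list
be analysed through the element standing at each place. -/
theorem keyRank_surj (hκ : ∀ y < n, ∀ z < n, κ y = κ z → y = z) {i : ℕ} (hi : i < n) :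
    ∃ y < n, keyRank n κ y = i := by
  have : Set.SurjOn (keyRank n κ) (Finset.range n) (Finset.range n) :=
    Finset.surjOn_of_injOn_of_card_le _ (fun y hy => by simpa using keyRank_lt (by simpa using hy))
      (fun y hy z hz h => keyRank_inj hκ (by simpa using hy) (by simpa using hz) h) le_rfl
  obtain ⟨y, hy, h⟩ := this (show i ∈ ((Finset.range n : Finset ℕ) : Set ℕ) by simpa using hi)
  exact ⟨y, by simpa using hy, h⟩

/-- The elements before `y` are those with a smaller digit and those of the same digit that came
earlier in the previous order. The right side is what a stable counting sort computes. -/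
theorem keyRank_lex
    (h : ∀ y < n, ∀ z < n, κ' z < κ' y ↔ dig z < dig y ∨ dig z = dig y ∧ κ z < κ y) {y : ℕ}
    (hy : y < n) :
    keyRank n κ' y = ((Finset.range n).filter fun z => dig z < dig y).card +
      ((Finset.range n).filter fun z => dig z = dig y ∧ keyRank n κ z < keyRank n κ y).card := by
  rw [keyRank, ← Finset.card_union_of_disjoint]
  · congr 1
    ext z
    simp only [Finset.mem_filter, Finset.mem_range, Finset.mem_union]
    constructor
    · rintro ⟨hz, hlt⟩
      rcases (h y hy z hz).1 hlt with h' | h'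
      · exact Or.inl ⟨hz, h'⟩
      · exact Or.inr ⟨hz, h'.1, (keyRank_lt_keyRank hz).2 h'.2⟩
    · rintro (⟨hz, h'⟩ | ⟨hz, h', h''⟩)
      · exact ⟨hz, (h y hy z hz).2 (Or.inl h')⟩
      · exact ⟨hz, (h y hy z hz).2 (Or.inr ⟨h', (keyRank_lt_keyRank hz).1 h''⟩)⟩
  · rw [Finset.disjoint_filter]
    intro z _ h₁ h₂
    omega

end keyRank

/-- The key by which `t` rounds of radix sort in base `b` sort. -/
def radixKey (n b t : ℕ) (v : ℕ → ℕ) (y : ℕ) : ℕ := (v y % b ^ t) * n + y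

/-- The position is the residue of the key modulo `n`. Breaking ties by position encodes stability
and makes the rank a bijection. -/
theorem radixKey_inj {n b t : ℕ} {v : ℕ → ℕ} : ∀ y < n, ∀ z < n,
    radixKey n b t v y = radixKey n b t v z → y = z := by
  intro y hy z hz h
  have : radixKey n b t v y % n = radixKey n b t v z % n := by rw [h]
  simpa [radixKey, Nat.mul_add_mod', Nat.mod_eq_of_lt hy, Nat.mod_eq_of_lt hz] using this

theorem mul_add_lt_mul_add_iff {n a b y z : ℕ} (hy : y < n) (hz : z < n) :
    a * n + z < b * n + y ↔ a < b ∨ a = b ∧ z < y := by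
  constructor
  · intro h
    rcases lt_trichotomy a b with h' | h' | h'
    · exact Or.inl h'
    · subst h'; exact Or.inr ⟨rfl, by omega⟩
    · have : (b + 1) * n ≤ a * n := Nat.mul_le_mul_right _ h'
      rw [Nat.add_mul] at this; omega
  · rintro (h | ⟨rfl, h⟩)
    · have : (a + 1) * n ≤ b * n := Nat.mul_le_mul_right _ h
      rw [Nat.add_mul] at this; omega
    · omega

/-- The number formed by the lowest `t + 1` digits has digit `t` as its leading digit, so comparison
is lexicographic: this is the correctness of sorting by the least significant digit first. -/
theorem radixKey_succ {n b t : ℕ} {v : ℕ → ℕ} (hb : 0 < b) : ∀ y < n, ∀ z < n,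
    (radixKey n b (t + 1) v z < radixKey n b (t + 1) v y ↔
      v z / b ^ t % b < v y / b ^ t % b ∨
      v z / b ^ t % b = v y / b ^ t % b ∧ radixKey n b t v z < radixKey n b t v y) := by
  intro y hy z hz
  have hlt : ∀ x, v x % b ^ t < b ^ t := fun x => Nat.mod_lt _ (by positivity)
  have key : ∀ x, v x % b ^ (t + 1) = (v x / b ^ t % b) * b ^ t + v x % b ^ t := fun x => by
    rw [pow_succ, Nat.mod_mul]; ring
  simp only [radixKey, mul_add_lt_mul_add_iff hy hz, key,
    mul_add_lt_mul_add_iff (hlt y) (hlt z)]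
  constructor
  · rintro ((h | ⟨h, h'⟩) | ⟨h, h'⟩)
    · exact Or.inl h
    · exact Or.inr ⟨h, Or.inl h'⟩
    · have h₁ := congrArg (· / b ^ t) h
      have h₂ := congrArg (· % b ^ t) h
      simp only [Nat.mul_add_mod', Nat.mod_eq_of_lt (hlt _)] at h₂
      rw [h₂] at h
      exact Or.inr ⟨Nat.eq_of_mul_eq_mul_right (by positivity) (Nat.add_right_cancel h),
        Or.inr ⟨h₂, h'⟩⟩
  · rintro (h | ⟨h, h' | ⟨h', h''⟩⟩)
    · exact Or.inl (Or.inl h)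
    · exact Or.inl (Or.inr ⟨h, h'⟩)
    · exact Or.inr ⟨by rw [h, h'], h''⟩

theorem Finset.card_filter_range_succ (p : ℕ → Prop) [DecidablePred p] (i : ℕ) :
    ((Finset.range (i + 1)).filter p).card =
      ((Finset.range i).filter p).card + if p i then 1 else 0 := by
  rw [Finset.range_add_one, Finset.filter_insert]
  split_ifs
  · rw [Finset.card_insert_of_notMem (by simp)]
  · rfl

/-! ### One stable counting sort pass. -/

namespace WordRAM
open WordRAM.Expr WordRAM.Prog

def zeroCounts : Prog := forLoop 2 6 [write 4 (reg 2) (const 0)]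

def countDigits : Prog := forLoop 2 0
  [assign 7 (bin .mod (bin .div (read 2 (reg 2)) (reg 8)) (reg 6)),
   write 4 (reg 7) (bin .add (read 4 (reg 7)) (const 1))]

def prefixSums : Prog := forLoop 2 6
  [assign 9 (read 4 (reg 2)), write 4 (reg 2) (reg 7), assign 7 (bin .add (reg 7) (reg 9))]

/-- Array `4` holds the next free slot of each bucket; scanning array `3` in its present order makes
the pass stable. -/
def placeDigits : Prog := forLoop 2 0
  [assign 9 (read 3 (reg 2)),
   assign 7 (bin .mod (bin .div (read 2 (reg 9)) (reg 8)) (reg 6)),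
   write 5 (read 4 (reg 7)) (reg 9),
   write 4 (reg 7) (bin .add (read 4 (reg 7)) (const 1))]

def copyBack : Prog := forLoop 2 0 [write 3 (reg 2) (read 5 (reg 2))]

/-- One stable counting sort pass on the digit with place value `reg 8` in base `reg 6`. -/
def radixPass : Prog := block [zeroCounts, countDigits, assign 7 (const 0), prefixSums,
  placeDigits, copyBack]

variable {w n F b B : ℕ} {M : ℤ} {σ : State} {v κ κ' : ℕ → ℕ}

theorem zeroCounts_spec (hW : Fits w M) (hbM : (b : ℤ) ≤ M) (h6 : σ.reg 6 = b) (hF : b ≤ F) :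
    Ter w F zeroCounts σ fun τ => ∀ c < b, τ.arr 4 (c : ℕ) = 0 := by
  have h1 := hW.one_le
  refine Ter.forLoop hW b hbM (fun i τ => ∀ c < i, τ.arr 4 (c : ℕ) = 0) h6 (by decide)
    (by decide) (by decide) hF (by simp) ?_
  rintro i hi τ hf hx a1
  refine Ter.write i 0 (by simp [Expr.eval, hx]) (hW.bmod 0 (by omega) (by omega)) (Ter.nil ?_)
  simp
  intro j hj
  rcases hj.lt_or_eq with hj | rfl
  · simp [a1 j hj]
  · simp

theorem eval_digit {e : Expr} (hW : Fits w M) (hb : 0 < b) (hbM : (b : ℤ) ≤ M) {x : ℕ}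
    (hx : (x : ℤ) ≤ M) (he : e.eval w σ = x) (h6 : σ.reg 6 = b) (h8 : σ.reg 8 = B) :
    (bin .mod (bin .div e (reg 8)) (reg 6)).eval w σ = (x / B % b : ℕ) := by
  have h₀ : ∀ u : ℕ, -M ≤ u := fun u => by omega
  have h₁ : ((x / B : ℕ) : ℤ) ≤ M := by
    have := Nat.div_le_self x B
    omega
  have h₂ : ((x / B % b : ℕ) : ℤ) ≤ M := by
    have := Nat.mod_lt (x / B) hb
    omega
  simp only [Expr.eval, BinOp.apply, he, h6, h8]
  rw [← Int.natCast_div, hW.bmod _ (h₀ _) h₁, ← Int.natCast_mod, hW.bmod _ (h₀ _) h₂]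

theorem countDigits_spec (hW : Fits w M) (hnM : (n : ℤ) ≤ M) (hb : 0 < b) (hbM : (b : ℤ) ≤ M)
    (h0 : σ.reg 0 = n) (h6 : σ.reg 6 = b) (h8 : σ.reg 8 = B)
    (hv : ∀ y < n, σ.arr 2 (y : ℕ) = v y) (hvM : ∀ y < n, (v y : ℤ) ≤ M)
    (h4 : ∀ c < b, σ.arr 4 (c : ℕ) = 0) (hF : n ≤ F) :
    Ter w F countDigits σ fun τ => ∀ c < b, τ.arr 4 (c : ℕ) =
      ((Finset.range n).filter fun z => v z / B % b = c).card := by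
  have h1 := hW.one_le
  refine Ter.forLoop hW n hnM (fun i τ => ∀ c < b, τ.arr 4 (c : ℕ) =
      ((Finset.range i).filter fun z => v z / B % b = c).card) h0 (by decide)
    (by decide) (by decide) hF (by simpa using h4) ?_
  rintro i hi τ hf hx a1
  have hvi : τ.arr 2 i = v i := by rw [hf.2 2 (by decide), hv i hi]
  have hd : v i / B % b < b := Nat.mod_lt _ hb
  have hc : ((Finset.range i).filter fun z => v z / B % b = v i / B % b).card ≤ i := by
    simpa using Finset.card_filter_le (Finset.range i) fun z => v z / B % b = v i / B % b
  refine Ter.assign _ (eval_digit hW hb hbM (hvM i hi) (by simp [Expr.eval, hx, hvi])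
    ((hf.1 6 (by decide)).trans h6) ((hf.1 8 (by decide)).trans h8)) ?_
  refine Ter.write (v i / B % b : ℕ)
    (((Finset.range i).filter fun z => v z / B % b = v i / B % b).card + 1)
    (by simp [Expr.eval]) ?_ (Ter.nil ?_)
  · simp only [Expr.eval, BinOp.apply, setReg_reg, setReg_arr, if_true]
    rw [a1 _ hd, hW.bmod 1 (by omega) (by omega), hW.bmod _ (by omega) (by omega)]
  · intro c hc
    simp only [Finset.card_filter_range_succ, setReg_arr, setArr_arr, Nat.cast_inj, true_and]
    by_cases h : c = v i / B % b
    · simp [h]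
    · simp [h, Ne.symm h, a1 c hc]

theorem prefixSums_spec {dig : ℕ → ℕ} (hW : Fits w M) (hnM : (n : ℤ) ≤ M) (hbM : (b : ℤ) ≤ M)
    (h6 : σ.reg 6 = b) (h7 : σ.reg 7 = 0)
    (h4 : ∀ c < b, σ.arr 4 (c : ℕ) = ((Finset.range n).filter fun z => dig z = c).card)
    (hF : b ≤ F) :
    Ter w F prefixSums σ fun τ => ∀ c < b, τ.arr 4 (c : ℕ) =
      ((Finset.range n).filter fun z => dig z < c).card := by
  have h1 := hW.one_le
  -- Cells below `i` already hold prefix sums, the others still hold raw counts, and register `7`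
  -- carries the running sum.
  refine (Ter.forLoop hW b hbM (fun i τ =>
      τ.reg 7 = ((Finset.range n).filter fun z => dig z < i).card ∧
      (∀ c < i, τ.arr 4 (c : ℕ) = ((Finset.range n).filter fun z => dig z < c).card) ∧
      (∀ c < b, i ≤ c → τ.arr 4 (c : ℕ) = ((Finset.range n).filter fun z => dig z = c).card))
    h6 (by decide) (by decide) (by decide) hF (by simp [h7]; simpa using h4) ?_).mono
    fun τ h => h.2.1
  rintro i hi τ hf hx ⟨a1, a2, a3⟩
  have hsum : ((Finset.range n).filter fun z => dig z < i + 1).card =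
      ((Finset.range n).filter fun z => dig z < i).card +
      ((Finset.range n).filter fun z => dig z = i).card := by
    rw [← Finset.card_union_of_disjoint]
    · congr 1
      ext z
      simp only [Finset.mem_filter, Finset.mem_union, Finset.mem_range]
      omega
    · rw [Finset.disjoint_filter]
      intros
      omega
  have hle : ((Finset.range n).filter fun z => dig z < i + 1).card ≤ n := by
    simpa using Finset.card_filter_le (Finset.range n) fun z => dig z < i + 1
  refine Ter.assign _ (by simp only [Expr.eval, hx]; exact a3 i hi le_rfl) ?_
  refine Ter.write i _ (by simp [Expr.eval, hx]) (by simpa [Expr.eval] using a1) ?_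
  refine Ter.assign (((Finset.range n).filter fun z => dig z < i + 1).card : ℕ) ?_ (Ter.nil ?_)
  · have : τ.reg 7 + (((Finset.range n).filter fun z => dig z = i).card : ℕ) =
        (((Finset.range n).filter fun z => dig z < i + 1).card : ℕ) := by omega
    have hb := hW.bmod (((Finset.range n).filter fun z => dig z < i + 1).card : ℕ) (by omega)
      (by omega)
    simpa only [Expr.eval, BinOp.apply, setReg_reg, setArr_reg, ← this, if_true,
      show ¬ ((7 : ℕ) = 9) by decide, if_false] using hb
  · refine ⟨by simp, ?_, ?_⟩
    · intro c hc
      rcases (Nat.lt_succ_iff.1 hc).lt_or_eq with hj | rfl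
      · simp [hj.ne, a2 c hj]
      · simp
    · intro c hc hic
      have : c ≠ i := by omega
      simp [this, a3 c hc (by omega)]

theorem placeDigits_spec {dig : ℕ → ℕ} (hW : Fits w M) (hnM : (n : ℤ) ≤ M) (hb : 0 < b)
    (hbM : (b : ℤ) ≤ M)
    (h0 : σ.reg 0 = n) (h6 : σ.reg 6 = b) (h8 : σ.reg 8 = B)
    (hv : ∀ y < n, σ.arr 2 (y : ℕ) = v y) (hvM : ∀ y < n, (v y : ℤ) ≤ M)
    (hdig : ∀ y, dig y = v y / B % b)
    (hκ : ∀ y < n, ∀ z < n, κ y = κ z → y = z) (hκ' : ∀ y < n, ∀ z < n, κ' y = κ' z → y = z)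
    (hlex : ∀ y < n, ∀ z < n, κ' z < κ' y ↔ dig z < dig y ∨ dig z = dig y ∧ κ z < κ y)
    (h3 : ∀ y < n, σ.arr 3 (keyRank n κ y : ℕ) = y)
    (h4 : ∀ c < b, σ.arr 4 (c : ℕ) = ((Finset.range n).filter fun z => dig z < c).card)
    (hF : n ≤ F) :
    Ter w F placeDigits σ fun τ => ∀ y < n, τ.arr 5 (keyRank n κ' y : ℕ) = y := by
  have h1 := hW.one_le
  -- The slot for digit `c` is the start of its bucket plus the number of its members placed so far,
  -- those of old rank less than `i`.
  refine (Ter.forLoop hW n hnM (fun i τ => (∀ c < b, τ.arr 4 (c : ℕ) =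
      (((Finset.range n).filter fun z => dig z < c).card +
      ((Finset.range n).filter fun z => dig z = c ∧ keyRank n κ z < i).card : ℕ)) ∧
      ∀ y < n, keyRank n κ y < i → τ.arr 5 (keyRank n κ' y : ℕ) = y) h0 (by decide)
    (by decide) (by decide) hF ⟨by simpa using h4, by simp⟩ ?_).mono
    fun τ h y hy => h.2 y hy (keyRank_lt hy)
  rintro i hi τ hf hx ⟨a1, a2⟩
  obtain ⟨y, hy, rfl⟩ := keyRank_surj hκ hi
  have h3y : τ.arr 3 (keyRank n κ y : ℕ) = y := by rw [hf.2 3 (by decide), h3 y hy]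
  have hvi : τ.arr 2 y = v y := by rw [hf.2 2 (by decide), hv y hy]
  have hd : dig y < b := by rw [hdig]; exact Nat.mod_lt _ hb
  have h4y := a1 _ hd
  -- So the next free slot of this bucket is precisely the new rank of `y`.
  rw [← keyRank_lex hlex hy] at h4y
  have hlt := keyRank_lt (κ := κ') hy
  refine Ter.assign y (by simp [Expr.eval, hx, h3y]) ?_
  refine Ter.assign (dig y) (by
    rw [hdig]
    exact (eval_digit hW hb hbM (hvM y hy) (by simp [Expr.eval, hvi])
      (by simpa using (hf.1 6 (by decide)).trans h6)
      (by simpa using (hf.1 8 (by decide)).trans h8))) ?_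
  refine Ter.write (keyRank n κ' y) y (by simp [Expr.eval, h4y]) (by simp [Expr.eval]) ?_
  refine Ter.write (dig y) (keyRank n κ' y + 1) (by simp [Expr.eval]) ?_ (Ter.nil ⟨?_, ?_⟩)
  · simp [Expr.eval, BinOp.apply, h4y]
    rw [hW.bmod _ (by omega) (by omega)]
  · intro c hc
    -- Only `y` has this old rank, so the round adds one member to the bucket of `y` and none to the
    -- others.
    have hsplit : ((Finset.range n).filter fun z => dig z = c ∧
        keyRank n κ z < keyRank n κ y + 1).card =
        ((Finset.range n).filter fun z => dig z = c ∧ keyRank n κ z < keyRank n κ y).card +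
        if c = dig y then 1 else 0 := by
      split_ifs with hcd
      · rw [← Finset.card_insert_of_notMem (a := y) (by simp)]
        congr 1
        ext z
        simp only [Finset.mem_filter, Finset.mem_insert, Finset.mem_range]
        constructor
        · rintro ⟨hz, hzc, hzr⟩
          by_cases h : z = y
          · exact Or.inl h
          · refine Or.inr ⟨hz, hzc, ?_⟩
            have := mt (keyRank_inj hκ hz hy) h
            omega
        · rintro (rfl | ⟨hz, hzc, hzr⟩)
          · exact ⟨hy, hcd.symm, by omega⟩
          · exact ⟨hz, hzc, by omega⟩
      · rw [add_zero]
        congr 1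
        ext z
        simp only [Finset.mem_filter, Finset.mem_range]
        constructor
        · rintro ⟨hz, hzc, hzr⟩
          refine ⟨hz, hzc, ?_⟩
          have : z ≠ y := by rintro rfl; exact hcd hzc.symm
          have := mt (keyRank_inj hκ hz hy) this
          omega
        · rintro ⟨hz, hzc, hzr⟩
          exact ⟨hz, hzc, by omega⟩
    rw [hsplit]
    by_cases hcd : c = dig y
    · subst hcd
      simp [keyRank_lex hlex hy]
      ring
    · simp [hcd, a1 c hc]
  · intro z hz hzr
    by_cases h : z = y
    · subst h; simp
    · have h₁ := mt (keyRank_inj hκ hz hy) h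
      have h₂ := mt (keyRank_inj hκ' hz hy) h
      simp [h₂, a2 z hz (by omega)]

theorem copyBack_spec (hW : Fits w M) (hnM : (n : ℤ) ≤ M) (h0 : σ.reg 0 = n) (hF : n ≤ F) :
    Ter w F copyBack σ fun τ => ∀ i < n, τ.arr 3 (i : ℕ) = σ.arr 5 (i : ℕ) := by
  refine Ter.forLoop hW n hnM (fun i τ => ∀ j < i, τ.arr 3 (j : ℕ) = σ.arr 5 (j : ℕ))
    h0 (by decide) (by decide) (by decide) hF (by simp) ?_
  rintro i hi τ hf hx a1
  refine Ter.write i (σ.arr 5 i) (by simp [Expr.eval, hx])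
    (by simp [Expr.eval, hx, hf.2 5 (by decide)]) (Ter.nil ?_)
  simp
  intro j hj
  rcases hj.lt_or_eq with hj | rfl
  · simp [hj.ne, a1 j hj]
  · simp

theorem radixPass_spec (hW : Fits w M) (hnM : (n : ℤ) ≤ M) (hb : 0 < b) (hbM : (b : ℤ) ≤ M)
    (h0 : σ.reg 0 = n) (h6 : σ.reg 6 = b) (h8 : σ.reg 8 = B)
    (hv : ∀ y < n, σ.arr 2 (y : ℕ) = v y) (hvM : ∀ y < n, (v y : ℤ) ≤ M)
    (hκ : ∀ y < n, ∀ z < n, κ y = κ z → y = z) (hκ' : ∀ y < n, ∀ z < n, κ' y = κ' z → y = z)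
    (hlex : ∀ y < n, ∀ z < n, κ' z < κ' y ↔ v z / B % b < v y / B % b ∨
      v z / B % b = v y / B % b ∧ κ z < κ y)
    (h3 : ∀ y < n, σ.arr 3 (keyRank n κ y : ℕ) = y) (hF : n ≤ F) (hbF : b ≤ F) :
    Ter w F radixPass σ fun τ => ∀ y < n, τ.arr 3 (keyRank n κ' y : ℕ) = y := by
  have h1 := hW.one_le
  refine Ter.cons ((zeroCounts_spec hW hbM h6 hbF).mono_frame fun τ₁ f₁ q₁ => ?_)
  refine Ter.cons ((countDigits_spec hW hnM hb hbM ((f₁.1 0 (by decide)).trans h0)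
    ((f₁.1 6 (by decide)).trans h6) ((f₁.1 8 (by decide)).trans h8)
    (fun y hy => by rw [f₁.2 2 (by decide), hv y hy]) hvM q₁ hF).mono_frame fun τ₂ f₂ q₂ => ?_)
  refine Ter.assign 0 (hW.bmod 0 (by omega) (by omega)) ?_
  refine Ter.cons ((prefixSums_spec (dig := fun z => v z / B % b) hW hnM hbM
    (by simpa using (f₂.1 6 (by decide)).trans ((f₁.1 6 (by decide)).trans h6)) (by simp)
    (by simpa using q₂) hbF).mono_frame fun τ₃ f₃ q₃ => ?_)
  have g0 : τ₃.reg 0 = n := by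
    rw [f₃.1 0 (by decide)]
    simpa using (f₂.1 0 (by decide)).trans ((f₁.1 0 (by decide)).trans h0)
  have g6 : τ₃.reg 6 = b := by
    rw [f₃.1 6 (by decide)]
    simpa using (f₂.1 6 (by decide)).trans ((f₁.1 6 (by decide)).trans h6)
  have g8 : τ₃.reg 8 = B := by
    rw [f₃.1 8 (by decide)]
    simpa using (f₂.1 8 (by decide)).trans ((f₁.1 8 (by decide)).trans h8)
  have g2 : τ₃.arr 2 = σ.arr 2 := by
    rw [f₃.2 2 (by decide)]
    simpa using (f₂.2 2 (by decide)).trans (f₁.2 2 (by decide))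
  have g3 : τ₃.arr 3 = σ.arr 3 := by
    rw [f₃.2 3 (by decide)]
    simpa using (f₂.2 3 (by decide)).trans (f₁.2 3 (by decide))
  refine Ter.cons ((placeDigits_spec (dig := fun z => v z / B % b) hW hnM hb hbM g0 g6 g8
    (by simpa [g2] using hv) hvM (fun _ => rfl) hκ hκ' hlex (by simpa [g3] using h3) q₃
    hF).mono_frame fun τ₄ f₄ q₄ => ?_)
  refine Ter.cons ((copyBack_spec hW hnM ((f₄.1 0 (by decide)).trans g0) hF).mono
    fun τ₅ q₅ => Ter.nil fun y hy => ?_)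
  rw [q₅ _ (keyRank_lt hy), q₄ y hy]

end WordRAM

/-! ### Deletion from a sorted list. -/

/-- `y` is the neighbour of `u` among `{0, …, m - 1}` in direction `r`, and `-1` if there is
none. -/
def IsNeighbour (r : ℕ → ℕ → Prop) (m u : ℕ) (y : ℤ) : Prop :=
  (y = -1 ∧ ∀ z < m, ¬ r z u) ∨ ∃ p : ℕ, y = p ∧ p < m ∧ r p u ∧ ∀ z < m, r z u → z = p ∨ r z p

/-- Removing `i` affects, in direction `r`, only the element on its other side, namely `b`, which
inherits the neighbour `a` of `i`. Stating it for both directions at once serves both link arrays.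
-/
theorem IsNeighbour.delete {n i u : ℕ} {κ : ℕ → ℕ} {r : ℕ → ℕ → Prop} {a b y : ℤ}
    (hκ : ∀ y < n, ∀ z < n, κ y = κ z → y = z)
    (hr : (∀ x y, r x y ↔ κ x < κ y) ∨ (∀ x y, r x y ↔ κ y < κ x))
    (hi : i < n) (hu : u < i)
    (ha : IsNeighbour r (i + 1) i a) (hb : IsNeighbour (fun x y => r y x) (i + 1) i b)
    (hy : IsNeighbour r (i + 1) u y) :
    IsNeighbour r i u (if (u : ℤ) = b then a else y) := by
  have hirr : ∀ x, ¬ r x x := fun x => by rcases hr with h | h <;> simp [h]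
  have htrans : ∀ x y z, r x y → r y z → r x z := fun x y z => by
    rcases hr with h | h <;> simp only [h] <;> omega
  have htri : ∀ x < n, ∀ y < n, x = y ∨ r x y ∨ r y x := fun x hx y hy => by
    by_cases h : x = y
    · exact Or.inl h
    · have := mt (hκ x hx y hy) h
      rcases hr with h | h <;> simp only [h] <;> omega
  split_ifs with hub
  · rcases hb with ⟨hb, -⟩ | ⟨q, hq, hq₁, hq₂, hq₃⟩
    · omega
    · obtain rfl : u = q := by omega
      -- No remaining element lies between `i` and `u`, so whatever is beyond `u` is beyond `i`.
      have hstep : ∀ z < i, r z u → r z i := fun z hz hzu => by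
        rcases htri z (by omega) i hi with h | h | h
        · omega
        · exact h
        · rcases hq₃ z (by omega) h with h' | h'
          · exact absurd (h' ▸ hzu) (hirr _)
          · exact absurd (htrans _ _ _ hzu h') (hirr _)
      rcases ha with ⟨ha, ha'⟩ | ⟨p, hp, hp₁, hp₂, hp₃⟩
      · exact Or.inl ⟨ha, fun z hz hzu => ha' z (by omega) (hstep z hz hzu)⟩
      · have : p ≠ i := by rintro rfl; exact hirr _ hp₂
        exact Or.inr ⟨p, hp, by omega, htrans _ _ _ hp₂ hq₂,
          fun z hz hzu => hp₃ z (by omega) (hstep z hz hzu)⟩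
  · rcases hy with ⟨hy, hy'⟩ | ⟨p, hp, hp₁, hp₂, hp₃⟩
    · exact Or.inl ⟨hy, fun z hz => hy' z (by omega)⟩
    -- If `i` were the neighbour of `u`, then `u` would be the opposite neighbour `b` of `i`, which
    -- this case excludes.
    · have : p ≠ i := by
        rintro rfl
        rcases hb with ⟨hb, hb'⟩ | ⟨q, hq, hq₁, hq₂, hq₃⟩
        · exact hb' u (by omega) hp₂
        · rcases hq₃ u (by omega) hp₂ with h | h
          · omega
          · rcases hp₃ q (by omega) h with h' | h'
            · exact hirr _ (h' ▸ hq₂)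
            · exact hirr _ (htrans _ _ _ hq₂ h')
      exact Or.inr ⟨p, hp, by omega, hp₂, fun z hz => hp₃ z (by omega)⟩

/-! ### Radix sort and the neighbours among earlier positions. -/

namespace WordRAM
open WordRAM.Expr WordRAM.Prog

/-- Sort the positions by the values in array `2`; the sorted list is put into array `3`. -/
def radixSort : Prog := block
  [assign 10 (bin .sub (reg 4) (reg 3)), assign 6 (bin .add (reg 0) (const 2)),
   assign 8 (const 1),
   loop (bin .lt (reg 8) (bin .add (reg 10) (const 1)))
    (block [radixPass, assign 8 (bin .mul (reg 8) (reg 6))])]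

variable {w n F : ℕ} {M : ℤ} {σ : State} {v κ : ℕ → ℕ}

theorem radixSort_spec {D N : ℕ} (hW : Fits w M) (hnM : (n : ℤ) + 2 ≤ M)
    (hDM : ((D : ℤ) + 1) * (n + 2) ≤ M)
    (h0 : σ.reg 0 = n) (hD : σ.reg 4 - σ.reg 3 = D) (hDN : D < (n + 2) ^ N)
    (hv : ∀ y < n, σ.arr 2 (y : ℕ) = v y) (hvD : ∀ y < n, v y ≤ D)
    (h3 : ∀ y < n, σ.arr 3 (y : ℕ) = y) (hF : (n + 3) * (N + 1) ≤ F + 1) :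
    Ter w F radixSort σ fun τ => ∀ y < n,
      τ.arr 3 (keyRank n (fun y => v y * n + y) y : ℕ) = y := by
  have h1 := hW.one_le
  have hDM' : (D : ℤ) + 1 ≤ M := by nlinarith
  refine Ter.assign D ?_ (Ter.assign (n + 2) ?_ (Ter.assign 1
    (hW.bmod 1 (by omega) (by omega)) (Ter.cons ?_)))
  · simp only [Expr.eval, BinOp.apply, hD]
    exact hW.bmod _ (by omega) (by omega)
  · simp [Expr.eval, BinOp.apply, h0, hW.bmod 2 (by omega) (by omega)]
    exact hW.bmod _ (by omega) (by omega)
  refine (Ter.loop (F₁ := n + 2) (fun t τ => τ.reg 8 = ((n + 2) ^ t : ℕ) ∧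
    ∀ y < n, τ.arr 3 (keyRank n (radixKey n (n + 2) t v) y : ℕ) = y) (fun t => N - t) 0
    ⟨by simp, ?_⟩ (by simpa using hF) ?_).mono_frame ?_
  · intro y hy
    -- With no digits considered, the order is that of the positions: the identity list is already
    -- sorted.
    have : keyRank n (radixKey n (n + 2) 0 v) y = y := by
      have : (Finset.range n).filter (fun z => z < y) = Finset.range y := by
        ext z
        simp only [Finset.mem_filter, Finset.mem_range]
        omega
      simp [keyRank, radixKey, Nat.mod_one, this]
    simp [this, h3 y hy]
  · rintro t τ hf ⟨h8, hI⟩ hc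
    have g0 : τ.reg 0 = n := by rw [hf.1 0 (by decide)]; simp [h0]
    have g6 : τ.reg 6 = n + 2 := by rw [hf.1 6 (by decide)]; simp
    have g10 : τ.reg 10 = D := by rw [hf.1 10 (by decide)]; simp
    have g2 : τ.arr 2 = σ.arr 2 := by rw [hf.2 2 (by decide)]; simp
    have ht : (n + 2) ^ t ≤ D := by
      by_contra hcon
      apply hc
      simp only [Expr.eval, BinOp.apply, h8, g10]
      rw [hW.bmod 1 (by omega) (by omega), hW.bmod ((D : ℤ) + 1) (by omega) (by omega), hW.ite,
        if_neg]
      omega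
    have htN : t < N := by
      by_contra hcon
      have := Nat.pow_le_pow_right (show 0 < n + 2 by omega) (not_lt.1 hcon)
      omega
    refine Ter.cons ((radixPass_spec (b := n + 2) (B := (n + 2) ^ t) (v := v)
      (κ := radixKey n (n + 2) t v)
      (κ' := radixKey n (n + 2) (t + 1) v) hW (by omega) (by omega) (by exact_mod_cast hnM) g0
      (by exact_mod_cast g6) h8 (by simpa [g2] using hv)
      (fun y hy => by have := hvD y hy; omega) radixKey_inj radixKey_inj
      (radixKey_succ (by omega)) hI (by omega) le_rfl).mono_frame fun υ fυ hυ => ?_)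
    refine Ter.assign ((n + 2) ^ (t + 1) : ℕ) ?_ (Ter.nil ⟨t + 1, ⟨by simp, hυ⟩, by omega⟩)
    simp only [Expr.eval, BinOp.apply]
    rw [fυ.1 8 (by decide), fυ.1 6 (by decide), h8, g6]
    have : ((n + 2) ^ t : ℕ) * ((n : ℤ) + 2) = ((n + 2) ^ (t + 1) : ℕ) := by push_cast; ring
    rw [this, hW.bmod _ (by omega)]
    rw [← this]
    have : (((n + 2) ^ t : ℕ) : ℤ) ≤ D := by exact_mod_cast ht
    nlinarith
  · rintro τ hf ⟨t, ⟨h8, hI⟩, hc⟩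
    have g10 : τ.reg 10 = D := by rw [hf.1 10 (by decide)]; simp
    have ht : D < (n + 2) ^ t := by
      by_contra hcon
      simp only [Expr.eval, BinOp.apply, h8, g10] at hc
      rw [hW.bmod 1 (by omega) (by omega), hW.bmod ((D : ℤ) + 1) (by omega) (by omega), hW.ite,
        if_pos (by omega)] at hc
      exact one_ne_zero hc
    -- The place value now exceeds every key value, so reduction modulo it is the identity and the
    -- order is complete.
    refine Ter.nil fun y hy => ?_
    rw [← hI y hy]
    congr 2
    unfold keyRank
    congr 1
    refine Finset.filter_congr fun z hz => ?_
    have h₁ := hvD y hy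
    have h₂ := hvD z (Finset.mem_range.1 hz)
    simp only [radixKey]
    rw [Nat.mod_eq_of_lt (by omega), Nat.mod_eq_of_lt (by omega)]

/-- Turn the sorted list in array `3` into the doubly linked list in arrays `6` and `7`. -/
def linkList : Prog := block
  [write 3 (const (-1)) (const (-1)), write 3 (reg 0) (const (-1)),
   forLoop 2 0 [assign 9 (read 3 (reg 2)),
    write 6 (reg 9) (read 3 (bin .sub (reg 2) (const 1))),
    write 7 (reg 9) (read 3 (bin .add (reg 2) (const 1)))]]

theorem linkList_spec (hW : Fits w M) (hnM : (n : ℤ) ≤ M) (h0 : σ.reg 0 = n)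
    (hκ : ∀ y < n, ∀ z < n, κ y = κ z → y = z)
    (h3 : ∀ y < n, σ.arr 3 (keyRank n κ y : ℕ) = y) (hF : n ≤ F) :
    Ter w F linkList σ fun τ => ∀ y < n,
      IsNeighbour (fun x y => κ x < κ y) n y (τ.arr 6 y) ∧
      IsNeighbour (fun x y => κ y < κ x) n y (τ.arr 7 y) := by
  have h1 := hW.one_le
  have hm1 := hW.bmod (-1) (by omega) (by omega)
  have hp1 := hW.bmod 1 (by omega) (by omega)
  -- The cells `-1` and `n` of the sorted list are sentinels: the extreme elements read `-1` as
  -- their missing neighbour.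
  refine Ter.write (-1) (-1) hm1 hm1 (Ter.write n (-1) (by simp [Expr.eval, h0]) hm1
    (Ter.cons ?_))
  set σ' := (σ.setArr 3 (-1) (-1)).setArr 3 n (-1) with hσ'
  have e1 : σ'.arr 3 (-1) = -1 := by
    have : ¬ ((-1 : ℤ) = n) := by omega
    simp [hσ']
  have e2 : σ'.arr 3 n = -1 := by simp [hσ']
  have e3 : ∀ y < n, σ'.arr 3 (keyRank n κ y : ℕ) = y := fun y hy => by
    have h₁ := keyRank_lt (κ := κ) hy
    have h₂ : ¬ ((keyRank n κ y : ℤ) = -1) := by omega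
    simp [hσ', h₁.ne, h₂, h3 y hy]
  refine (Ter.forLoop hW n hnM (fun i τ => ∀ y < n, keyRank n κ y < i →
      τ.arr 6 y = σ'.arr 3 ((keyRank n κ y : ℕ) - 1) ∧
      τ.arr 7 y = σ'.arr 3 ((keyRank n κ y : ℕ) + 1))
    (by simp [hσ', h0]) (by decide) (by decide) (by decide) hF (by simp) ?_).mono fun τ h => ?_
  · rintro i hi τ hf hx a1
    obtain ⟨y, hy, rfl⟩ := keyRank_surj hκ hi
    have e3y := e3 y hy
    rw [← hf.2 3 (by decide)] at e3y
    refine Ter.assign y (by simpa [Expr.eval, hx] using e3y) ?_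
    refine Ter.write y (σ'.arr 3 ((keyRank n κ y : ℕ) - 1)) (by simp [Expr.eval]) ?_ ?_
    · simp [Expr.eval, BinOp.apply, hx, hp1]
      rw [hW.bmod _ (by omega) (by omega), hf.2 3 (by decide)]
    refine Ter.write y (σ'.arr 3 ((keyRank n κ y : ℕ) + 1)) (by simp [Expr.eval]) ?_
      (Ter.nil ?_)
    · simp [Expr.eval, BinOp.apply, hx, hp1]
      rw [hW.bmod _ (by omega) (by omega), hf.2 3 (by decide)]
    · intro z hz hzr
      by_cases h : z = y
      · subst h; simp
      · have h₁ := mt (keyRank_inj hκ hz hy) h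
        simp [h, a1 z hz (by omega)]
  · refine Ter.nil fun y hy => ?_
    obtain ⟨h6, h7⟩ := h y hy (keyRank_lt hy)
    rw [h6, h7]
    constructor
    · by_cases h0 : keyRank n κ y = 0
      · refine Or.inl ⟨by simp [h0, e1], fun z hz hlt => ?_⟩
        have := (keyRank_lt_keyRank hz).2 hlt
        omega
      · obtain ⟨p, hp, hpr⟩ := keyRank_surj hκ (i := keyRank n κ y - 1)
          (by have := keyRank_lt (κ := κ) hy; omega)
        have hpr' : ((keyRank n κ y : ℕ) : ℤ) - 1 = (keyRank n κ p : ℕ) := by omega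
        refine Or.inr ⟨p, by rw [hpr', e3 p hp], hp, (keyRank_lt_keyRank hp).1 (by omega),
          fun z hz hlt => ?_⟩
        have h₁ := (keyRank_lt_keyRank hz).2 hlt
        by_cases h₂ : keyRank n κ z = keyRank n κ p
        · exact Or.inl (keyRank_inj hκ hz hp h₂)
        · exact Or.inr ((keyRank_lt_keyRank hz).1 (by omega))
    · by_cases h0 : keyRank n κ y + 1 = n
      · refine Or.inl ⟨by rw [← e2]; congr 1; omega, fun z hz hlt => ?_⟩
        have := (keyRank_lt_keyRank hy).2 hlt
        have := keyRank_lt (κ := κ) hz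
        omega
      · obtain ⟨p, hp, hpr⟩ := keyRank_surj hκ (i := keyRank n κ y + 1)
          (by have := keyRank_lt (κ := κ) hy; omega)
        have hpr' : ((keyRank n κ y : ℕ) : ℤ) + 1 = (keyRank n κ p : ℕ) := by omega
        refine Or.inr ⟨p, by rw [hpr', e3 p hp], hp, (keyRank_lt_keyRank hy).1 (by omega),
          fun z hz hlt => ?_⟩
        have h₁ := (keyRank_lt_keyRank hy).2 hlt
        by_cases h₂ : keyRank n κ z = keyRank n κ p
        · exact Or.inl (keyRank_inj hκ hz hp h₂)
        · exact Or.inr ((keyRank_lt_keyRank hp).1 (by omega))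

/-- Delete the positions from the linked list in decreasing order. -/
def unlink : Prog := forLoop 2 0
  [assign 8 (bin .sub (bin .sub (reg 0) (reg 2)) (const 1)),
   assign 9 (read 6 (reg 8)), assign 10 (read 7 (reg 8)),
   write 7 (reg 9) (reg 10), write 6 (reg 10) (reg 9)]

theorem unlink_spec (hW : Fits w M) (hnM : (n : ℤ) ≤ M) (h0 : σ.reg 0 = n)
    (hκ : ∀ y < n, ∀ z < n, κ y = κ z → y = z)
    (h67 : ∀ y < n, IsNeighbour (fun x y => κ x < κ y) n y (σ.arr 6 y) ∧
      IsNeighbour (fun x y => κ y < κ x) n y (σ.arr 7 y)) (hF : n ≤ F) :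
    Ter w F unlink σ fun τ => ∀ y < n,
      IsNeighbour (fun x y => κ x < κ y) (y + 1) y (τ.arr 6 y) ∧
      IsNeighbour (fun x y => κ y < κ x) (y + 1) y (τ.arr 7 y) := by
  have h1 := hW.one_le
  have hp1 := hW.bmod 1 (by omega) (by omega)
  -- After `x` deletions a remaining position has its neighbours among those below `n - x`, while a
  -- deleted position `y` keeps the links it had when it was the largest left, i.e. among those
  -- below `y + 1`. The maximum covers both cases.
  refine (Ter.forLoop hW n hnM (fun x τ => ∀ y < n,
      IsNeighbour (fun x y => κ x < κ y) (max (n - x) (y + 1)) y (τ.arr 6 y) ∧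
      IsNeighbour (fun x y => κ y < κ x) (max (n - x) (y + 1)) y (τ.arr 7 y))
    h0 (by decide) (by decide) (by decide) hF ?_ ?_).mono fun τ h => by simpa using h
  · intro y hy
    rw [max_eq_left (by omega)]
    simpa using h67 y hy
  rintro x hxn τ hf hx a1
  obtain ⟨i, rfl⟩ : ∃ i, n = x + i + 1 := ⟨n - x - 1, by omega⟩
  have hτ0 : τ.reg 0 = x + i + 1 := by rw [hf.1 0 (by decide), h0]; push_cast; ring
  obtain ⟨ha, hb⟩ := a1 i (by omega)
  rw [show max (x + i + 1 - x) (i + 1) = i + 1 by omega] at ha hb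
  -- Neighbours of `i` are smaller than `i` or equal to `-1`, so the two writes miss all frozen
  -- links; a missing neighbour merely sends a write to the cell `-1`.
  have haux : ∀ r : ℕ → ℕ → Prop, (∀ x, ¬ r x x) → ∀ y, IsNeighbour r (i + 1) i y →
      ∀ u : ℕ, i ≤ u → (u : ℤ) ≠ y := by
    rintro r hr y (⟨rfl, -⟩ | ⟨p, rfl, hp, hp', -⟩) u hu
    · omega
    · have : p ≠ i := by rintro rfl; exact hr _ hp'
      omega
  refine Ter.assign i ?_ ?_
  · simp [Expr.eval, BinOp.apply, hx, hτ0, hp1]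
    rw [show (x : ℤ) + i + 1 - x - 1 = i by ring]
    exact hW.bmod _ (by omega) (by omega)
  refine Ter.assign (τ.arr 6 i) (by simp [Expr.eval]) ?_
  refine Ter.assign (τ.arr 7 i) (by simp [Expr.eval]) ?_
  refine Ter.write (τ.arr 6 i) (τ.arr 7 i) (by simp [Expr.eval]) (by simp [Expr.eval]) ?_
  refine Ter.write (τ.arr 7 i) (τ.arr 6 i) (by simp [Expr.eval]) (by simp [Expr.eval])
    (Ter.nil ?_)
  intro u hu
  have hu' := a1 u hu
  simp only [setReg_arr, setArr_arr, true_and, show ¬ ((6 : ℕ) = 7) by decide, false_and,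
    show ¬ ((7 : ℕ) = 6) by decide, if_false]
  rcases lt_or_ge u i with hui | hui
  · rw [show max (x + i + 1 - x) (u + 1) = i + 1 by omega] at hu'
    rw [show max (x + i + 1 - (x + 1)) (u + 1) = i by omega]
    exact ⟨IsNeighbour.delete hκ (Or.inl fun _ _ => Iff.rfl) (by omega) hui ha hb hu'.1,
      IsNeighbour.delete hκ (Or.inr fun _ _ => Iff.rfl) (by omega) hui hb ha hu'.2⟩
  · rw [show max (x + i + 1 - x) (u + 1) = u + 1 by omega] at hu'
    rw [show max (x + i + 1 - (x + 1)) (u + 1) = u + 1 by omega]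
    rw [if_neg (haux (fun x y => κ x < κ y) (fun _ => lt_irrefl _) _ ha u hui),
      if_neg (haux (fun x y => κ y < κ x) (fun _ => lt_irrefl _) _ hb u hui)]
    exact hu'

end WordRAM

/-! ### Order-preserving matches with prefixes. -/

/-- The factor of length `x` at position `j` is order-equivalent to the prefix of length `x`. -/
def OpMatch (s : ℕ → ℤ) (j x : ℕ) : Prop := ∀ a < x, ∀ b < x, s a < s b ↔ s (j + a) < s (j + b)

theorem OpMatch.mono {s : ℕ → ℤ} {j x y : ℕ} (h : OpMatch s j x) (hy : y ≤ x) : OpMatch s j y :=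
  fun a ha b hb => h a (by omega) b (by omega)

theorem opMatch_one (s : ℕ → ℤ) (j : ℕ) : OpMatch s j 1 := fun a ha b hb => by
  obtain rfl : a = b := by omega
  simp

/-- Inside the window the letters at `l + k` are ordered like those at `k`. This is what lets the
Z-algorithm reuse earlier entries. -/
theorem OpMatch.shift {s : ℕ → ℤ} {l k x y : ℕ} (h : OpMatch s l x) (hy : k + y ≤ x) :
    OpMatch s (l + k) y ↔ OpMatch s k y := by
  have : ∀ a < y, ∀ b < y, s (k + a) < s (k + b) ↔ s (l + k + a) < s (l + k + b) :=
    fun a ha b hb => by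
      rw [add_assoc, add_assoc]
      exact h (k + a) (by omega) (k + b) (by omega)
  constructor
  · intro h' a ha b hb
    rw [this a ha b hb]
    exact h' a ha b hb
  · intro h' a ha b hb
    rw [← this a ha b hb]
    exact h' a ha b hb

/-- `x` is the entry of the order-preserving prefix table at position `j`. -/
def IsOpPref (s : ℕ → ℤ) (n j x : ℕ) : Prop :=
  OpMatch s j x ∧ j + x ≤ n ∧ (j + x < n → ¬ OpMatch s j (x + 1))

theorem IsOpPref.opMatch_iff {s : ℕ → ℤ} {n j x y : ℕ} (h : IsOpPref s n j x) (hy : j + y ≤ n) :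
    OpMatch s j y ↔ y ≤ x := by
  constructor
  · intro h'
    by_contra hcon
    exact h.2.2 (by omega) (h'.mono (by omega))
  · exact h.1.mono

/-- It suffices to compare a new letter with its neighbours among the previous ones. -/
theorem OpMatch.succ_iff {s : ℕ → ℤ} {κ : ℕ → ℕ} {n j x : ℕ} {P Q : ℤ} (h : OpMatch s j x)
    (hx : x < n)
    (hκ : ∀ a < n, ∀ b < n, κ a < κ b ↔ s a < s b ∨ s a = s b ∧ a < b)
    (hP : IsNeighbour (fun x y => κ x < κ y) (x + 1) x P)
    (hQ : IsNeighbour (fun x y => κ y < κ x) (x + 1) x Q) :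
    OpMatch s j (x + 1) ↔
      (P < 0 ∨ ((s P.toNat < s x ↔ s (j + P.toNat) < s (j + x)) ∧ s (j + P.toNat) ≤ s (j + x))) ∧
      (Q < 0 ∨ s (j + x) < s (j + Q.toNat)) := by
  -- Earlier occurrences of an equal letter have smaller keys, so `P` carries the largest earlier
  -- letter that is at most `s x`, possibly equal to it, and `Q` below carries the smallest one
  -- strictly above.
  have hP' : (P = -1 ∧ ∀ z < x, s x < s z) ∨
      ∃ p : ℕ, P = p ∧ p < x ∧ s p ≤ s x ∧ ∀ z < x, s z ≤ s x → s z ≤ s p := by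
    rcases hP with ⟨hP, h'⟩ | ⟨p, hp, hp₁, hp₂, hp₃⟩
    · refine Or.inl ⟨hP, fun z hz => ?_⟩
      have : ¬ κ z < κ x := h' z (by omega)
      rw [hκ z (by omega) x hx] at this
      omega
    · have h₁ := (hκ p (by omega) x hx).1 hp₂
      have hpx : p ≠ x := by rintro rfl; omega
      refine Or.inr ⟨p, hp, by omega, by omega, fun z hz hzx => ?_⟩
      rcases hp₃ z (by omega) ((hκ z (by omega) x hx).2 (by omega)) with rfl | h₂
      · rfl
      · have := (hκ z (by omega) p (by omega)).1 h₂
        omega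
  have hQ' : (Q = -1 ∧ ∀ z < x, s z ≤ s x) ∨
      ∃ q : ℕ, Q = q ∧ q < x ∧ s x < s q ∧ ∀ z < x, s x < s z → s q ≤ s z := by
    rcases hQ with ⟨hQ, h'⟩ | ⟨q, hq, hq₁, hq₂, hq₃⟩
    · refine Or.inl ⟨hQ, fun z hz => ?_⟩
      have : ¬ κ x < κ z := h' z (by omega)
      rw [hκ x hx z (by omega)] at this
      omega
    · have h₁ := (hκ x hx q (by omega)).1 hq₂
      have hqx : q ≠ x := by rintro rfl; omega
      refine Or.inr ⟨q, hq, by omega, by omega, fun z hz hzx => ?_⟩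
      rcases hq₃ z (by omega) ((hκ x hx z (by omega)).2 (by omega)) with rfl | h₂
      · rfl
      · have := (hκ q (by omega) z (by omega)).1 h₂
        omega
  constructor
  · intro H
    constructor
    · rcases hP' with ⟨rfl, -⟩ | ⟨p, rfl, hp, hpx, -⟩
      · exact Or.inl (by omega)
      · have h₁ := H p (by omega) x (by omega)
        have h₂ := H x (by omega) p (by omega)
        rw [Int.toNat_natCast]
        exact Or.inr ⟨h₁, by omega⟩
    · rcases hQ' with ⟨rfl, -⟩ | ⟨q, rfl, hq, hqx, -⟩
      · exact Or.inl (by omega)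
      · rw [Int.toNat_natCast]
        exact Or.inr ((H x (by omega) q (by omega)).1 hqx)
  · rintro ⟨H₁, H₂⟩
    -- Every earlier letter is at most that of `P` or at least that of `Q`; the match of length `x`
    -- carries this over to the factor, where the two tests place the new letter.
    have key : ∀ a < x, (s a < s x ↔ s (j + a) < s (j + x)) ∧
        (s x < s a ↔ s (j + x) < s (j + a)) := by
      intro a ha
      rcases le_or_gt (s a) (s x) with hax | hax
      · rcases hP' with ⟨-, h'⟩ | ⟨p, rfl, hp, hpx, hp'⟩
        · have := h' a ha
          omega
        · rw [Int.toNat_natCast] at H₁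
          have h₁ := h p hp a ha
          have h₂ := h a ha p hp
          have h₃ := hp' a ha hax
          omega
      · rcases hQ' with ⟨-, h'⟩ | ⟨q, rfl, hq, hqx, hq'⟩
        · have := h' a ha
          omega
        · rw [Int.toNat_natCast] at H₂
          have h₁ := h q hq a ha
          have h₂ := h a ha q hq
          have h₃ := hq' a ha hax
          omega
    intro a ha b hb
    rcases (Nat.lt_succ_iff.1 ha).lt_or_eq with ha | rfl
    · rcases (Nat.lt_succ_iff.1 hb).lt_or_eq with hb | rfl
      · exact h a ha b hb
      · exact (key a ha).1
    · rcases (Nat.lt_succ_iff.1 hb).lt_or_eq with hb | rfl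
      · exact (key b hb).2
      · simp

/-! ### The order-preserving prefix table. -/

namespace WordRAM
open WordRAM.Expr WordRAM.Prog

/-- Test whether the match of the prefix with the factor starting at `reg 3` and ending before
`reg 4` can be extended by one letter. -/
def testExtend : Prog := block
  [assign 5 (bin .sub (reg 4) (reg 3)), assign 7 (read 6 (reg 5)), assign 8 (read 7 (reg 5)),
   assign 6 (const 1),
   branch (bin .lt (reg 7) (const 0)) (block [])
    (block [assign 6 (bin .mul
      (bin .eq (bin .lt (read 0 (reg 7)) (read 0 (reg 5)))
        (bin .lt (read 0 (bin .add (reg 3) (reg 7))) (read 0 (reg 4))))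
      (bin .eq (bin .lt (read 0 (reg 4)) (read 0 (bin .add (reg 3) (reg 7)))) (const 0)))]),
   branch (bin .lt (reg 8) (const 0)) (block [])
    (block [assign 6 (bin .mul (reg 6)
      (bin .lt (read 0 (reg 4)) (read 0 (bin .add (reg 3) (reg 8)))))])]

variable {w n F : ℕ} {M : ℤ} {σ : State} {s : ℕ → ℤ} {κ : ℕ → ℕ}

theorem testExtend_spec {l x : ℕ} (hW : Fits w M) (hnM : (n : ℤ) ≤ M)
    (hs : ∀ i : ℕ, σ.arr 0 i = s i)
    (hκ : ∀ a < n, ∀ b < n, κ a < κ b ↔ s a < s b ∨ s a = s b ∧ a < b)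
    (h67 : ∀ y < n, IsNeighbour (fun x y => κ x < κ y) (y + 1) y (σ.arr 6 y) ∧
      IsNeighbour (fun x y => κ y < κ x) (y + 1) y (σ.arr 7 y))
    (h3 : σ.reg 3 = l) (h4 : σ.reg 4 = (l + x : ℕ)) (hlx : l + x < n) (h : OpMatch s l x) :
    Ter w 0 testExtend σ fun τ => τ.reg 6 ≠ 0 ↔ OpMatch s l (x + 1) := by
  have h1 := hW.one_le
  have b0 := hW.bmod 0 (by omega) (by omega)
  have b1 := hW.bmod 1 (by omega) (by omega)
  obtain ⟨hP, hQ⟩ := h67 x (by omega)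
  have hiff := h.succ_iff (by omega) hκ hP hQ
  have hr : σ.arr 0 (l + x) = s (l + x) := by exact_mod_cast hs (l + x)
  have hnb : ∀ r : ℕ → ℕ → Prop, (∀ x, ¬ r x x) → ∀ y, IsNeighbour r (x + 1) x y → ¬ y < 0 →
      ∃ p : ℕ, y = p ∧ p < x := by
    rintro r hirr y (⟨rfl, -⟩ | ⟨p, rfl, hp, hp', -⟩) hy
    · omega
    · have : p ≠ x := by rintro rfl; exact hirr _ hp'
      exact ⟨p, rfl, by omega⟩
  have mul_ite : ∀ (p q : Prop) [Decidable p] [Decidable q],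
      Int.bmod ((if p then 1 else 0) * (if q then 1 else 0)) (2 ^ w) =
        if p ∧ q then 1 else 0 := by
    intro p q _ _
    have h₁ := hW.ite p
    by_cases hp : p <;> by_cases hq : q <;> simp [hp, hq, b0]
    simpa [hp] using h₁
  have eq_ite : ∀ (p q : Prop) [Decidable p] [Decidable q],
      ((if p then (1 : ℤ) else 0) = if q then 1 else 0) ↔ (p ↔ q) := by
    intro p q _ _
    by_cases hp : p <;> by_cases hq : q <;> simp [hp, hq]
  have eq_ite' : ∀ (p : Prop) [Decidable p], ((if p then (1 : ℤ) else 0) = 0) ↔ ¬ p := by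
    intro p _
    by_cases hp : p <;> simp [hp]
  refine Ter.assign x ?_ (Ter.assign (σ.arr 6 x) (by simp [Expr.eval])
    (Ter.assign (σ.arr 7 x) (by simp [Expr.eval]) (Ter.assign 1 b1 ?_)))
  · simp only [Expr.eval, BinOp.apply, h3, h4]
    rw [hW.bmod _ (by omega) (by omega)]
    omega
  -- Both outcomes of the predecessor test lead to the successor test, which is therefore treated
  -- once, with `p` recording the first result.
  have second : ∀ (p : Prop) (τ : State), (p ↔ σ.arr 6 x < 0 ∨
      ((s (σ.arr 6 x).toNat < s x ↔ s (l + (σ.arr 6 x).toNat) < s (l + x)) ∧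
        s (l + (σ.arr 6 x).toNat) ≤ s (l + x))) →
      (∀ [Decidable p], τ.reg 6 = if p then 1 else 0) → τ.arr = σ.arr →
      τ.reg 3 = l → τ.reg 4 = (l + x : ℕ) → τ.reg 8 = σ.arr 7 x →
      Ter w 0 (block [branch (bin .lt (reg 8) (const 0)) (block [])
        (block [assign 6 (bin .mul (reg 6)
          (bin .lt (read 0 (reg 4)) (read 0 (bin .add (reg 3) (reg 8)))))])]) τ
        fun τ => τ.reg 6 ≠ 0 ↔ OpMatch s l (x + 1) := by
    classical
    intro p τ hp h6 harr g3 g4 g8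
    rw [hiff, ← hp]
    have hr' : τ.arr 0 (l + x) = s (l + x) := by rw [harr, hr]
    refine Ter.branch (fun hc => Ter.nil (Ter.nil ?_)) (fun hc => ?_)
    · simp only [Expr.eval, BinOp.apply, g8, b0, hW.ite, ne_eq, eq_ite', not_not] at hc
      simp [h6, hc]
    · simp only [Expr.eval, BinOp.apply, g8, b0, hW.ite, eq_ite'] at hc
      obtain ⟨q, hq, hqx⟩ := hnb (fun x y => κ y < κ x) (fun _ => lt_irrefl _) _ hQ hc
      have hq' : τ.arr 0 (l + q) = s (l + q) := by
        rw [harr]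
        exact_mod_cast hs (l + q)
      refine Ter.assign (if p ∧ s (l + x) < s (l + q) then 1 else 0) ?_ (Ter.nil (Ter.nil ?_))
      · rw [← mul_ite]
        simp only [Expr.eval, BinOp.apply, g8, g3, g4, hq, h6]
        rw [hW.bmod ((l : ℤ) + q) (by omega) (by omega), hq', hW.ite]
        push_cast
        rw [hr']
      · rw [hq] at hc ⊢
        rw [Int.toNat_natCast]
        simp [eq_ite', hc]
  refine Ter.branch (fun hc => ?_) (fun hc => ?_)
  · simp only [Expr.eval, BinOp.apply, setReg_reg, b0, hW.ite, ne_eq, eq_ite', not_not] at hc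
    refine Ter.nil (second True _ ?_ (by simp) (by simp) (by simp [h3]) (by simp [h4]) (by simp))
    simp only [true_iff]
    exact Or.inl (by simpa using hc)
  · simp only [Expr.eval, BinOp.apply, setReg_reg, b0, hW.ite, eq_ite'] at hc
    replace hc : ¬ σ.arr 6 x < 0 := by simpa using hc
    obtain ⟨p, hp, hpx⟩ := hnb (fun x y => κ x < κ y) (fun _ => lt_irrefl _) _ hP hc
    have hp' : σ.arr 0 (l + p) = s (l + p) := by exact_mod_cast hs (l + p)
    refine Ter.assign (if (s p < s x ↔ s (l + p) < s (l + x)) ∧ ¬ s (l + x) < s (l + p)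
      then 1 else 0) ?_ (Ter.nil (second ((s p < s x ↔ s (l + p) < s (l + x)) ∧
        ¬ s (l + x) < s (l + p)) _ ?_ ?_ (by simp) (by simp [h3]) (by simp [h4]) (by simp)))
    · rw [← mul_ite]
      simp only [Expr.eval, BinOp.apply, setReg_reg, setReg_arr, h3, h4, hp, hs, if_true,
        show ¬ ((7 : ℕ) = 6) by decide, show ¬ ((7 : ℕ) = 8) by decide,
        show ¬ ((5 : ℕ) = 6) by decide, show ¬ ((5 : ℕ) = 8) by decide,
        show ¬ ((5 : ℕ) = 7) by decide, show ¬ ((3 : ℕ) = 6) by decide,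
        show ¬ ((3 : ℕ) = 8) by decide, show ¬ ((3 : ℕ) = 7) by decide,
        show ¬ ((3 : ℕ) = 5) by decide, show ¬ ((4 : ℕ) = 6) by decide,
        show ¬ ((4 : ℕ) = 8) by decide, show ¬ ((4 : ℕ) = 7) by decide,
        show ¬ ((4 : ℕ) = 5) by decide, if_false, b0]
      rw [hW.bmod ((l : ℤ) + p) (by omega) (by omega), hp']
      simp only [hW.ite, eq_ite, eq_ite']
    · rw [hp, Int.toNat_natCast, not_lt]
      rw [hp] at hc
      exact ⟨Or.inr, fun h => h.resolve_left hc⟩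
    · intro _
      simp only [setReg_reg, if_true]
      congr

/-- Compute the order-preserving prefix table into array `8`. -/
def opPref : Prog := block
  [assign 2 (const 1), assign 3 (const 1), assign 4 (const 1),
   loop (bin .lt (reg 2) (reg 0)) (block
    [branch (bin .eq (reg 2) (reg 3))
      (block [assign 6 (const 0),
        branch (bin .lt (reg 4) (reg 0)) testExtend (block []),
        branch (reg 6) (block [assign 4 (bin .add (reg 4) (const 1))])
          (block [write 8 (reg 2) (bin .sub (reg 4) (reg 2)),
            assign 2 (bin .add (reg 2) (const 1))])])
      (block [branch (bin .lt (read 8 (bin .sub (reg 2) (reg 3))) (bin .sub (reg 4) (reg 2)))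
        (block [write 8 (reg 2) (read 8 (bin .sub (reg 2) (reg 3))),
          assign 2 (bin .add (reg 2) (const 1))])
        (block [assign 3 (reg 2)])])])]

theorem opPref_spec (hW : Fits w M) (hnM : (n : ℤ) ≤ M) (h0 : σ.reg 0 = n)
    (hs : ∀ i : ℕ, σ.arr 0 i = s i)
    (hκ : ∀ a < n, ∀ b < n, κ a < κ b ↔ s a < s b ∨ s a = s b ∧ a < b)
    (h67 : ∀ y < n, IsNeighbour (fun x y => κ x < κ y) (y + 1) y (σ.arr 6 y) ∧
      IsNeighbour (fun x y => κ y < κ x) (y + 1) y (σ.arr 7 y)) (hF : 3 * n ≤ F) :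
    Ter w F opPref σ fun τ => ∀ j < n, 1 ≤ j → ∃ x : ℕ, τ.arr 8 j = x ∧ IsOpPref s n j x := by
  have h1 := hW.one_le
  have b0 := hW.bmod 0 (by omega) (by omega)
  have b1 := hW.bmod 1 (by omega) (by omega)
  refine Ter.assign 1 b1 (Ter.assign 1 b1 (Ter.assign 1 b1 (Ter.cons ?_)))
  -- The ghost triple is `(l, j, r)`: the window from `l` to `r` matches a prefix, and `j` is the
  -- position whose entry is sought. The bound `max n 1` allows for the initial `r = 1` when `n =
  -- 0`.
  refine (Ter.loop (F₁ := 0) (α := ℕ × ℕ × ℕ) (fun a τ => 1 ≤ a.1 ∧ a.1 ≤ a.2.1 ∧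
      a.2.1 ≤ a.2.2 ∧ a.2.2 ≤ max n 1 ∧ τ.reg 3 = a.1 ∧ τ.reg 2 = a.2.1 ∧ τ.reg 4 = a.2.2 ∧
      OpMatch s a.1 (a.2.2 - a.1) ∧
      ∀ j < a.2.1, 1 ≤ j → ∃ x : ℕ, τ.arr 8 j = x ∧ IsOpPref s n j x)
    -- Extending lowers the first term. Recording an entry lowers the second by two and may raise
    -- the indicator by one. Moving `l` up to `j` clears the indicator.
    (fun a => (n - a.2.2) + 2 * (n - a.2.1) + if a.1 < a.2.1 then 1 else 0) (1, 1, 1)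
    ⟨by simp, by simp, by simp, by simp, by simp, by simp, by simp,
      fun a ha => absurd ha (Nat.not_lt_zero a), fun j hj hj' => by simp only at hj; omega⟩
    (by simp; omega) ?_).mono_frame ?_
  · rintro ⟨l, j, r⟩ τ hf ⟨i1, i2, i3, i4, g3, g2, g4, hm, hZ⟩ hc
    dsimp only at i1 i2 i3 i4 g3 g2 g4 hm hZ
    have g0 : τ.reg 0 = n := by rw [hf.1 0 (by decide)]; simp [h0]
    have hjn : j < n := by
      by_contra hcon
      apply hc
      simp only [Expr.eval, BinOp.apply, g2, g0, hW.ite]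
      rw [if_neg (by omega)]
    have hrn : r ≤ n := by omega
    refine Ter.branch (fun hc => ?_) (fun hc => ?_)
    · have hjl : j = l := by
        by_contra hcon
        apply hc
        simp only [Expr.eval, BinOp.apply, g2, g3, hW.ite]
        rw [if_neg (by omega)]
      subst hjl
      have tail : ∀ υ : State, Frame testExtend (τ.setReg 6 0) υ →
          (υ.reg 6 ≠ 0 ↔ r < n ∧ OpMatch s j (r - j + 1)) →
          Ter w 0 (block [branch (reg 6) (block [assign 4 (bin .add (reg 4) (const 1))])
            (block [write 8 (reg 2) (bin .sub (reg 4) (reg 2)),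
              assign 2 (bin .add (reg 2) (const 1))])]) υ fun τ => Ter w 0 (block []) τ fun υ =>
            ∃ b : ℕ × ℕ × ℕ, (1 ≤ b.1 ∧ b.1 ≤ b.2.1 ∧
              b.2.1 ≤ b.2.2 ∧ b.2.2 ≤ max n 1 ∧ υ.reg 3 = b.1 ∧ υ.reg 2 = b.2.1 ∧
              υ.reg 4 = b.2.2 ∧ OpMatch s b.1 (b.2.2 - b.1) ∧
              ∀ j < b.2.1, 1 ≤ j → ∃ x : ℕ, υ.arr 8 j = x ∧ IsOpPref s n j x) ∧
              (n - b.2.2) + 2 * (n - b.2.1) + (if b.1 < b.2.1 then 1 else 0) <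
                (n - r) + 2 * (n - j) + if j < j then 1 else 0 := by
        intro υ hfυ hiff
        have k2 : υ.reg 2 = j := by rw [hfυ.1 2 (by decide)]; simp [g2]
        have k3 : υ.reg 3 = j := by rw [hfυ.1 3 (by decide)]; simp [g3]
        have k4 : υ.reg 4 = r := by rw [hfυ.1 4 (by decide)]; simp [g4]
        have k8 : υ.arr 8 = τ.arr 8 := by rw [hfυ.2 8 (by decide)]; simp
        refine Ter.branch (fun hc => ?_) (fun hc => ?_)
        · obtain ⟨hr, hm'⟩ := hiff.1 hc
          refine Ter.assign (r + 1) ?_ (Ter.nil (Ter.nil (Ter.nil ⟨(j, j, r + 1), ?_, ?_⟩)))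
          · simp only [Expr.eval, BinOp.apply, k4, b1]
            exact hW.bmod _ (by omega) (by omega)
          · refine ⟨i1, le_rfl, by simp only; omega, by simp only; omega, by simp [k3], by simp [k2],
              by simp, ?_, ?_⟩
            · exact hm'.mono (by simp only; omega)
            · simpa [k8] using hZ
          · simp only [lt_irrefl, if_false]
            omega
        · have hnot : ¬ (r < n ∧ OpMatch s j (r - j + 1)) := fun h => hiff.2 h hc
          -- A single letter always matches, so the extension test cannot fail while the window is
          -- empty.
          have hjr : j < r := by
            by_contra hcon
            obtain rfl : j = r := by omega
            exact hnot ⟨hjn, by simpa using opMatch_one s j⟩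
          refine Ter.write j (r - j : ℕ) (by simp [Expr.eval, k2]) ?_ ?_
          · simp only [Expr.eval, BinOp.apply, k4, k2]
            rw [hW.bmod _ (by omega) (by omega)]
            omega
          refine Ter.assign (j + 1) ?_ (Ter.nil (Ter.nil (Ter.nil ⟨(j, j + 1, r), ?_, ?_⟩)))
          · simp only [Expr.eval, BinOp.apply, setArr_reg, k2, b1]
            exact hW.bmod _ (by omega) (by omega)
          · refine ⟨i1, by simp, by simp only; omega, by simp only; omega, by simp [k3],
              by simp, by simp [k4], hm, ?_⟩
            intro i hi hi1
            rcases (Nat.lt_succ_iff.1 hi).lt_or_eq with hi | rfl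
            · obtain ⟨x, hx⟩ := hZ i hi hi1
              exact ⟨x, by simp [hi.ne, k8, hx.1], hx.2⟩
            · exact ⟨r - i, by simp, hm, by omega, fun h h' => hnot ⟨by omega, h'⟩⟩
          · simp only [lt_irrefl, if_false]
            split_ifs <;> omega
      refine Ter.assign 0 b0 (Ter.branch (fun hc => ?_) (fun hc => ?_))
      · have hrn' : r < n := by
          by_contra hcon
          apply hc
          simp [Expr.eval, BinOp.apply, g4, g0, hW.ite]
          omega
        obtain ⟨x, rfl⟩ : ∃ x, r = j + x := ⟨r - j, by omega⟩
        rw [Nat.add_sub_cancel_left] at hm tail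
        refine (testExtend_spec (σ := τ.setReg 6 0) hW hnM (by
            intro i
            rw [setReg_arr, hf.2 0 (by decide)]
            simpa using hs i) hκ (by
            intro y hy
            rw [setReg_arr, hf.2 6 (by decide), hf.2 7 (by decide)]
            simpa using h67 y hy) (by simp [g3]) (by simp [g4]) hrn' hm).mono_frame
          fun υ hfυ hυ => tail υ hfυ ?_
        simpa [hrn'] using hυ
      · have hrn' : ¬ r < n := by
          intro hcon
          simp [Expr.eval, BinOp.apply, g4, g0, hW.ite] at hc
          omega
        exact Ter.nil (tail _ (Frame.refl _ _) (by simp [hrn']))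
    · have hjl : l < j := by
        by_contra hcon
        have : j = l := by omega
        simp [Expr.eval, BinOp.apply, g2, g3, this, b1] at hc
      obtain ⟨k, rfl⟩ : ∃ k, j = l + k := ⟨j - l, by omega⟩
      obtain ⟨x, hx, hpx⟩ := hZ k (by omega) (by omega)
      have ek : Expr.eval w τ (bin .sub (reg 2) (reg 3)) = k := by
        simp only [Expr.eval, BinOp.apply, g2, g3]
        rw [hW.bmod _ (by omega) (by omega)]
        omega
      have er : Expr.eval w τ (bin .sub (reg 4) (reg 2)) = (r - (l + k) : ℕ) := by
        simp only [Expr.eval, BinOp.apply, g4, g2]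
        rw [hW.bmod _ (by omega) (by omega)]
        omega
      have ec : Expr.eval w τ (bin .lt (read 8 (bin .sub (reg 2) (reg 3)))
          (bin .sub (reg 4) (reg 2))) = if x < r - (l + k) then 1 else 0 := by
        rw [Expr.eval, er, Expr.eval, ek, hx]
        simp only [BinOp.apply, hW.ite, Nat.cast_lt]
      refine Ter.branch (fun hc => ?_) (fun hc => ?_)
      · have hlt : x < r - (l + k) := by
          by_contra hcon
          exact hc (by rw [ec, if_neg hcon])
        refine Ter.write (l + k : ℕ) x (by simp only [Expr.eval, g2])
          (by rw [Expr.eval, ek, hx]) ?_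
        refine Ter.assign (l + k + 1 : ℕ) ?_ (Ter.nil (Ter.nil (Ter.nil
          ⟨(l, l + k + 1, r), ?_, ?_⟩)))
        · simp only [Expr.eval, BinOp.apply, setArr_reg, g2, b1]
          rw [hW.bmod _ (by omega) (by omega)]
          omega
        · refine ⟨i1, by simp only; omega, by simp only; omega, i4, by simp [g3], by simp,
            by simp [g4], hm, ?_⟩
          intro i hi hi1
          rcases (Nat.lt_succ_iff.1 hi).lt_or_eq with hi | rfl
          · obtain ⟨x, hx⟩ := hZ i hi hi1
            refine ⟨x, ?_, hx.2⟩
            have : ¬ ((i : ℤ) = l + k) := by omega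
            simp [this, hx.1]
          -- The copied match stops strictly inside the window, so its failing extension is also
          -- visible there and transfers.
          · refine ⟨x, by simp, (hm.shift (by omega)).2 hpx.1, by omega, fun _ h => ?_⟩
            exact hpx.2.2 (by omega) ((hm.shift (by omega)).1 h)
        · simp only
          split_ifs <;> omega
      · have hge : r - (l + k) ≤ x := by
          by_contra hcon
          rw [ec, if_pos (by omega)] at hc
          exact one_ne_zero hc
        -- The old entry reaches the end of the window, so the match at `j` holds up to `r`;
        -- comparison resumes there without moving `r` back.
        refine Ter.assign (l + k : ℕ) (by simp only [Expr.eval, g2])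
          (Ter.nil (Ter.nil (Ter.nil ⟨(l + k, l + k, r), ?_, ?_⟩)))
        · refine ⟨by simp only; omega, le_rfl, i3, i4, by simp, by simp [g2],
            by simp [g4], (hm.shift (y := r - (l + k)) (by omega)).2 (hpx.1.mono hge), ?_⟩
          simpa using hZ
        · simp only [lt_irrefl, if_false, show l < l + k by omega, if_true]
          omega
  · rintro τ hf ⟨⟨l, j, r⟩, ⟨i1, i2, i3, i4, g3, g2, g4, hm, hZ⟩, hc⟩
    have g0 : τ.reg 0 = n := by rw [hf.1 0 (by decide)]; simp [h0]
    have hjn : n ≤ j := by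
      by_contra hcon
      dsimp only at g2
      simp only [Expr.eval, BinOp.apply, g2, g0, hW.ite] at hc
      rw [if_pos (by omega)] at hc
      exact one_ne_zero hc
    exact Ter.nil fun i hi => hZ i (lt_of_lt_of_le hi hjn)

end WordRAM

/-! ### Arithmetic of the linear sieve. -/

/-- With `g = gcd(i, n)`, the new gcd is a multiple of `g` and a divisor of `p * g`, so only two
values are possible and one divisibility test decides. -/
theorem gcd_prime_mul {p i n : ℕ} (hp : p.Prime) :
    Nat.gcd (p * i) n = if p * Nat.gcd i n ∣ n then p * Nat.gcd i n else Nat.gcd i n := by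
  have h₁ : Nat.gcd (p * i) n ∣ p * Nat.gcd i n := by
    rw [← Nat.gcd_mul_left]
    exact Nat.dvd_gcd (Nat.gcd_dvd_left _ _) ((Nat.gcd_dvd_right _ _).trans (Nat.dvd_mul_left _ _))
  have h₂ : Nat.gcd i n ∣ Nat.gcd (p * i) n := Nat.gcd_dvd_gcd_of_dvd_left _ (Nat.dvd_mul_left _ _)
  split_ifs with h
  · exact Nat.dvd_antisymm h₁ (Nat.dvd_gcd (Nat.mul_dvd_mul_left _ (Nat.gcd_dvd_left _ _)) h)
  · obtain ⟨t, ht⟩ := h₂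
    rcases Nat.eq_zero_or_pos (Nat.gcd i n) with h0 | h0
    · rw [ht, h0, zero_mul]
    · rw [ht, mul_comm p] at h₁
      have h₃ := Nat.dvd_of_mul_dvd_mul_left h0 h₁
      rcases (Nat.dvd_prime hp).1 h₃ with rfl | rfl
      · rw [ht, mul_one]
      · exact absurd (by rw [mul_comm, ← ht]; exact Nat.gcd_dvd_right _ _) h

/-- The numbers treated by the linear sieve when it has reached the `idx`-th prime multiple of
`i`. -/
def Sieved (i idx m : ℕ) : Prop :=
  m = 1 ∨ m.Prime ∧ m ≤ i ∨
    ¬ m.Prime ∧ m ≠ 1 ∧ (m / m.minFac < i ∨ m / m.minFac = i ∧ Nat.count Nat.Prime m.minFac < idx)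

theorem minFac_mul_of_le {p i : ℕ} (hp : p.Prime) (h : p ≤ i.minFac) :
    (p * i).minFac = p := by
  refine le_antisymm (Nat.minFac_le_of_dvd hp.two_le (Nat.dvd_mul_right _ _)) ?_
  have h₁ : (p * i).minFac ∣ p * i := Nat.minFac_dvd _
  have hne : p * i ≠ 1 := by
    intro h'
    exact hp.one_lt.ne' (Nat.eq_one_of_mul_eq_one_right h')
  rcases (Nat.minFac_prime hne).dvd_mul.1 h₁ with h₂ | h₂
  · exact ((Nat.prime_dvd_prime_iff_eq (Nat.minFac_prime hne) hp).1 h₂).ge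
  · exact h.trans (Nat.minFac_le_of_dvd (Nat.minFac_prime hne).two_le h₂)

theorem count_prime_lt_iff {q k : ℕ} (hq : q.Prime) :
    Nat.count Nat.Prime q < k ↔ q < Nat.nth Nat.Prime k := by
  conv_rhs => rw [← Nat.nth_count hq]
  exact (Nat.nth_lt_nth Nat.infinite_setOfPred_prime).symm

theorem minFac_mul_div (m : ℕ) : m.minFac * (m / m.minFac) = m :=
  Nat.mul_div_cancel' (Nat.minFac_dvd m)

theorem div_minFac_lt {m : ℕ} (h0 : 0 < m) (h1 : m ≠ 1) : m / m.minFac < m :=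
  Nat.div_lt_self h0 (Nat.minFac_prime h1).one_lt

theorem minFac_le_minFac_div {m : ℕ} (h : m / m.minFac ≠ 1) :
    m.minFac ≤ (m / m.minFac).minFac :=
  Nat.minFac_le_of_dvd (Nat.minFac_prime h).two_le
    ((Nat.minFac_dvd _).trans (Nat.div_dvd_of_dvd (Nat.minFac_dvd m)))

theorem prime_of_div_minFac_eq_one {m : ℕ} (h1 : m ≠ 1) (h : m / m.minFac = 1) : m.Prime := by
  have := minFac_mul_div m
  rw [h, mul_one] at this
  rw [← this]
  exact Nat.minFac_prime h1

theorem sieved_self {i idx : ℕ} (hi : 1 ≤ i) : Sieved i idx i := by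
  by_cases h1 : i = 1
  · exact Or.inl h1
  · by_cases hp : i.Prime
    · exact Or.inr (Or.inl ⟨hp, le_rfl⟩)
    · exact Or.inr (Or.inr ⟨hp, h1, Or.inl (div_minFac_lt (by omega) h1)⟩)

/-- A composite is marked only as its least prime factor times the cofactor, so each marking is new
and lowers the potential. -/
theorem not_sieved_mul {i idx : ℕ} (hi : 2 ≤ i) (hle : Nat.nth Nat.Prime idx ≤ i.minFac) :
    ¬ Sieved i idx (Nat.nth Nat.Prime idx * i) := by
  have hp := Nat.prime_nth_prime idx
  set p := Nat.nth Nat.Prime idx with hpdef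
  rintro (h | ⟨h, -⟩ | ⟨-, -, h⟩)
  · have := hp.two_le
    nlinarith
  · exact Nat.not_prime_mul hp.one_lt.ne' (by omega) h
  · rw [minFac_mul_of_le hp hle, Nat.mul_div_cancel_left _ hp.pos] at h
    rcases h with h | ⟨-, h⟩
    · omega
    · rw [count_prime_lt_iff hp] at h
      omega

/-- Once the current prime divides `i`, it is the least prime factor of every further prime multiple
of `i`. Those belong to other cofactors, so jumping to the end of the list of primes loses nothing.
-/
theorem sieved_step {i idx idx' m : ℕ} (hi : 2 ≤ i) (hle : Nat.nth Nat.Prime idx ≤ i.minFac)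
    (hidx : idx' = idx + 1 ∨
      Nat.nth Nat.Prime idx ∣ i ∧ idx' = Nat.count Nat.Prime (i + 1)) :
    Sieved i idx' m ↔ Sieved i idx m ∨ m = Nat.nth Nat.Prime idx * i := by
  have hp := Nat.prime_nth_prime idx
  have hidx' : idx < idx' := by
    rcases hidx with h | ⟨h, h'⟩
    · omega
    · rw [h', ← Nat.count_nth_of_infinite Nat.infinite_setOfPred_prime idx]
      have h₁ := Nat.le_of_dvd (by omega) h
      have h₂ := (count_prime_lt_iff (k := Nat.count Nat.Prime (i + 1)) hp).2
      refine h₂ ?_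
      have h₃ := Nat.le_nth_count (p := Nat.Prime) Nat.infinite_setOfPred_prime (i + 1)
      omega
  constructor
  · rintro (h | h | ⟨h₁, h₂, h | ⟨h₃, h⟩⟩)
    · exact Or.inl (Or.inl h)
    · exact Or.inl (Or.inr (Or.inl h))
    · exact Or.inl (Or.inr (Or.inr ⟨h₁, h₂, Or.inl h⟩))
    · by_cases hlt : Nat.count Nat.Prime m.minFac < idx
      · exact Or.inl (Or.inr (Or.inr ⟨h₁, h₂, Or.inr ⟨h₃, hlt⟩⟩))
      · have hm := minFac_mul_div m
        rw [h₃] at hm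
        have hq := Nat.minFac_prime h₂
        have hge : Nat.nth Nat.Prime idx ≤ m.minFac := by
          rw [count_prime_lt_iff hq] at hlt
          omega
        rcases hidx with rfl | ⟨hd, -⟩
        · have : Nat.count Nat.Prime m.minFac = idx := by omega
          right
          rw [← this, Nat.nth_count hq, hm]
        · right
          have : m.minFac ≤ Nat.nth Nat.Prime idx := by
            refine Nat.minFac_le_of_dvd hp.two_le (hd.trans ?_)
            rw [← hm]
            exact Nat.dvd_mul_left _ _
          rw [← le_antisymm this hge, hm]
  · rintro ((h | h | ⟨h₁, h₂, h | ⟨h₃, h⟩⟩) | rfl)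
    · exact Or.inl h
    · exact Or.inr (Or.inl h)
    · exact Or.inr (Or.inr ⟨h₁, h₂, Or.inl h⟩)
    · exact Or.inr (Or.inr ⟨h₁, h₂, Or.inr ⟨h₃, by omega⟩⟩)
    · have h2 := hp.two_le
      refine Or.inr (Or.inr ⟨Nat.not_prime_mul hp.one_lt.ne' (by omega), by nlinarith, Or.inr ?_⟩)
      rw [minFac_mul_of_le hp hle, Nat.mul_div_cancel_left _ hp.pos,
        Nat.count_nth_of_infinite Nat.infinite_setOfPred_prime]
      exact ⟨rfl, hidx'⟩

/-- When the primes up to `i` are exhausted or the next multiple exceeds `n`, every number up to `n`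
with cofactor `i` has been reached; the only possible newcomer is a prime `i + 1`. -/
theorem sieved_next {n i idx m : ℕ} (hi : 1 ≤ i) (hmn : m ≤ n)
    (hidx : idx = Nat.count Nat.Prime (i + 1) ∨ n < Nat.nth Nat.Prime idx * i) :
    Sieved (i + 1) 0 m ↔ Sieved i idx m ∨ m.Prime ∧ m = i + 1 := by
  constructor
  · rintro (h | ⟨h, h'⟩ | ⟨h₁, h₂, h | ⟨h₃, h⟩⟩)
    · exact Or.inl (Or.inl h)
    · by_cases hmi : m = i + 1
      · exact Or.inr ⟨h, hmi⟩
      · exact Or.inl (Or.inr (Or.inl ⟨h, by omega⟩))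
    · refine Or.inl (Or.inr (Or.inr ⟨h₁, h₂, ?_⟩))
      by_cases hlt : m / m.minFac < i
      · exact Or.inl hlt
      · have heq : m / m.minFac = i := by omega
        refine Or.inr ⟨heq, ?_⟩
        have hi1 : i ≠ 1 := by
          rintro rfl
          exact h₁ (prime_of_div_minFac_eq_one h₂ heq)
        have hq := Nat.minFac_prime h₂
        rcases hidx with h' | h'
        · have hle := minFac_le_minFac_div (by rw [heq]; exact hi1)
          rw [heq] at hle
          rw [h', count_prime_lt_iff hq]
          have h₃ := Nat.le_nth_count (p := Nat.Prime) Nat.infinite_setOfPred_prime (i + 1)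
          have h₄ := Nat.minFac_le (n := i) (by omega)
          omega
        · rw [count_prime_lt_iff hq]
          have hmm := minFac_mul_div m
          rw [heq] at hmm
          exact lt_of_mul_lt_mul_right (by omega : m.minFac * i < _) (Nat.zero_le i)
    · omega
  · rintro ((h | ⟨h, h'⟩ | ⟨h₁, h₂, h | ⟨h₃, h⟩⟩) | ⟨h, h'⟩)
    · exact Or.inl h
    · exact Or.inr (Or.inl ⟨h, by omega⟩)
    · exact Or.inr (Or.inr ⟨h₁, h₂, Or.inl (by omega)⟩)
    · exact Or.inr (Or.inr ⟨h₁, h₂, Or.inl (by omega)⟩)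
    · exact Or.inr (Or.inl ⟨h, by omega⟩)

theorem sieved_of_le {i idx m : ℕ} (h0 : 1 ≤ m) (h : m ≤ i) : Sieved i idx m := by
  by_cases h1 : m = 1
  · exact Or.inl h1
  · by_cases hp : m.Prime
    · exact Or.inr (Or.inl ⟨hp, h⟩)
    · exact Or.inr (Or.inr ⟨hp, h1, Or.inl ((div_minFac_lt (by omega) h1).trans_le h)⟩)

/-- This is how the sieve recognises primes: a composite `i + 1` has a smaller cofactor and has
already been marked. -/
theorem sieved_succ_iff {n i idx : ℕ} (hi : 1 ≤ i) (hin : i + 1 ≤ n)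
    (hidx : idx = Nat.count Nat.Prime (i + 1) ∨ n < Nat.nth Nat.Prime idx * i) :
    Sieved i idx (i + 1) ↔ ¬ (i + 1).Prime := by
  constructor
  · rintro (h | h | h) hp
    · omega
    · omega
    · exact h.1 hp
  · intro hp
    have := (sieved_next hi hin hidx).1 (sieved_of_le (by omega) le_rfl)
    exact this.resolve_right fun h => hp h.1

/-! ### The sieve for greatest common divisors. -/

namespace WordRAM
open WordRAM.Expr WordRAM.Prog

/-- A linear sieve, computing the greatest common divisors with `reg 0` into array `10`; the primes
are listed in array `9`. -/
def gcdSieve : Prog := block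
  [write 10 (const 1) (const 1), assign 2 (const 1), assign 3 (const 0), assign 4 (const 0),
   loop (bin .lt (reg 2) (reg 0)) (block
    [assign 6 (const 0),
     branch (bin .lt (reg 4) (reg 3))
      (block [assign 5 (read 9 (reg 4)), assign 7 (bin .mul (reg 5) (reg 2)),
        assign 6 (bin .lt (reg 7) (bin .add (reg 0) (const 1)))])
      (block []),
     branch (reg 6)
      (block [assign 8 (bin .mul (reg 5) (read 10 (reg 2))),
        branch (bin .eq (bin .mod (reg 0) (reg 8)) (const 0))
          (block [write 10 (reg 7) (reg 8)]) (block [write 10 (reg 7) (read 10 (reg 2))]),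
        branch (bin .eq (bin .mod (reg 2) (reg 5)) (const 0))
          (block [assign 4 (reg 3)]) (block [assign 4 (bin .add (reg 4) (const 1))])])
      (block [assign 2 (bin .add (reg 2) (const 1)), assign 4 (const 0),
        branch (bin .eq (read 10 (reg 2)) (const 0))
          (block [write 9 (reg 3) (reg 2), assign 3 (bin .add (reg 3) (const 1)),
            branch (bin .eq (bin .mod (reg 0) (reg 2)) (const 0))
              (block [write 10 (reg 2) (reg 2)]) (block [write 10 (reg 2) (const 1)])])
          (block [])])])]

variable {w n F : ℕ} {M : ℤ} {σ : State}

open Classical in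
/-- The invariant of the linear sieve. -/
structure SieveInv (n : ℕ) (a : ℕ × ℕ) (τ : State) : Prop where
  reg0 : τ.reg 0 = n
  reg2 : τ.reg 2 = a.1
  reg3 : τ.reg 3 = Nat.count Nat.Prime (a.1 + 1)
  reg4 : τ.reg 4 = a.2
  one_le : 1 ≤ a.1
  le : a.1 ≤ max n 1
  idx_le : a.2 ≤ Nat.count Nat.Prime (a.1 + 1)
  nth_le : a.2 < Nat.count Nat.Prime (a.1 + 1) → Nat.nth Nat.Prime a.2 ≤ a.1.minFac
  primes : ∀ j < Nat.count Nat.Prime (a.1 + 1), τ.arr 9 j = Nat.nth Nat.Prime j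
  gcds : ∀ m : ℕ, 1 ≤ m → m ≤ n → τ.arr 10 m = if Sieved a.1 a.2 m then Nat.gcd m n else 0

open Classical in
/-- The potential of the linear sieve. -/
noncomputable def sievePotential (n : ℕ) (a : ℕ × ℕ) : ℕ :=
  (n - a.1) + ((Finset.Icc 1 n).filter fun m => ¬ Sieved a.1 a.2 m).card

/-- The case `y = 0` is included: the remainder is then `x`, in accordance with `0 ∣ x ↔ x = 0`. -/
theorem eval_mod_eq_zero {e₁ e₂ : Expr} {x y : ℕ} (hW : Fits w M) (hx : (x : ℤ) ≤ M)
    (h₁ : e₁.eval w σ = x) (h₂ : e₂.eval w σ = y) :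
    (bin .eq (bin .mod e₁ e₂) (const 0)).eval w σ = if y ∣ x then 1 else 0 := by
  have h1 := hW.one_le
  have h₃ : ((x % y : ℕ) : ℤ) ≤ M := by
    have : ((x % y : ℕ) : ℤ) ≤ x := by exact_mod_cast Nat.mod_le x y
    linarith
  have h₄ : -M ≤ ((x % y : ℕ) : ℤ) := by
    have := Int.natCast_nonneg (x % y)
    linarith
  simp only [Expr.eval, BinOp.apply, h₁, h₂]
  rw [← Int.natCast_mod, hW.bmod _ h₄ h₃, hW.bmod 0 (by omega) (by omega), hW.ite]
  simp only [Nat.cast_eq_zero, Nat.dvd_iff_mod_eq_zero]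

theorem count_prime_le (i : ℕ) : Nat.count Nat.Prime (i + 1) ≤ i := by
  rw [Nat.count_eq_card_filter_range]
  have : (Finset.range (i + 1)).filter Nat.Prime ⊆ Finset.Icc 1 i := by
    intro p hp
    simp only [Finset.mem_filter, Finset.mem_range] at hp
    have := hp.2.pos
    simp only [Finset.mem_Icc]
    omega
  simpa using Finset.card_le_card this

theorem gcdSieve_mark {i idx p : ℕ} (hW : Fits w M) (hnM : (n : ℤ) ≤ M)
    (hinv : SieveInv n (i, idx) σ)
    (hi : i < n) (hidx : idx < Nat.count Nat.Prime (i + 1)) (hp : p = Nat.nth Nat.Prime idx)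
    (hpi : p * i ≤ n) (h5 : σ.reg 5 = p) (h7 : σ.reg 7 = (p * i : ℕ)) :
    Ter w 0 (block [assign 8 (bin .mul (reg 5) (read 10 (reg 2))),
        branch (bin .eq (bin .mod (reg 0) (reg 8)) (const 0))
          (block [write 10 (reg 7) (reg 8)]) (block [write 10 (reg 7) (read 10 (reg 2))]),
        branch (bin .eq (bin .mod (reg 2) (reg 5)) (const 0))
          (block [assign 4 (reg 3)]) (block [assign 4 (bin .add (reg 4) (const 1))])]) σ
      fun τ => ∃ b, SieveInv n b τ ∧ sievePotential n b < sievePotential n (i, idx) := by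
  classical
  have h1 := hW.one_le
  obtain ⟨g0, g2, g3, g4, hi1, hin, hle, hnth, hpr, hg⟩ := hinv
  dsimp only at g2 g3 g4 hi1 hin hle hnth hpr hg
  have hi2 : 2 ≤ i := by
    by_contra hcon
    obtain rfl : i = 1 := by omega
    simp [Nat.count_succ, Nat.not_prime_zero, Nat.not_prime_one] at hidx
  have hpp : p.Prime := hp ▸ Nat.prime_nth_prime idx
  have hpmin := hnth hidx
  have hgi := hg i hi1 hi.le
  rw [if_pos (sieved_self hi1)] at hgi
  have hgle : Nat.gcd i n ≤ i := Nat.gcd_le_left _ hi1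
  have hgpos : 0 < Nat.gcd i n := Nat.gcd_pos_of_pos_left _ hi1
  have hpn : p * Nat.gcd i n ≤ n := (Nat.mul_le_mul_left p hgle).trans hpi
  have hpg : Expr.eval w σ (bin .mul (reg 5) (read 10 (reg 2))) = (p * Nat.gcd i n : ℕ) := by
    simp only [Expr.eval, BinOp.apply, h5, g2, hgi]
    rw [← Nat.cast_mul]
    exact hW.bmod _ (by omega) (by omega)
  have hcnt := count_prime_le i
  have hple : p ≤ n := le_trans (Nat.le_mul_of_pos_right p hi1) hpi
  have finish : ∀ idx' : ℕ, (idx' = idx + 1 ∧ ¬ p ∣ i ∨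
      p ∣ i ∧ idx' = Nat.count Nat.Prime (i + 1)) → ∀ τ : State, τ.reg 0 = n →
      τ.reg 2 = i → τ.reg 3 = Nat.count Nat.Prime (i + 1) → τ.reg 4 = idx' →
      τ.arr 9 = σ.arr 9 →
      (∀ m : ℕ, τ.arr 10 m = if m = p * i then (Nat.gcd (p * i) n : ℤ) else σ.arr 10 m) →
      ∃ b, SieveInv n b τ ∧ sievePotential n b < sievePotential n (i, idx) := by
    intro idx' hidx' τ k0 k2 k3 k4 k9 k10
    have hstep : ∀ m, Sieved i idx' m ↔ Sieved i idx m ∨ m = p * i := fun m => by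
      rw [hp]
      refine sieved_step hi2 hpmin ?_
      rw [← hp]
      tauto
    refine ⟨(i, idx'), ⟨k0, k2, k3, k4, hi1, hin, ?_, ?_, by rw [k9]; exact hpr, ?_⟩, ?_⟩
    · rcases hidx' with h | h
      · exact h.1 ▸ hidx
      · exact h.2.le
    -- If the current prime does not divide `i`, the least prime factor of `i` is larger, hence at
    -- least the next prime. In the other case the index is at the end and nothing is claimed.
    · intro hlt
      rcases hidx' with ⟨rfl, hnd⟩ | h
      · dsimp only
        have hq := Nat.minFac_prime (show i ≠ 1 by omega)
        have hne : p ≠ i.minFac := fun h => hnd (h ▸ Nat.minFac_dvd i)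
        by_contra hcon
        have := (count_prime_lt_iff (k := idx + 1) hq).2 (by omega)
        have h' : ¬ Nat.count Nat.Prime i.minFac < idx := by
          rw [count_prime_lt_iff hq]; omega
        have h'' : Nat.count Nat.Prime i.minFac = idx := by omega
        rw [hp, ← h'', Nat.nth_count hq] at hne
        exact hne rfl
      · dsimp only at hlt
        omega
    · intro m hm hmn
      dsimp only
      rw [k10, hg m hm hmn]
      by_cases h : m = p * i
      · rw [if_pos h, if_pos ((hstep m).2 (Or.inr h)), h]
      · rw [if_neg h]
        have hiff : Sieved i idx m ↔ Sieved i idx' m := by rw [hstep, or_iff_left h]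
        exact congrArg _ (if_congr hiff rfl rfl)
    · simp only [sievePotential]
      refine Nat.add_lt_add_left (Finset.card_lt_card ?_) _
      rw [Finset.ssubset_iff_of_subset]
      · refine ⟨p * i, ?_, ?_⟩
        · simp only [Finset.mem_filter, Finset.mem_Icc]
          refine ⟨⟨Nat.mul_pos hpp.pos hi1, hpi⟩, ?_⟩
          rw [hp]
          exact not_sieved_mul hi2 hpmin
        · simp [hstep]
      · intro m hm
        simp only [Finset.mem_filter, hstep, not_or] at hm ⊢
        exact ⟨hm.1, hm.2.1⟩
  have tail : ∀ τ : State, τ.reg 0 = n → τ.reg 2 = i → τ.reg 3 = Nat.count Nat.Prime (i + 1) →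
      τ.reg 4 = idx → τ.reg 5 = p → τ.arr 9 = σ.arr 9 →
      (∀ m : ℕ, τ.arr 10 m = if m = p * i then (Nat.gcd (p * i) n : ℤ) else σ.arr 10 m) →
      Ter w 0 (block [branch (bin .eq (bin .mod (reg 2) (reg 5)) (const 0))
          (block [assign 4 (reg 3)]) (block [assign 4 (bin .add (reg 4) (const 1))])]) τ
      fun τ => ∃ b, SieveInv n b τ ∧ sievePotential n b < sievePotential n (i, idx) := by
    intro τ k0 k2 k3 k4 k5 k9 k10
    have hcond : Expr.eval w τ (bin .eq (bin .mod (reg 2) (reg 5)) (const 0)) =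
        if p ∣ i then 1 else 0 := eval_mod_eq_zero hW (by omega) k2 k5
    refine Ter.branch (fun hc => ?_) (fun hc => ?_)
    · have hd : p ∣ i := by
        by_contra hcon
        rw [hcond, if_neg hcon] at hc
        exact hc rfl
      refine Ter.assign _ (by simp only [Expr.eval]; exact k3) (Ter.nil (Ter.nil ?_))
      exact finish _ (Or.inr ⟨hd, rfl⟩) _ (by simp [k0]) (by simp [k2]) (by simp [k3])
        (by simp) (by simp [k9]) (by simpa using k10)
    · have hd : ¬ p ∣ i := by
        intro hcon
        rw [hcond, if_pos hcon] at hc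
        exact one_ne_zero hc
      refine Ter.assign (idx + 1 : ℕ) ?_ (Ter.nil (Ter.nil ?_))
      · simp only [Expr.eval, BinOp.apply, k4]
        rw [hW.bmod 1 (by omega) (by omega), hW.bmod _ (by omega) (by omega)]
        push_cast
        rfl
      exact finish _ (Or.inl ⟨rfl, hd⟩) _ (by simp [k0]) (by simp [k2]) (by simp [k3])
        (by simp) (by simp [k9]) (by simpa using k10)
  refine Ter.assign _ hpg ?_
  have hgcd := gcd_prime_mul (i := i) (n := n) hpp
  have hcond : Expr.eval w (σ.setReg 8 (p * Nat.gcd i n : ℕ))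
      (bin .eq (bin .mod (reg 0) (reg 8)) (const 0)) =
      if p * Nat.gcd i n ∣ n then 1 else 0 :=
    eval_mod_eq_zero hW (by omega) (by simp [Expr.eval, g0])
      (by simp only [Expr.eval, setReg_reg, if_true])
  refine Ter.branch (fun hc => ?_) (fun hc => ?_)
  · have hd : p * Nat.gcd i n ∣ n := by
      by_contra hcon
      rw [hcond, if_neg hcon] at hc
      exact hc rfl
    rw [if_pos hd] at hgcd
    refine Ter.write (p * i : ℕ) (p * Nat.gcd i n : ℕ) (by simp [Expr.eval, h7])
      (by simp [Expr.eval]) (Ter.nil ?_)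
    refine tail _ (by simp [g0]) (by simp [g2]) (by simp [g3]) (by simp [g4]) (by simp [h5])
      (by funext; simp) fun m => ?_
    simp only [setReg_arr, setArr_arr, true_and, Nat.cast_inj, hgcd]
  · have hd : ¬ p * Nat.gcd i n ∣ n := by
      intro hcon
      rw [hcond, if_pos hcon] at hc
      exact one_ne_zero hc
    rw [if_neg hd] at hgcd
    refine Ter.write (p * i : ℕ) (Nat.gcd i n : ℕ) (by simp [Expr.eval, h7])
      (by simp [Expr.eval, g2, hgi]) (Ter.nil ?_)
    refine tail _ (by simp [g0]) (by simp [g2]) (by simp [g3]) (by simp [g4]) (by simp [h5])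
      (by funext; simp) fun m => ?_
    simp only [setReg_arr, setArr_arr, true_and, Nat.cast_inj, hgcd]

/-- Since gcds here are positive, a zero cell means that `i + 1` is unmarked, hence prime; its gcd
with `n` is then itself or `1`. -/
theorem gcdSieve_next {i idx : ℕ} (hW : Fits w M) (hnM : (n : ℤ) ≤ M)
    (hinv : SieveInv n (i, idx) σ) (hi : i < n)
    (hidx : idx = Nat.count Nat.Prime (i + 1) ∨ n < Nat.nth Nat.Prime idx * i) :
    Ter w 0 (block [assign 2 (bin .add (reg 2) (const 1)), assign 4 (const 0),
        branch (bin .eq (read 10 (reg 2)) (const 0))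
          (block [write 9 (reg 3) (reg 2), assign 3 (bin .add (reg 3) (const 1)),
            branch (bin .eq (bin .mod (reg 0) (reg 2)) (const 0))
              (block [write 10 (reg 2) (reg 2)]) (block [write 10 (reg 2) (const 1)])])
          (block [])]) σ
      fun τ => ∃ b, SieveInv n b τ ∧ sievePotential n b < sievePotential n (i, idx) := by
  classical
  have h1 := hW.one_le
  have b0 := hW.bmod 0 (by omega) (by omega)
  have b1 := hW.bmod 1 (by omega) (by omega)
  obtain ⟨g0, g2, g3, g4, hi1, hin, hle, hnth, hpr, hg⟩ := hinv
  dsimp only at g2 g3 g4 hi1 hin hle hnth hpr hg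
  have hnext : ∀ m ≤ n, (Sieved (i + 1) 0 m ↔ Sieved i idx m ∨ m.Prime ∧ m = i + 1) :=
    fun m hmn => sieved_next hi1 hmn hidx
  have hsucc := sieved_succ_iff hi1 hi hidx
  have hgi := hg (i + 1) (by omega) hi
  have hcnt := count_prime_le i
  have hcnt' : Nat.count Nat.Prime (i + 1 + 1) =
      Nat.count Nat.Prime (i + 1) + if (i + 1).Prime then 1 else 0 := Nat.count_succ _ _
  have finish : ∀ τ : State, τ.reg 0 = n → τ.reg 2 = i + 1 →
      τ.reg 3 = Nat.count Nat.Prime (i + 1 + 1) → τ.reg 4 = 0 →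
      (∀ j < Nat.count Nat.Prime (i + 1 + 1), τ.arr 9 j = Nat.nth Nat.Prime j) →
      (∀ m : ℕ, τ.arr 10 m =
        if (i + 1).Prime ∧ m = i + 1 then (Nat.gcd (i + 1) n : ℤ) else σ.arr 10 m) →
      ∃ b, SieveInv n b τ ∧ sievePotential n b < sievePotential n (i, idx) := by
    intro τ k0 k2 k3 k4 k9 k10
    refine ⟨(i + 1, 0), ⟨k0, by simpa using k2, k3, k4, by simp, by simp only; omega, by simp,
      fun _ => ?_, k9, ?_⟩, ?_⟩
    · simp only [Nat.nth_prime_zero_eq_two]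
      exact (Nat.minFac_prime (by omega)).two_le
    · intro m hm hmn
      dsimp only
      rw [k10, hg m hm hmn]
      by_cases h : (i + 1).Prime ∧ m = i + 1
      · obtain ⟨h, rfl⟩ := h
        rw [if_pos ⟨h, rfl⟩, if_pos (sieved_of_le (by omega) le_rfl)]
      · have h' : ¬ (m.Prime ∧ m = i + 1) := by
          rintro ⟨h₁, rfl⟩
          exact h ⟨h₁, rfl⟩
        have hiff : Sieved i idx m ↔ Sieved (i + 1) 0 m := by rw [hnext m hmn, or_iff_left h']
        rw [if_neg h]
        exact congrArg _ (if_congr hiff rfl rfl)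
    · simp only [sievePotential]
      refine Nat.add_lt_add_of_lt_of_le (by omega) (Finset.card_le_card fun m hm => ?_)
      simp only [Finset.mem_filter, Finset.mem_Icc] at hm ⊢
      refine ⟨hm.1, fun h => hm.2 ?_⟩
      exact (hnext m hm.1.2).2 (Or.inl h)
  refine Ter.assign (i + 1) ?_ (Ter.assign 0 b0 (Ter.branch (fun hc => ?_) (fun hc => ?_)))
  · simp only [Expr.eval, BinOp.apply, g2, b1]
    exact hW.bmod _ (by omega) (by omega)
  · have hz : σ.arr 10 (i + 1 : ℕ) = 0 := by
      by_contra hcon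
      apply hc
      simp only [Expr.eval, BinOp.apply, setReg_reg, setReg_arr, if_true, b0, hW.ite,
        show ¬ ((2 : ℕ) = 4) by decide, if_false]
      rw [if_neg (by exact_mod_cast hcon)]
    have hprime : (i + 1).Prime := by
      by_contra hcon
      rw [if_pos (hsucc.2 hcon)] at hgi
      have := Nat.gcd_pos_of_pos_left n (show 0 < i + 1 by omega)
      omega
    rw [if_pos hprime] at hcnt'
    refine Ter.write (Nat.count Nat.Prime (i + 1) : ℕ) (i + 1) (by simp [Expr.eval, g3])
      (by simp [Expr.eval]) ?_
    refine Ter.assign (Nat.count Nat.Prime (i + 1 + 1) : ℕ) ?_ ?_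
    · rw [hcnt']
      simp only [Expr.eval, BinOp.apply, setReg_reg, setArr_reg, b1,
        show ¬ ((3 : ℕ) = 4) by decide, show ¬ ((3 : ℕ) = 2) by decide, if_false, g3]
      rw [hW.bmod _ (by omega) (by omega)]
      push_cast
      rfl
    have k9 : ∀ j < Nat.count Nat.Prime (i + 1 + 1),
        (if (j : ℤ) = (Nat.count Nat.Prime (i + 1) : ℕ) then (i + 1 : ℤ) else σ.arr 9 j) =
          Nat.nth Nat.Prime j := by
      intro j hj
      simp only [Nat.cast_inj]
      split_ifs with h
      · rw [h, Nat.nth_count hprime]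
        push_cast
        rfl
      · exact hpr j (by omega)
    refine Ter.branch (fun hc => ?_) (fun hc => ?_) <;>
      rw [eval_mod_eq_zero (x := n) (y := i + 1) hW (by omega)
        (by simp [Expr.eval, g0]) (by simp [Expr.eval])] at hc
    · have hd : i + 1 ∣ n := by
        by_contra hcon
        rw [if_neg hcon] at hc
        exact hc rfl
      refine Ter.write (i + 1) (i + 1) (by simp [Expr.eval]) (by simp [Expr.eval])
        (Ter.nil (Ter.nil (Ter.nil ?_)))
      refine finish _ (by simp [g0]) (by simp) (by simp) (by simp) (by simpa using k9) ?_
      intro m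
      rw [Nat.gcd_eq_left hd]
      have : ((m : ℤ) = i + 1) ↔ m = i + 1 := by omega
      simp [hprime, this]
    · have hd : ¬ i + 1 ∣ n := by
        intro hcon
        rw [if_pos hcon] at hc
        exact one_ne_zero hc
      refine Ter.write (i + 1) 1 (by simp [Expr.eval]) b1
        (Ter.nil (Ter.nil (Ter.nil ?_)))
      refine finish _ (by simp [g0]) (by simp) (by simp) (by simp) (by simpa using k9) ?_
      intro m
      rw [(Nat.Prime.coprime_iff_not_dvd hprime).2 hd]
      have : ((m : ℤ) = i + 1) ↔ m = i + 1 := by omega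
      simp [hprime, this]
  · have hz : σ.arr 10 (i + 1 : ℕ) ≠ 0 := by
      intro hcon
      simp only [Expr.eval, BinOp.apply, setReg_reg, setReg_arr, if_true, b0, hW.ite,
        show ¬ ((2 : ℕ) = 4) by decide, if_false] at hc
      rw [if_pos (by exact_mod_cast hcon)] at hc
      exact one_ne_zero hc
    have hprime : ¬ (i + 1).Prime := by
      intro hcon
      rw [if_neg (by rw [hsucc]; exact not_not.2 hcon)] at hgi
      exact hz hgi
    rw [if_neg hprime, add_zero] at hcnt'
    refine Ter.nil (Ter.nil (finish _ (by simp [g0]) (by simp) (by simp [g3, hcnt']) (by simp)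
      ?_ ?_))
    · rw [hcnt']
      simpa using hpr
    · simp [hprime]

/-- Each round marks a new number or advances `i`, so the potential is at most `2 * n`. The product
`p * i` is formed before it is compared with `n`, which is why `n * n` must fit into a word. -/
theorem gcdSieve_spec (hW : Fits w M) (hnM : (n : ℤ) + 1 ≤ M) (hn2M : (n : ℤ) * n ≤ M)
    (h0 : σ.reg 0 = n) (h10 : ∀ i : ℕ, σ.arr 10 i = 0) (hF : 2 * n ≤ F) :
    Ter w F gcdSieve σ fun τ => ∀ m : ℕ, 1 ≤ m → m ≤ n → τ.arr 10 m = Nat.gcd m n := by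
  classical
  have h1 := hW.one_le
  have b0 := hW.bmod 0 (by omega) (by omega)
  have b1 := hW.bmod 1 (by omega) (by omega)
  have hc1 : Nat.count Nat.Prime 2 = 0 := by
    simp [Nat.count_succ, Nat.not_prime_zero, Nat.not_prime_one]
  refine Ter.write 1 1 b1 b1 (Ter.assign 1 b1 (Ter.assign 0 b0 (Ter.assign 0 b0 (Ter.cons ?_))))
  refine (Ter.loop (F₁ := 0) (SieveInv n) (sievePotential n) (1, 0)
    ⟨by simp [h0], by simp, by simp [hc1], by simp, by simp, by simp, by simp,
      by simp [hc1], by simp [hc1], ?_⟩ ?_ ?_).mono ?_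
  · intro m hm hmn
    have hsv : Sieved 1 0 m ↔ m = 1 := by
      constructor
      · rintro (h | ⟨h, h'⟩ | ⟨h₁, h₂, h | ⟨-, h⟩⟩)
        · exact h
        · have := h.two_le
          omega
        · have := Nat.div_pos (Nat.minFac_le (n := m) (by omega)) (Nat.minFac_pos m)
          omega
        · omega
      · exact Or.inl
    by_cases h : m = 1
    · subst h
      simp [Sieved]
    · simp [hsv, h, h10]
  · have : sievePotential n (1, 0) ≤ n - 1 + n :=
      Nat.add_le_add_left ((Finset.card_le_card (Finset.filter_subset _ _)).trans (by simp)) _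
    omega
  · rintro ⟨i, idx⟩ τ hf hinv hc
    obtain ⟨g0, g2, g3, g4, hi1, hin, hle, hnth, hpr, hg⟩ := id hinv
    dsimp only at g2 g3 g4 hi1 hin hle hnth hpr hg
    have hi : i < n := by
      by_contra hcon
      apply hc
      simp only [Expr.eval, BinOp.apply, g2, g0, hW.ite]
      rw [if_neg (by omega)]
    have hcnt := count_prime_le i
    refine Ter.assign 0 b0 (Ter.branch (fun hc => ?_) (fun hc => ?_))
    · have hidx : idx < Nat.count Nat.Prime (i + 1) := by
        by_contra hcon
        apply hc
        simp [Expr.eval, BinOp.apply, g4, g3, hW.ite]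
        omega
      have hpos : 0 < Nat.nth Nat.Prime idx := (Nat.prime_nth_prime idx).pos
      have hpn : Nat.nth Nat.Prime idx ≤ i := (hnth hidx).trans (Nat.minFac_le (by omega))
      have hmul : Nat.nth Nat.Prime idx * i ≤ n * n := Nat.mul_le_mul (by omega) hi.le
      have hmul' : ((Nat.nth Nat.Prime idx * i : ℕ) : ℤ) ≤ (n * n : ℕ) := by exact_mod_cast hmul
      push_cast at hmul'
      refine Ter.assign (Nat.nth Nat.Prime idx : ℕ) (by simp [Expr.eval, g4, hpr idx hidx]) ?_
      refine Ter.assign (Nat.nth Nat.Prime idx * i : ℕ) ?_ ?_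
      · simp [Expr.eval, BinOp.apply, g2]
        have := Int.natCast_nonneg (Nat.nth Nat.Prime idx * i)
        push_cast at this
        exact hW.bmod _ (by linarith) (by linarith)
      refine Ter.assign (if Nat.nth Nat.Prime idx * i ≤ n then 1 else 0) ?_ (Ter.nil ?_)
      · simp only [Expr.eval, BinOp.apply, setReg_reg, if_true, b1, g0,
          show ¬ ((0 : ℕ) = 7) by decide, show ¬ ((0 : ℕ) = 6) by decide,
          show ¬ ((0 : ℕ) = 5) by decide, if_false]
        rw [hW.bmod ((n : ℤ) + 1) (by omega) (by omega), hW.ite]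
        congr 1
        rw [eq_iff_iff]
        omega
      refine Ter.branch (fun hc => ?_) (fun hc => ?_)
      · have hle : Nat.nth Nat.Prime idx * i ≤ n := by
          by_contra hcon
          simp [Expr.eval, hcon] at hc
        refine (gcdSieve_mark hW (by omega) (i := i) (idx := idx) ⟨by simp [g0],
          by simp [g2], by simp [g3], by simp [g4], hi1, hin, hinv.idx_le, hnth,
          by simpa using hpr, by simpa using hg⟩ hi hidx rfl hle (by simp) (by simp)).mono
          fun τ h => Ter.nil h
      · have hle : n < Nat.nth Nat.Prime idx * i := by
          by_contra hcon
          simp [Expr.eval, not_lt.1 hcon] at hc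
        refine (gcdSieve_next hW (by omega) (i := i) (idx := idx) ⟨by simp [g0],
          by simp [g2], by simp [g3], by simp [g4], hi1, hin, hinv.idx_le, hnth,
          by simpa using hpr, by simpa using hg⟩ hi (Or.inr hle)).mono
          fun τ h => Ter.nil h
    · have hidx : ¬ idx < Nat.count Nat.Prime (i + 1) := by
        intro hcon
        simp [Expr.eval, BinOp.apply, g4, g3, hW.ite] at hc
        omega
      refine Ter.nil (Ter.branch (fun hc => ?_) (fun hc => ?_))
      · simp [Expr.eval] at hc
      · refine (gcdSieve_next hW (by omega) (i := i) (idx := idx) ⟨by simp [g0],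
          by simp [g2], by simp [g3], by simp [g4], hi1, hin, hinv.idx_le, hnth,
          by simpa using hpr, by simpa using hg⟩ hi (Or.inl (by omega))).mono
          fun τ h => Ter.nil h
  · rintro τ ⟨⟨i, idx⟩, hinv, hc⟩
    have hi : n ≤ i := by
      by_contra hcon
      have g2 := hinv.reg2
      dsimp only at g2
      simp only [Expr.eval, BinOp.apply, g2, hinv.reg0, hW.ite] at hc
      rw [if_pos (by omega)] at hc
      exact one_ne_zero hc
    refine Ter.nil fun m hm hmn => ?_
    rw [hinv.gcds m hm hmn, if_pos (sieved_of_le hm (by dsimp only; omega))]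

end WordRAM

/-! ### Full op-periods in terms of matches with the prefix. -/

theorem orderEquiv_iff {X Y : List ℤ} : OrderEquiv X Y ↔ X.length = Y.length ∧
    ∀ a < X.length, ∀ b < X.length, X.getD a 0 < X.getD b 0 ↔ Y.getD a 0 < Y.getD b 0 := by
  constructor
  · rintro ⟨h, H⟩
    refine ⟨h, fun a ha b hb => ?_⟩
    have := H ⟨a, ha⟩ ⟨b, hb⟩
    simpa [List.getD_eq_getElem, ha, hb, ← h] using this
  · rintro ⟨h, H⟩
    refine ⟨h, fun ⟨a, ha⟩ ⟨b, hb⟩ => ?_⟩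
    have := H a ha b hb
    simpa [List.getD_eq_getElem, ha, hb, ← h] using this

theorem length_flatten_of_forall_length {p : ℕ} {Vs : List (List ℤ)}
    (h : ∀ V ∈ Vs, V.length = p) : Vs.flatten.length = p * Vs.length := by
  induction Vs with
  | nil => simp
  | cons V Vs ih =>
    rw [List.flatten_cons, List.length_append, ih fun U hU => h U (by simp [hU]),
      h V (by simp), List.length_cons]
    ring

theorem getD_flatten_of_forall_length {p : ℕ} {Vs : List (List ℤ)}
    (h : ∀ V ∈ Vs, V.length = p) {m a : ℕ} (ha : a < p) :
    Vs.flatten.getD (p * m + a) 0 = (Vs.getD m []).getD a 0 := by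
  induction Vs generalizing m with
  | nil => simp
  | cons V Vs ih =>
    have hV := h V (by simp)
    cases m with
    | zero =>
      rw [List.flatten_cons, List.getD_append _ _ _ _ (by omega)]
      simp
    | succ m =>
      have hle : V.length ≤ p * (m + 1) + a := by rw [hV]; nlinarith
      rw [List.flatten_cons, List.getD_append_right _ _ _ _ hle, hV,
        show p * (m + 1) + a - p = p * m + a by rw [mul_add]; omega,
        ih fun U hU => h U (by simp [hU])]
      simp

theorem isFullOpPeriod_iff {S : List ℤ} {p : ℕ} : IsFullOpPeriod S p ↔
    0 < p ∧ p < S.length ∧ p ∣ S.length ∧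
      ∀ j < S.length, 1 ≤ j → p ∣ j → OpMatch (fun i => S.getD i 0) j p := by
  simp only [IsFullOpPeriod, IsInitialOpPeriod, opShifts, Set.mem_ofPred_eq, HasOpPeriod,
    List.take_zero, List.drop_zero]
  constructor
  · rintro ⟨⟨hp, hpn, V₁, Vs, hlen, heq, -, hpre⟩, hdvd⟩
    refine ⟨hp, hpn, hdvd, ?_⟩
    rintro _ hj - ⟨m, rfl⟩
    have hlen' : ∀ V ∈ Vs, V.length = p := fun V hV => hlen V (by simp [hV])
    have hn := hpre.length_le
    rw [length_flatten_of_forall_length hlen'] at hn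
    have hm : m < Vs.length := lt_of_mul_lt_mul_left (hj.trans_le hn) (Nat.zero_le p)
    have hget : ∀ m' a, a < p → p * m' + a < S.length →
        S.getD (p * m' + a) 0 = (Vs.getD m' []).getD a 0 := by
      intro m' a ha hlt
      rw [← getD_flatten_of_forall_length hlen' ha]
      obtain ⟨T, hT⟩ := hpre
      rw [← hT, List.getD_append _ _ _ _ hlt]
    -- Since `p` divides the length, the block starting at a multiple of `p` is complete.
    have hjn : p * m + p ≤ S.length := by
      obtain ⟨e, he⟩ := hdvd
      rw [he] at hj ⊢
      have := lt_of_mul_lt_mul_left hj (Nat.zero_le p)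
      calc p * m + p = p * (m + 1) := by ring
        _ ≤ p * e := Nat.mul_le_mul_left _ this
    have h0 : Vs.getD 0 [] ∈ Vs := by
      rw [List.getD_eq_getElem _ _ (by omega)]
      exact List.getElem_mem _
    have hm' : Vs.getD m [] ∈ Vs := by
      rw [List.getD_eq_getElem _ _ hm]
      exact List.getElem_mem _
    have h := (orderEquiv_iff.1 (heq _ (List.mem_cons_of_mem _ h0) _
      (List.mem_cons_of_mem _ hm'))).2
    rw [hlen' _ h0] at h
    intro a ha b hb
    have e₁ := hget 0 a ha (by omega)
    have e₂ := hget 0 b hb (by omega)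
    rw [mul_zero, zero_add] at e₁ e₂
    dsimp only
    rw [e₁, e₂, hget m a ha (by omega), hget m b hb (by omega)]
    exact h a ha b hb
  · rintro ⟨hp, hpn, hdvd, H⟩
    refine ⟨⟨hp, hpn, ?_⟩, hdvd⟩
    obtain ⟨e, he⟩ := hdvd
    let U : ℕ → List ℤ := fun m => (S.drop (p * m)).take p
    have hmle : ∀ m < e, p * m + p ≤ S.length := fun m hm => by
      rw [he]
      calc p * m + p = p * (m + 1) := by ring
        _ ≤ p * e := Nat.mul_le_mul_left _ hm
    have hU : ∀ m < e, (U m).length = p := fun m hm => by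
      have := hmle m hm
      simp only [U, List.length_take, List.length_drop]
      omega
    have hUget : ∀ m a, a < p → (U m).getD a 0 = S.getD (p * m + a) 0 := by
      intro m a ha
      simp only [U, List.getD_eq_getElem?_getD, List.getElem?_take, if_pos ha, List.getElem?_drop]
    have he0 : 0 < e := by
      rcases Nat.eq_zero_or_pos e with rfl | h
      · omega
      · exact h
    have hmem : ∀ V ∈ U 0 :: (List.range e).map U, ∃ m < e, V = U m := by
      intro V hV
      rcases List.mem_cons.1 hV with rfl | hV
      · exact ⟨0, he0, rfl⟩
      · obtain ⟨m, hm, rfl⟩ := List.mem_map.1 hV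
        exact ⟨m, List.mem_range.1 hm, rfl⟩
    have hmatch : ∀ m < e, OpMatch (fun i => S.getD i 0) (p * m) p := by
      intro m hm
      rcases Nat.eq_zero_or_pos m with rfl | h
      · intro a _ b _
        simp
      · exact H _ (by have := hmle m hm; omega) (Nat.mul_pos hp h) (Nat.dvd_mul_right _ _)
    -- The blocks of `S` themselves are the witness. For shift `0` the block `V₁` only has to be
    -- order-equivalent to them, so the first block is repeated.
    refine ⟨U 0, (List.range e).map U, ?_, ?_, List.nil_suffix, ?_⟩
    · intro V hV
      obtain ⟨m, hm, rfl⟩ := hmem V hV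
      exact hU m hm
    · intro V hV V' hV'
      obtain ⟨m, hm, rfl⟩ := hmem V hV
      obtain ⟨m', hm', rfl⟩ := hmem V' hV'
      refine orderEquiv_iff.2 ⟨by rw [hU m hm, hU m' hm'], ?_⟩
      rw [hU m hm]
      intro a ha b hb
      rw [hUget m a ha, hUget m b hb, hUget m' a ha, hUget m' b hb]
      exact (hmatch m hm a ha b hb).symm.trans (hmatch m' hm' a ha b hb)
    · have hall : ∀ V ∈ (List.range e).map U, V.length = p := fun V hV => by
        obtain ⟨m, hm, rfl⟩ := hmem V (List.mem_cons_of_mem _ hV)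
        exact hU m hm
      have hlen := length_flatten_of_forall_length hall
      rw [List.length_map, List.length_range, ← he] at hlen
      have : S = ((List.range e).map U).flatten := by
        refine List.ext_getElem hlen.symm fun i hi hi' => ?_
        rw [← List.getD_eq_getElem S 0 hi, ← List.getD_eq_getElem _ 0 hi']
        have hm : i / p < e := by
          rw [Nat.div_lt_iff_lt_mul hp, mul_comm, ← he]
          exact hi
        have hia := Nat.div_add_mod i p
        have hget := getD_flatten_of_forall_length (m := i / p) hall (Nat.mod_lt i hp)
        rw [hia] at hget
        rw [hget, List.getD_eq_getElem ((List.range e).map U) [] (by simpa using hm), List.getElem_map,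
          List.getElem_range, hUget _ _ (Nat.mod_lt i hp), hia]
      exact ⟨[], by rw [List.append_nil]; exact this⟩

/-! ### Counting divisors. -/

/-- The divisors of `n` that are less than `i`, in increasing order. -/
def divisorList (n i : ℕ) : List ℕ := (List.range i).filter (· ∣ n)

theorem mem_divisorList {n i d : ℕ} : d ∈ divisorList n i ↔ d < i ∧ d ∣ n := by
  simp [divisorList]

theorem nodup_divisorList (n i : ℕ) : (divisorList n i).Nodup := List.nodup_range.filter _

theorem length_divisorList_le (n i : ℕ) : (divisorList n i).length ≤ i := by
  simpa [divisorList] using List.length_filter_le (fun d => decide (d ∣ n)) (List.range i)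

/-- A divisor is at most `√n` or has a codivisor at most `√n`, so there are at most `2√n` of them.
This makes the loop over pairs of divisors linear. -/
theorem length_divisorList_sq_le (n : ℕ) :
    (divisorList n n).length * (divisorList n n).length ≤ 4 * n := by
  have hcard : (divisorList n n).length = ((Finset.range n).filter (· ∣ n)).card := by
    rw [← List.toFinset_card_of_nodup (nodup_divisorList n n)]
    congr 1
    ext d
    simp [mem_divisorList]
  have hsub : (Finset.range n).filter (· ∣ n) ⊆
      Finset.Icc 1 n.sqrt ∪ (Finset.Icc 1 n.sqrt).image (n / ·) := by
    intro d hd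
    simp only [Finset.mem_filter, Finset.mem_range, Finset.mem_union, Finset.mem_Icc,
      Finset.mem_image] at hd ⊢
    obtain ⟨hdn, e, he⟩ := hd
    have hd0 : 0 < d := Nat.pos_of_ne_zero fun h => by rw [h, zero_mul] at he; omega
    have he0 : 0 < e := Nat.pos_of_ne_zero fun h => by rw [h, mul_zero] at he; omega
    by_cases h : d ≤ n.sqrt
    · exact Or.inl ⟨hd0, h⟩
    · refine Or.inr ⟨e, ⟨he0, ?_⟩, ?_⟩
      · by_contra hcon
        have h₁ := Nat.lt_succ_sqrt n
        have h₂ : (n.sqrt + 1) * (n.sqrt + 1) ≤ d * e := Nat.mul_le_mul (by omega) (by omega)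
        simp only [Nat.succ_eq_add_one] at h₁
        omega
      · rw [he, Nat.mul_div_cancel _ he0]
  have h₁ := (Finset.card_le_card hsub).trans (Finset.card_union_le _ _)
  have h₂ : ((Finset.Icc 1 n.sqrt).image (n / ·)).card ≤ n.sqrt := by
    simpa using Finset.card_image_le (s := Finset.Icc 1 n.sqrt) (f := (n / ·))
  rw [← hcard] at h₁
  simp only [Nat.card_Icc, Nat.add_sub_cancel] at h₁
  have h₃ : (divisorList n n).length ≤ 2 * n.sqrt := by omega
  have h₄ := Nat.sqrt_le n
  nlinarith [Nat.mul_le_mul h₃ h₃]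

/-! ### Minima over gcd classes and selection of the periods. -/

namespace WordRAM
open WordRAM.Expr WordRAM.Prog

/-- Register `x` and array `a` hold the list `L`. -/
def HasList (x a : ℕ) (τ : State) (L : List ℕ) : Prop :=
  τ.reg x = (L.length : ℤ) ∧ ∀ j (h : j < L.length), τ.arr a (j : ℕ) = L[j]

theorem HasList.append {x a : ℕ} {τ υ : State} {L : List ℕ} (h : HasList x a τ L) {d : ℕ}
    (hr : υ.reg x = L.length + 1)
    (ha : ∀ j : ℕ, υ.arr a j = if j = L.length then (d : ℤ) else τ.arr a j) :
    HasList x a υ (L ++ [d]) := by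
  refine ⟨by simp [hr], fun j hj => ?_⟩
  rw [ha]
  split_ifs with hjL
  · subst hjL
    simp
  · have : j < L.length := by
      rw [List.length_append, List.length_singleton] at hj
      omega
    rw [h.2 j this, List.getElem_append_left this]

/-- List the proper divisors of `reg 0` in array `11`, and fill array `12` with `reg 0`. -/
def listDivisors : Prog := block
  [assign 11 (const 0), forLoop 2 0 [write 12 (reg 2) (reg 0),
    branch (bin .eq (bin .mod (reg 0) (reg 2)) (const 0))
      (block [write 11 (reg 11) (reg 2), assign 11 (bin .add (reg 11) (const 1))]) (block [])]]

variable {w n F : ℕ} {M : ℤ} {σ : State}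

theorem listDivisors_spec (hW : Fits w M) (hnM : (n : ℤ) + 1 ≤ M) (h0 : σ.reg 0 = n)
    (hF : n ≤ F) :
    Ter w F listDivisors σ fun τ => HasList 11 11 τ (divisorList n n) ∧
      ∀ d < n, τ.arr 12 (d : ℕ) = n := by
  have h1 := hW.one_le
  have b0 := hW.bmod 0 (by omega) (by omega)
  have b1 := hW.bmod 1 (by omega) (by omega)
  refine Ter.assign 0 b0 (Ter.cons ?_)
  refine (Ter.forLoop hW n (by omega) (fun i τ => HasList 11 11 τ (divisorList n i) ∧
    ∀ d < i, τ.arr 12 (d : ℕ) = n) (by simp [h0]) (by decide) (by decide) (by decide) hF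
    (by simp [HasList, divisorList]) ?_).mono fun τ h => Ter.nil h
  rintro i hi τ hf hx ⟨hL, h12⟩
  have g0 : τ.reg 0 = n := by rw [hf.1 0 (by decide)]; simp [h0]
  have hlen := length_divisorList_le n i
  have hsucc : divisorList n (i + 1) = divisorList n i ++ if i ∣ n then [i] else [] := by
    simp only [divisorList, List.range_succ, List.filter_append]
    by_cases h : i ∣ n <;> simp [h]
  have h12' : ∀ d < i + 1, (if (d : ℤ) = i then (n : ℤ) else τ.arr 12 d) = n := by
    intro d hd
    split_ifs with h
    · rfl
    · exact h12 d (by omega)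
  refine Ter.write i n (by simp [Expr.eval, hx]) (by simp [Expr.eval, g0]) ?_
  refine Ter.branch (fun hc => ?_) (fun hc => ?_) <;>
    rw [eval_mod_eq_zero (x := n) (y := i) hW (by omega) (by simp [Expr.eval, g0])
      (by simp [Expr.eval, hx])] at hc
  · have hd : i ∣ n := by
      by_contra hcon
      rw [if_neg hcon] at hc
      exact hc rfl
    rw [hsucc, if_pos hd]
    refine Ter.write (divisorList n i).length i (by simp [Expr.eval, hL.1])
      (by simp [Expr.eval, hx]) (Ter.assign ((divisorList n i).length + 1) ?_
      (Ter.nil (Ter.nil ⟨hL.append (by simp) (by simp), by simpa using h12'⟩)))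
    simp only [Expr.eval, BinOp.apply, setArr_reg, hL.1, b1]
    exact hW.bmod _ (by omega) (by omega)
  · have hd : ¬ i ∣ n := by
      intro hcon
      rw [if_pos hcon] at hc
      exact one_ne_zero hc
    rw [hsucc, if_neg hd, List.append_nil]
    exact Ter.nil (Ter.nil ⟨⟨by simp [hL.1], by simpa using hL.2⟩, by simpa using h12'⟩)

/-- For every divisor `d`, put the minimum of the entries of array `8` at the positions with
entry `d` in array `10` into array `12`. -/
def classMin : Prog := forLoop 2 0
  [branch (bin .lt (const 0) (reg 2))
    (block [assign 5 (read 10 (reg 2)), assign 6 (read 8 (reg 2)),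
      branch (bin .lt (reg 6) (read 12 (reg 5))) (block [write 12 (reg 5) (reg 6)]) (block [])])
    (block [])]

/-- The minimum is described by its lower bounds up to `n`, which also covers empty classes, where
the initial value `n` remains. -/
theorem classMin_spec {Z : ℕ → ℕ} (hW : Fits w M) (hnM : (n : ℤ) ≤ M) (h0 : σ.reg 0 = n)
    (h8 : ∀ j < n, 1 ≤ j → σ.arr 8 (j : ℕ) = Z j)
    (h10 : ∀ j < n, 1 ≤ j → σ.arr 10 (j : ℕ) = Nat.gcd j n)
    (h12 : ∀ d < n, σ.arr 12 (d : ℕ) = n) (hF : n ≤ F) :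
    Ter w F classMin σ fun τ => ∀ d < n, ∃ g : ℕ, τ.arr 12 (d : ℕ) = g ∧
      ∀ x ≤ n, x ≤ g ↔ ∀ j < n, 1 ≤ j → Nat.gcd j n = d → x ≤ Z j := by
  have h1 := hW.one_le
  have b0 := hW.bmod 0 (by omega) (by omega)
  refine Ter.forLoop hW n hnM (fun i τ => ∀ d < n, ∃ g : ℕ, τ.arr 12 (d : ℕ) = g ∧
      ∀ x ≤ n, x ≤ g ↔ ∀ j < i, 1 ≤ j → Nat.gcd j n = d → x ≤ Z j) h0 (by decide) (by decide)
      (by decide) hF (fun d hd => ⟨n, by simp [h12 d hd], by simp⟩) ?_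
  rintro i hi τ hf hx hG
  refine Ter.branch (fun hc => ?_) (fun hc => ?_) <;>
    simp only [Expr.eval, BinOp.apply, hx, b0, hW.ite] at hc
  · have hi1 : 1 ≤ i := by
      by_contra hcon
      rw [if_neg (by omega)] at hc
      exact hc rfl
    have hgn : Nat.gcd i n < n := (Nat.gcd_le_left _ hi1).trans_lt hi
    obtain ⟨g, hg, hgx⟩ := hG _ hgn
    have e10 : τ.arr 10 i = Nat.gcd i n := by rw [hf.2 10 (by decide), h10 i hi hi1]
    have e8 : τ.arr 8 i = Z i := by rw [hf.2 8 (by decide), h8 i hi hi1]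
    refine Ter.assign (Nat.gcd i n : ℕ) (by simp [Expr.eval, hx, e10]) ?_
    refine Ter.assign (Z i : ℕ) (by simp [Expr.eval, hx, e8]) ?_
    have split : ∀ (d x : ℕ), (∀ j < i + 1, 1 ≤ j → Nat.gcd j n = d → x ≤ Z j) ↔
        (∀ j < i, 1 ≤ j → Nat.gcd j n = d → x ≤ Z j) ∧ (Nat.gcd i n = d → x ≤ Z i) := by
      intro d x
      constructor
      · exact fun h => ⟨fun j hj => h j (by omega), h i (by omega) hi1⟩
      · rintro ⟨h, h'⟩ j hj hj1
        rcases (Nat.lt_succ_iff.1 hj).lt_or_eq with hj | rfl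
        · exact h j hj hj1
        · exact h'
    refine Ter.branch (fun hc => ?_) (fun hc => ?_) <;>
      simp [Expr.eval, BinOp.apply, hg, hW.ite] at hc
    · refine Ter.write (Nat.gcd i n : ℕ) (Z i : ℕ) (by simp [Expr.eval])
        (by simp [Expr.eval]) (Ter.nil (Ter.nil (Ter.nil fun d hd => ?_)))
      by_cases h : d = Nat.gcd i n
      · subst h
        refine ⟨Z i, by simp, fun x hxn => ?_⟩
        rw [split, ← hgx x hxn]
        simp only [forall_const]
        omega
      · obtain ⟨g', hg', hgx'⟩ := hG d hd
        refine ⟨g', by simp [h, hg'], fun x hxn => ?_⟩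
        rw [split, hgx' x hxn]
        simp [Ne.symm h]
    · refine Ter.nil (Ter.nil (Ter.nil fun d hd => ?_))
      obtain ⟨g', hg', hgx'⟩ := hG d hd
      refine ⟨g', by simp [hg'], fun x hxn => ?_⟩
      rw [split, hgx' x hxn]
      refine ⟨fun h => ⟨h, ?_⟩, fun h => h.1⟩
      rintro rfl
      have := (hgx x hxn).2 h
      omega
  · have hi0 : i = 0 := by
      by_contra hcon
      rw [if_pos (by omega)] at hc
      exact one_ne_zero hc
    subst hi0
    refine Ter.nil (Ter.nil fun d hd => ?_)
    obtain ⟨g', hg', hgx'⟩ := hG d hd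
    refine ⟨g', by simpa using hg', fun x hxn => ?_⟩
    rw [hgx' x hxn]
    simp

/-- Output the divisors `d` such that array `12` has no entry less than `d` at a multiple of
`d`. -/
def selectDivisors : Prog := block
  [assign 1 (const 0), assign 3 (const 0), assign 4 (const 0), assign 5 (const 1),
   loop (bin .lt (reg 3) (reg 11)) (block
    [assign 6 (read 11 (reg 3)),
     branch (bin .lt (reg 4) (reg 11))
      (block [assign 7 (read 11 (reg 4)),
        branch (bin .eq (bin .mod (reg 7) (reg 6)) (const 0))
          (block [branch (bin .lt (read 12 (reg 7)) (reg 6)) (block [assign 5 (const 0)])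
            (block [])]) (block []),
        assign 4 (bin .add (reg 4) (const 1))])
      (block [branch (reg 5)
          (block [write 1 (reg 1) (reg 6), assign 1 (bin .add (reg 1) (const 1))]) (block []),
        assign 3 (bin .add (reg 3) (const 1)), assign 4 (const 0), assign 5 (const 1)])])]

theorem selectDivisors_spec {D : List ℕ} {G : ℕ → ℕ} (hW : Fits w M)
    (hDM : (D.length : ℤ) ≤ M) (hD : HasList 11 11 σ D) (hdM : ∀ d ∈ D, (d : ℤ) ≤ M)
    (hG : ∀ d ∈ D, σ.arr 12 (d : ℕ) = G d) (hF : D.length * (D.length + 1) ≤ F) :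
    Ter w F selectDivisors σ fun τ =>
      HasList 1 1 τ (D.filter fun d => ∀ d' ∈ D, d ∣ d' → d ≤ G d') := by
  have h1 := hW.one_le
  have b0 := hW.bmod 0 (by omega) (by omega)
  have b1 := hW.bmod 1 (by omega) (by omega)
  refine Ter.assign 0 b0 (Ter.assign 0 b0 (Ter.assign 0 b0 (Ter.assign 1 b1 (Ter.cons ?_))))
  refine (Ter.loop (F₁ := 0) (α := ℕ × ℕ) (fun a τ => a.1 ≤ D.length ∧ a.2 ≤ D.length ∧
      τ.reg 3 = a.1 ∧ τ.reg 4 = a.2 ∧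
      (∀ h : a.1 < D.length, τ.reg 5 ≠ 0 ↔ ∀ d' ∈ D.take a.2, D[a.1] ∣ d' → D[a.1] ≤ G d') ∧
      HasList 1 1 τ ((D.take a.1).filter fun d => ∀ d' ∈ D, d ∣ d' → d ≤ G d'))
    -- Each candidate takes one round per divisor and one closing round that outputs it or not and
    -- resets the flag.
    (fun a => (D.length - a.1) * (D.length + 1) - a.2) (0, 0)
    ⟨by simp, by simp, by simp, by simp, by simp, by simp [HasList]⟩ (by simp; omega)
    ?_).mono_frame ?_
  · rintro ⟨a, b⟩ τ hf ⟨ha, hb, g3, g4, g5, hL⟩ hc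
    dsimp only at ha hb g3 g4 g5 hL
    have g11 : τ.reg 11 = D.length := by rw [hf.1 11 (by decide)]; simpa using hD.1
    have a11 : ∀ j (h : j < D.length), τ.arr 11 j = D[j] := by
      rw [hf.2 11 (by decide)]
      simpa using hD.2
    have a12 : ∀ d ∈ D, τ.arr 12 (d : ℕ) = G d := by
      rw [hf.2 12 (by decide)]
      simpa using hG
    have haD : a < D.length := by
      by_contra hcon
      apply hc
      simp only [Expr.eval, BinOp.apply, g3, g11, hW.ite]
      rw [if_neg (by omega)]
    have hdec : ∀ b', b < b' → b' ≤ D.length →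
        (D.length - a) * (D.length + 1) - b' < (D.length - a) * (D.length + 1) - b := by
      intro b' hb1 hb2
      have : 1 * (D.length + 1) ≤ (D.length - a) * (D.length + 1) :=
        Nat.mul_le_mul_right _ (by omega)
      omega
    have hdec' : (D.length - (a + 1)) * (D.length + 1) - 0 <
        (D.length - a) * (D.length + 1) - b := by
      have : D.length - a = D.length - (a + 1) + 1 := by omega
      rw [this, add_mul]
      omega
    replace g5 := g5 haD
    have hmemA : D[a] ∈ D := List.getElem_mem _
    refine Ter.assign (D[a] : ℕ) (by simp [Expr.eval, g3, a11 a haD]) ?_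
    refine Ter.branch (fun hc => ?_) (fun hc => ?_) <;>
      simp [Expr.eval, BinOp.apply, g4, g11, hW.ite] at hc
    · have hbD : b < D.length := hc
      have hmemB : D[b] ∈ D := List.getElem_mem _
      have htake : D.take (b + 1) = D.take b ++ [D[b]] := by
        rw [List.take_add_one, List.getElem?_eq_getElem hbD]
        rfl
      have tail : ∀ υ : State, υ.reg 1 = τ.reg 1 → υ.reg 3 = a → υ.reg 4 = b →
          υ.arr 1 = τ.arr 1 → (υ.reg 5 ≠ 0 ↔ τ.reg 5 ≠ 0 ∧ (D[a] ∣ D[b] → D[a] ≤ G D[b])) →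
          Ter w 0 (block [assign 4 (bin .add (reg 4) (const 1))]) υ
          fun τ => Ter w 0 (block []) τ fun υ => ∃ c : ℕ × ℕ, (c.1 ≤ D.length ∧ c.2 ≤ D.length ∧
            υ.reg 3 = c.1 ∧ υ.reg 4 = c.2 ∧ (∀ h : c.1 < D.length, υ.reg 5 ≠ 0 ↔
              ∀ d' ∈ D.take c.2, D[c.1] ∣ d' → D[c.1] ≤ G d') ∧
            HasList 1 1 υ ((D.take c.1).filter fun d => ∀ d' ∈ D, d ∣ d' → d ≤ G d')) ∧
            (D.length - c.1) * (D.length + 1) - c.2 < (D.length - a) * (D.length + 1) - b := by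
        intro υ k1 k3 k4 ka1 k5
        refine Ter.assign (b + 1) ?_ (Ter.nil (Ter.nil ⟨(a, b + 1), ⟨ha, hbD, by simp [k3],
          by simp, fun _ => ?_, ⟨by simp [k1, hL.1], by simpa [ka1] using hL.2⟩⟩,
          hdec _ (by simp) hbD⟩))
        · simp only [Expr.eval, BinOp.apply, k4, b1]
          exact hW.bmod _ (by omega) (by omega)
        · simp only [setReg_reg, show ¬ ((5 : ℕ) = 4) by decide, if_false]
          rw [k5, g5, htake, List.forall_mem_append]
          simp only [List.mem_singleton, forall_eq]
      refine Ter.assign (D[b] : ℕ) (by simp [Expr.eval, g4, a11 b hbD]) ?_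
      refine Ter.branch (fun hc => ?_) (fun hc => ?_) <;>
        rw [eval_mod_eq_zero (x := D[b]) (y := D[a]) hW (hdM _ hmemB) (by simp [Expr.eval])
          (by simp [Expr.eval])] at hc
      · have hd : D[a] ∣ D[b] := by
          by_contra hcon
          rw [if_neg hcon] at hc
          exact hc rfl
        refine Ter.branch (fun hc => ?_) (fun hc => ?_) <;>
          simp [Expr.eval, BinOp.apply, hW.ite, a12 _ hmemB] at hc
        · refine Ter.assign 0 b0 (Ter.nil (Ter.nil (tail _ (by simp) (by simp [g3])
            (by simp [g4]) (by simp) ?_)))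
          simp [hd, hc]
        · refine Ter.nil (Ter.nil (tail _ (by simp) (by simp [g3])
            (by simp [g4]) (by simp) ?_))
          simp [hd, hc]
      · have hd : ¬ D[a] ∣ D[b] := by
          intro hcon
          rw [if_pos hcon] at hc
          exact one_ne_zero hc
        refine Ter.nil (tail _ (by simp) (by simp [g3]) (by simp [g4]) (by simp) ?_)
        simp [hd]
    · have hbD : b = D.length := by omega
      rw [hbD, List.take_length] at g5
      set L := (D.take a).filter fun d => ∀ d' ∈ D, d ∣ d' → d ≤ G d' with hLdef
      have htake : ((D.take (a + 1)).filter fun d => ∀ d' ∈ D, d ∣ d' → d ≤ G d') =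
          L ++ if ∀ d' ∈ D, D[a] ∣ d' → D[a] ≤ G d' then [D[a]] else [] := by
        rw [List.take_add_one, List.getElem?_eq_getElem haD, List.filter_append, ← hLdef]
        congr 1
        by_cases h : ∀ d' ∈ D, D[a] ∣ d' → D[a] ≤ G d'
        · rw [if_pos h]
          exact List.filter_cons_of_pos (by simpa using h)
        · rw [if_neg h]
          exact List.filter_cons_of_neg (by simpa using h)
      have hlenL : L.length ≤ a := (List.length_filter_le _ _).trans (List.length_take_le _ _)
      have tail : ∀ υ : State, υ.reg 3 = a →
          HasList 1 1 υ ((D.take (a + 1)).filter fun d => ∀ d' ∈ D, d ∣ d' → d ≤ G d') →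
          Ter w 0 (block [assign 3 (bin .add (reg 3) (const 1)), assign 4 (const 0),
            assign 5 (const 1)]) υ
          fun τ => Ter w 0 (block []) τ fun υ => ∃ c : ℕ × ℕ, (c.1 ≤ D.length ∧ c.2 ≤ D.length ∧
            υ.reg 3 = c.1 ∧ υ.reg 4 = c.2 ∧ (∀ h : c.1 < D.length, υ.reg 5 ≠ 0 ↔
              ∀ d' ∈ D.take c.2, D[c.1] ∣ d' → D[c.1] ≤ G d') ∧
            HasList 1 1 υ ((D.take c.1).filter fun d => ∀ d' ∈ D, d ∣ d' → d ≤ G d')) ∧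
            (D.length - c.1) * (D.length + 1) - c.2 < (D.length - a) * (D.length + 1) - b := by
        intro υ k3 kL
        refine Ter.assign (a + 1) ?_ (Ter.assign 0 b0 (Ter.assign 1 b1 (Ter.nil (Ter.nil
          ⟨(a + 1, 0), ⟨haD, by simp, by simp, by simp, by simp, ⟨by simpa using kL.1,
          by simpa using kL.2⟩⟩, hdec'⟩))))
        simp only [Expr.eval, BinOp.apply, k3, b1]
        exact hW.bmod _ (by omega) (by omega)
      refine Ter.branch (fun hc => ?_) (fun hc => ?_) <;> simp [Expr.eval] at hc
      · rw [if_pos (g5.1 hc)] at htake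
        refine Ter.write L.length (D[a] : ℕ) (by simp [Expr.eval, hL.1]) (by simp [Expr.eval])
          (Ter.assign (L.length + 1) ?_ (Ter.nil (tail _ (by simp [g3]) ?_)))
        · simp only [Expr.eval, BinOp.apply, setArr_reg, setReg_reg,
            show ¬ ((1 : ℕ) = 6) by decide, if_false, hL.1, b1]
          exact hW.bmod _ (by omega) (by omega)
        · rw [htake]
          exact hL.append (by simp) (by simp)
      · rw [if_neg (by rw [← g5]; simpa using hc), List.append_nil] at htake
        refine Ter.nil (tail _ (by simp [g3]) ?_)
        rw [htake]
        exact ⟨by simp [hL.1], by simpa using hL.2⟩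
  · rintro τ hf ⟨⟨a, b⟩, ⟨ha, hb, g3, g4, g5, hL⟩, hc⟩
    dsimp only at ha hb g3 g4 g5 hL
    have g11 : τ.reg 11 = D.length := by rw [hf.1 11 (by decide)]; simpa using hD.1
    have haD : a = D.length := by
      by_contra hcon
      simp only [Expr.eval, BinOp.apply, g3, g11, hW.ite] at hc
      rw [if_pos (by omega)] at hc
      exact one_ne_zero hc
    rw [haD, List.take_length] at hL
    exact Ter.nil hL

end WordRAM

/-! ### Word size, constants and assembly. -/

namespace WordRAM
open WordRAM.Expr WordRAM.Prog

theorem fits_of_two_mul_lt {w : ℕ} {M : ℤ} (h1 : 1 ≤ M) (h : 2 * M < 2 ^ w) : Fits w M := by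
  refine ⟨h1, fun x hx hx' => Int.bmod_eq_of_le_mul_two ?_ ?_⟩ <;> push_cast <;> omega

theorem exists_fits {w k n : ℕ} (hw : (n + 2) ^ (k + 6) ≤ 2 ^ w) :
    ∃ M : ℤ, Fits w M ∧ 3 * ((n : ℤ) + 1) ^ k * (n + 2) ≤ M ∧ ((n : ℤ) + 2) * (n + 2) ≤ M := by
  have h₁ : (((n + 2) ^ (k + 6) : ℕ) : ℤ) ≤ ((2 ^ w : ℕ) : ℤ) := by exact_mod_cast hw
  push_cast at h₁
  have hx : (2 : ℤ) ≤ (n : ℤ) + 2 := by omega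
  have hA : ((n : ℤ) + 1) ^ k ≤ ((n : ℤ) + 2) ^ k := pow_le_pow_left₀ (by omega) (by omega) k
  have hA0 : (1 : ℤ) ≤ ((n : ℤ) + 1) ^ k := one_le_pow₀ (by omega)
  generalize ((n : ℤ) + 1) ^ k = A at hA hA0 ⊢
  have hpow : ((n : ℤ) + 2) ^ (k + 6) = ((n : ℤ) + 2) ^ k * ((n + 2) ^ 4 * (n + 2) ^ 2) := by ring
  rw [hpow] at h₁
  generalize ((n : ℤ) + 2) ^ k = B at hA h₁
  generalize (n : ℤ) + 2 = x at hx h₁ ⊢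
  have h2 : 4 ≤ x ^ 2 := by nlinarith
  have h4 : 4 * x ^ 2 ≤ x ^ 4 := by nlinarith
  have hB4 : x ^ 4 ≤ B * x ^ 4 := le_mul_of_one_le_left (by positivity) (by omega)
  -- The exponent `k + 6` leaves a spare factor `x ^ 2 ≥ 4` for the sign, while `x ^ 4` absorbs the
  -- constants and products formed by the program.
  refine ⟨B * x ^ 4, fits_of_two_mul_lt (by omega) ?_, ?_, by nlinarith⟩
  · nlinarith
  · have : 3 * x ≤ x ^ 4 := by nlinarith
    calc 3 * A * x = A * (3 * x) := by ring
      _ ≤ B * x ^ 4 := mul_le_mul hA this (by omega) (by omega)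

/-- This bounds the passes of radix sort by `k + 2`, the only place where the polynomial bound on
the alphabet affects the running time. -/
theorem lt_pow_add_two {D : ℕ} {n k : ℕ} (h : (D : ℤ) ≤ 2 * ((n : ℤ) + 1) ^ k) :
    D < (n + 2) ^ (k + 2) := by
  have h' : D ≤ 2 * (n + 1) ^ k := by exact_mod_cast h
  have h₁ : (n + 1) ^ k ≤ (n + 2) ^ k := Nat.pow_le_pow_left (by omega) k
  have h₂ : 0 < (n + 2) ^ k := by positivity
  have h₃ : (n + 2) ^ (k + 2) = (n + 2) ^ k * ((n + 2) * (n + 2)) := by ring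
  have h₄ : 4 ≤ (n + 2) * (n + 2) := by nlinarith
  have h₅ : (n + 2) ^ k * 4 ≤ (n + 2) ^ k * ((n + 2) * (n + 2)) := Nat.mul_le_mul_left _ h₄
  omega

/-- Compute the neighbours of every position among the previous ones. -/
def neighbours : Prog := block [minMax, shift, radixSort, linkList, unlink]

variable {w n k F : ℕ} {M : ℤ} {σ : State} {s : ℕ → ℤ}

theorem neighbours_spec (hW : Fits w M) (hM : 3 * ((n : ℤ) + 1) ^ k * (n + 2) ≤ M)
    (h0 : σ.reg 0 = n) (h3 : σ.reg 3 = 0) (h4 : σ.reg 4 = 0) (h0s : ∀ i : ℕ, σ.arr 0 i = s i)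
    (hs : ∀ i < n, |s i| ≤ ((n : ℤ) + 1) ^ k) (hF : 3 * (k + 3) * (n + 1) ≤ F) :
    Ter w F neighbours σ fun τ => ∃ κ : ℕ → ℕ,
      (∀ a < n, ∀ b < n, κ a < κ b ↔ s a < s b ∨ s a = s b ∧ a < b) ∧
      ∀ y < n, IsNeighbour (fun x y => κ x < κ y) (y + 1) y (τ.arr 6 y) ∧
        IsNeighbour (fun x y => κ y < κ x) (y + 1) y (τ.arr 7 y) := by
  have hA0 : (1 : ℤ) ≤ ((n : ℤ) + 1) ^ k := one_le_pow₀ (by omega)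
  obtain ⟨A, hA⟩ : ∃ A : ℤ, ((n : ℤ) + 1) ^ k = A := ⟨_, rfl⟩
  have hAM : 3 * A ≤ M := by rw [← hA]; nlinarith
  have hnM : (n : ℤ) + 2 ≤ M := by nlinarith
  have hnF : n ≤ F := by nlinarith
  have hnF' : (n + 3) * (k + 2 + 1) ≤ F + 1 := by nlinarith
  refine Ter.cons ((minMax_spec (n := n) (A := A) (s := s) hW (by omega) h0 h3 h4 h0s (by omega)
    (fun i hi => abs_le.1 (hA ▸ hs i hi)) hnF).mono_frame fun τ₁ f₁ q₁ => ?_)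
  obtain ⟨p₁, p₂, p₃, p₄, p₅⟩ := q₁
  have r₁ : τ₁.reg 0 = n := by rw [f₁.1 0 (by decide), h0]
  have a₁ : ∀ i : ℕ, τ₁.arr 0 i = s i := by rw [f₁.2 0 (by decide)]; exact h0s
  obtain ⟨m, hm⟩ : ∃ m, τ₁.reg 3 = m := ⟨_, rfl⟩
  obtain ⟨D, hD⟩ : ∃ D : ℕ, τ₁.reg 4 - τ₁.reg 3 = D :=
    ⟨(τ₁.reg 4 - τ₁.reg 3).toNat, by omega⟩
  refine Ter.cons ((shift_spec (n := n) (s := s) (m := m) hW (by omega) r₁ hm a₁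
    (fun i hi => by have := p₅ i hi; omega) hnF).mono_frame fun τ₂ f₂ q₂ => ?_)
  have r₂ : τ₂.reg 0 = n := by rw [f₂.1 0 (by decide), r₁]
  obtain ⟨v, hv⟩ : ∃ v : ℕ → ℕ, ∀ y < n, (v y : ℤ) = s y - m :=
    ⟨fun y => (s y - m).toNat, fun y hy => by
      have := p₅ y hy
      exact Int.toNat_of_nonneg (by omega)⟩
  have hDA : (D : ℤ) ≤ 2 * A := by omega
  have hDM : ((D : ℤ) + 1) * (n + 2) ≤ M := by rw [hA] at hM; nlinarith
  have hDN : D < (n + 2) ^ (k + 2) := lt_pow_add_two (hA ▸ hDA)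
  have hD₂ : τ₂.reg 4 - τ₂.reg 3 = D := by
    rw [f₂.1 4 (by decide), f₂.1 3 (by decide), hD]
  refine Ter.cons ((radixSort_spec (n := n) (v := v) (D := D) (N := k + 2) hW hnM
    hDM r₂ hD₂ hDN (fun y hy => by rw [q₂.1 y hy, hv y hy])
    (fun y hy => by have := p₅ y hy; have := hv y hy; omega) q₂.2 hnF').mono_frame
    fun τ₃ f₃ q₃ => ?_)
  have r₃ : τ₃.reg 0 = n := by rw [f₃.1 0 (by decide), r₂]
  -- A key that orders positions by letter and then by position.
  obtain ⟨κ, hκ⟩ : ∃ κ : ℕ → ℕ, κ = fun y => v y * n + y := ⟨_, rfl⟩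
  rw [← hκ] at q₃
  have hκs : ∀ a < n, ∀ b < n, κ a < κ b ↔ s a < s b ∨ s a = s b ∧ a < b := by
    intro a ha b hb
    rw [hκ, mul_add_lt_mul_add_iff hb ha]
    have h₁ := hv a ha
    have h₂ := hv b hb
    omega
  have hinj : ∀ a < n, ∀ b < n, κ a = κ b → a = b := by
    intro a ha b hb h
    have h₁ := hκs a ha b hb
    have h₂ := hκs b hb a ha
    omega
  refine Ter.cons ((linkList_spec (n := n) (κ := κ) hW (by omega) r₃ hinj q₃
    hnF).mono_frame fun τ₄ f₄ q₄ => ?_)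
  have r₄ : τ₄.reg 0 = n := by rw [f₄.1 0 (by decide), r₃]
  exact Ter.cons ((unlink_spec (n := n) (κ := κ) hW (by omega) r₄ hinj q₄ hnF).mono
    fun τ₅ q₅ => Ter.nil ⟨κ, hκs, q₅⟩)

/-- The program listing all full op-periods. -/
def fullOpPeriods : Prog := block [neighbours, opPref, gcdSieve, listDivisors, classMin,
  selectDivisors]

/-- The factor covers every phase: the neighbours ask for `3 * (k + 3) * (n + 1)`, the prefix table
for `3 * n`, the sieve for `2 * n`, and the pairs of divisors for at most `5 * n`. -/
theorem fullOpPeriods_spec {S : List ℤ}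
    (hS : ∀ x ∈ S, |x| ≤ ((S.length : ℤ) + 1) ^ k) (hw : (S.length + 2) ^ (k + 6) ≤ 2 ^ w)
    (hF : 15 * (k + 3) * (S.length + 1) ≤ F) :
    Ter w F fullOpPeriods (inputState S) fun τ => ∃ L : List ℕ, HasOutput τ L ∧ L.Nodup ∧
      ∀ p : ℕ, p ∈ L ↔ IsFullOpPeriod S p := by
  obtain ⟨n, hn⟩ : ∃ n, S.length = n := ⟨_, rfl⟩
  obtain ⟨s, hs⟩ : ∃ s : ℕ → ℤ, s = fun i => S.getD i 0 := ⟨_, rfl⟩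
  rw [hn] at hS hw hF
  obtain ⟨M, hW, hM, hM2⟩ := exists_fits hw
  have hnM : (n : ℤ) + 2 ≤ M := by nlinarith
  have hn2M : (n : ℤ) * n ≤ M := by nlinarith
  have hF15 : 15 * (n + 1) ≤ F := by nlinarith
  have hnF : n ≤ F := by omega
  have z0 : (inputState S).reg 0 = n := by simp [inputState, hn]
  have za : ∀ i : ℕ, (inputState S).arr 0 i = s i := fun i => by simp [inputState, hs]
  have z10 : ∀ i : ℕ, (inputState S).arr 10 i = 0 := fun i => by simp [inputState]
  have hsA : ∀ i < n, |s i| ≤ ((n : ℤ) + 1) ^ k := fun i hi => by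
    refine hS _ ?_
    simp only [hs]
    rw [List.getD_eq_getElem _ _ (by omega)]
    exact List.getElem_mem _
  refine Ter.cons ((neighbours_spec (n := n) (s := s) hW hM z0 (by simp [inputState])
    (by simp [inputState]) za hsA (by nlinarith)).mono_frame fun τ₅ f₅ q₅ => ?_)
  obtain ⟨κ, hκs, q₅⟩ := q₅
  have r₅ : τ₅.reg 0 = n := by rw [f₅.1 0 (by decide), z0]
  have a₅ : ∀ i : ℕ, τ₅.arr 0 i = s i := by rw [f₅.2 0 (by decide)]; exact za
  refine Ter.cons ((opPref_spec (n := n) (κ := κ) (s := s) hW (by omega) r₅ a₅ hκs q₅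
    (by omega)).mono_frame fun τ₆ f₆ q₆ => ?_)
  have r₆ : τ₆.reg 0 = n := by rw [f₆.1 0 (by decide), r₅]
  -- The sieve reads zero as unmarked, so array `10` must be untouched by the earlier phases.
  have z₆ : ∀ i : ℕ, τ₆.arr 10 i = 0 := by
    rw [f₆.2 10 (by decide), f₅.2 10 (by decide)]
    exact z10
  choose! Z hZ using q₆
  refine Ter.cons ((gcdSieve_spec (n := n) hW (by omega) hn2M r₆ z₆ (by omega)).mono_frame
    fun τ₇ f₇ q₇ => ?_)
  have r₇ : τ₇.reg 0 = n := by rw [f₇.1 0 (by decide), r₆]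
  refine Ter.cons ((listDivisors_spec (n := n) hW (by omega) r₇ hnF).mono_frame
    fun τ₈ f₈ q₈ => ?_)
  have r₈ : τ₈.reg 0 = n := by rw [f₈.1 0 (by decide), r₇]
  refine Ter.cons ((classMin_spec (n := n) (Z := Z) hW (by omega) r₈ (fun j hj hj1 => by
      rw [f₈.2 8 (by decide), f₇.2 8 (by decide), (hZ j hj hj1).1]) (fun j hj hj1 => by
      rw [f₈.2 10 (by decide), q₇ j hj1 hj.le]) q₈.2 hnF).mono_frame fun τ₉ f₉ q₉ => ?_)
  choose! G hG using q₉
  have hlen := length_divisorList_le n n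
  have hlen2 := length_divisorList_sq_le n
  refine Ter.cons ((selectDivisors_spec (D := divisorList n n) (G := G) hW (by omega) ?_
    (fun d hd => by have := (mem_divisorList.1 hd).1; omega)
    (fun d hd => (hG d (mem_divisorList.1 hd).1).1) (by rw [mul_add]; omega)).mono
    fun τ hτ => Ter.nil ⟨_, ⟨hτ.1, fun j => hτ.2 j j.2⟩,
      (nodup_divisorList n n).filter _, fun p => ?_⟩)
  · exact ⟨(f₉.1 11 (by decide)).trans q₈.1.1, fun j hj => by
      rw [f₉.2 11 (by decide)]; exact q₈.1.2 j hj⟩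
  rw [isFullOpPeriod_iff, List.mem_filter, mem_divisorList, hn, ← hs]
  simp only [decide_eq_true_eq]
  -- Divisibility gives `j + p ≤ n`, so the table entry is not cut off by the end of the string.
  have hmatch : ∀ j < n, 1 ≤ j → p ∣ j → p ∣ n → (OpMatch s j p ↔ p ≤ Z j) := by
    intro j hj hj1 hpj hpn
    refine (hZ j hj hj1).2.opMatch_iff ?_
    have := Nat.le_of_dvd (by omega) (Nat.dvd_sub hpn hpj)
    omega
  constructor
  · rintro ⟨⟨hpn, hd⟩, H⟩
    refine ⟨Nat.pos_of_dvd_of_pos hd (by omega), hpn, hd, fun j hj hj1 hpj => ?_⟩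
    refine (hmatch j hj hj1 hpj hd).2 ?_
    -- The class of `j` is a proper divisor of `n` and a multiple of `p`, so it is among the tested
    -- ones.
    have hgn : Nat.gcd j n < n := (Nat.gcd_le_left _ hj1).trans_lt hj
    exact ((hG _ hgn).2 p hpn.le).1 (H _ (mem_divisorList.2 ⟨hgn, Nat.gcd_dvd_right _ _⟩)
      (Nat.dvd_gcd hpj hd)) j hj hj1 rfl
  · rintro ⟨hp, hpn, hd, H⟩
    refine ⟨⟨hpn, hd⟩, fun d' hd' hpd' => ?_⟩
    refine ((hG d' (mem_divisorList.1 hd').1).2 p hpn.le).2 fun j hj hj1 hgcd => ?_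
    have hpj : p ∣ j := hpd'.trans (hgcd ▸ Nat.gcd_dvd_left _ _)
    exact (hmatch j hj hj1 hpj hd).1 (H j hj hj1 hpj)

end WordRAM

/-- All full op-periods of a string of length `n` over a polynomially bounded integer alphabet can
be computed in `O(n)` time on the word RAM with words of `w ≥ c · log₂ (n + 2)` bits: one program
works for all inputs, and `c` and the constant `C` of the time bound depend only on the
exponent `k` bounding the alphabet. -/
theorem mainTheorem6 :
    ∃ P : WordRAM.Prog, ∀ k : ℕ, ∃ C c : ℕ, ∀ (w : ℕ) (S : List ℤ),
      (∀ x ∈ S, |x| ≤ ((S.length : ℤ) + 1) ^ k) →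
      (S.length + 2) ^ c ≤ 2 ^ w →
      ∃ (t : ℕ) (τ : WordRAM.State) (L : List ℕ),
        WordRAM.Run w P (WordRAM.inputState S) t τ ∧
        t ≤ C * (S.length + 1) ∧
        WordRAM.HasOutput τ L ∧
        L.Nodup ∧ ∀ p : ℕ, p ∈ L ↔ IsFullOpPeriod S p := by
  refine ⟨WordRAM.fullOpPeriods, fun k => ⟨WordRAM.fullOpPeriods.cost * (16 * (k + 3)), k + 6,
    fun w S hS hw => ?_⟩⟩
  obtain ⟨t, τ, hrun, ht, L, hL⟩ := WordRAM.fullOpPeriods_spec hS hw le_rfl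
  refine ⟨t, τ, L, hrun, ht.trans ?_, hL⟩
  rw [mul_assoc WordRAM.fullOpPeriods.cost]
  refine Nat.mul_le_mul_left _ ?_
  -- Passing from `15` to `16` absorbs the `+ 1` of the factor `F + 1`.
  nlinarith
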